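/- Let $\Gamma\subset\mathbb C$ be a lattice of rank two with invariants $g_2=60\sum_{\omega\in\Gamma\setminus 0}\omega^{-4}$, $g_3=140\sum_{\omega\in\Gamma\setminus 0}\omega^{-6}$, Weierstrass function $\wp$ and zeta function $\zeta(z)=\frac1z+\sum_{\omega\in\Gamma\setminus 0}\left(\frac1{z-\omega}+\frac1\omega+\frac z{\omega^2}\right)$. Let $\mathcal F$ be the space of elliptic functions with respect to $\Gamma$ that are holomorphic outside $\Gamma$, and for $N\in\mathbb N$ let $\mathcal F_N\subset\mathcal F$ be the subspace of functions with poles of order at most $N$ on $\Gamma$. Let $S^*\mathcal F$ be the symmetric (polynomial) algebra of $\mathcal F$; an element of $S^2\mathcal F$ is regarded as a symmetric function of two variables, the product $fg$ of $f,g\in\mathcal F$ corresponding to $(x,y)\mapsto f(x)g(y)+f(y)g(x)$. Let $n\in\mathbb C$. (a) There is exactly one Poisson bracket on $S^*\mathcal F$ such that for all $f,g\in\mathcal F$ the element $\{f,g\}$ lies in $S^2\mathcal F$ and, for $x,y,x-y\notin\Gamma$, $$\{f,g\}(x,y)=n\bigl(\zeta(x-y)-\zeta(x)+\zeta(y)\bigr)\bigl(f(x)g(y)-f(y)g(x)\bigr)-f'(x)g(y)-f'(y)g(x)+f(x)g'(y)+f(y)g'(x).$$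 (b) If $n\in\mathbb N$, then $\{\mathcal F_n,\mathcal F_n\}\subset S^2\mathcal F_n$, and there is exactly one Poisson bracket on $S^*\mathcal F_n$ for which the canonical map $S^*\mathcal F_n\to S^*\mathcal F$ preserves brackets. (c) The functions $e_{2a}=\wp^a$ and $e_{2a+3}=-\frac12\wp^a\wp'$ $(a\in\mathbb Z_{\ge0})$ form a basis of $\mathcal F$, and for all $\alpha,\beta\in\{0,2,3,4,\dots\}$ $$\{e_\alpha,e_\beta\}=\{e_\alpha,e_\beta\}_1+g_2\{e_\alpha,e_\beta\}_2+g_3\{e_\alpha,e_\beta\}_3 .$$ Here, with the formal sums $S_k(e_a,e_b)=\sum_{r\ge0}e_{a+kr}e_{b-kr}$ in commuting variables $e_a$ $(a\in\mathbb Z)$, the skew-symmetric expressions $\{\,,\}_i$ are given by $$\{e_\alpha,e_\beta\}_1=\tfrac n2\bigl(S_1(e_{\alpha+1},e_\beta)-S_1(e_{\beta+1},e_\alpha)\bigr)+(\alpha-n)e_{\alpha+1}e_\beta-(\beta-n)e_\alpha e_{\beta+1},$$ $$\{e_{2\alpha},e_{2\beta}\}_2=\{e_{2\alpha},e_{2\beta}\}_3=0,$$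 $$\{e_{2\alpha},e_{2\beta+3}\}_2=\tfrac n8\bigl(S_2(e_{2\beta+2},e_{2\alpha-2})-S_2(e_{2\alpha},e_{2\beta})\bigr)+\tfrac14(2\beta+1)e_{2\alpha}e_{2\beta},$$ $$\{e_{2\alpha+3},e_{2\beta+3}\}_2=\tfrac n4\bigl(S_2(e_{2\beta+2},e_{2\alpha+1})-S_2(e_{2\alpha+2},e_{2\beta+1})\bigr)-\tfrac14(2\alpha+1)e_{2\alpha}e_{2\beta+3}+\tfrac14(2\beta+1)e_{2\alpha+3}e_{2\beta},$$ $$\{e_{2\alpha},e_{2\beta+3}\}_3=\tfrac n8\bigl(S_2(e_{2\beta},e_{2\alpha-2})-S_2(e_{2\alpha},e_{2\beta-2})\bigr)+\tfrac12\beta\, e_{2\alpha}e_{2\beta-2},$$ $$\{e_{2\alpha+3},e_{2\beta+3}\}_3=\tfrac n4\bigl(S_2(e_{2\beta},e_{2\alpha+1})-S_2(e_{2\alpha},e_{2\beta+1})\bigr)-\tfrac12\alpha\, e_{2\alpha-2}e_{2\beta+3}+\tfrac12\beta\, e_{2\alpha+3}e_{2\beta-2};$$ for indices in $\{0,2,3,\dots\}$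 each of them reduces to a polynomial in $e_0,e_2,e_3,\dots$. -/

import Mathlib

noncomputable section

namespace OdesskiiElliptic

/-! ### Elliptic functions -/

/-- The space `𝓕` of elliptic functions (meromorphic, periodic with respect to the lattice `Γ`)
that are holomorphic outside `Γ`. Such a function is really a function on `ℂ ∖ Γ`; it is
represented by its extension by `0` to the points of `Γ`. -/
def ellipticSpace (L : PeriodPair) : Submodule ℂ (ℂ → ℂ) where
  carrier := {f | (∀ z, MeromorphicAt f z) ∧
    DifferentiableOn ℂ f ((L.lattice : Set ℂ)ᶜ) ∧
    (∀ w ∈ L.lattice, Function.Periodic f w) ∧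
    (∀ w ∈ L.lattice, f w = 0)}
  add_mem' := by
    rintro f g ⟨hf1, hf2, hf3, hf4⟩ ⟨hg1, hg2, hg3, hg4⟩
    refine ⟨fun z => (hf1 z).add (hg1 z), hf2.add hg2, fun w hw => (hf3 w hw).add (hg3 w hw),
      fun w hw => ?_⟩
    simp [hf4 w hw, hg4 w hw]
  zero_mem' := by
    refine ⟨fun z => MeromorphicAt.const 0 z, differentiableOn_const 0, fun w _ z => rfl,
      fun w _ => rfl⟩
  smul_mem' := by
    rintro c f ⟨hf1, hf2, hf3, hf4⟩
    refine ⟨fun z => (MeromorphicAt.const c z).smul (hf1 z), hf2.const_smul c,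
      fun w hw => (hf3 w hw).smul c, fun w hw => ?_⟩
    simp [hf4 w hw]

/-- The subspace `𝓕_N ⊆ 𝓕` of functions with poles of order at most `N` on `Γ`. -/
def ellipticSpaceLE (L : PeriodPair) (N : ℕ) : Submodule ℂ (ellipticSpace L) where
  carrier := {f | ∀ w ∈ L.lattice, ((-(N : ℤ) : ℤ) : WithTop ℤ) ≤ meromorphicOrderAt (f : ℂ → ℂ) w}
  add_mem' := by
    intro f g hf hg w hw
    exact (le_min (hf w hw) (hg w hw)).trans
      (meromorphicOrderAt_add (f.2.1 w) (g.2.1 w))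
  zero_mem' := by
    intro w _
    have h : meromorphicOrderAt (((0 : ellipticSpace L) : ℂ → ℂ)) w = ⊤ := by
      rw [meromorphicOrderAt_eq_top_iff]
      exact Filter.Eventually.of_forall fun _ => rfl
    rw [h]
    exact le_top
  smul_mem' := by
    intro c f hf w hw
    have h : meromorphicOrderAt ((c • f : ellipticSpace L) : ℂ → ℂ) w
        = meromorphicOrderAt (fun _ : ℂ => c) w + meromorphicOrderAt (f : ℂ → ℂ) w :=
      meromorphicOrderAt_smul (MeromorphicAt.const c w) (f.2.1 w)
    have h0 : 0 ≤ meromorphicOrderAt (fun _ : ℂ => c) w :=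
      (analyticAt_const).meromorphicOrderAt_nonneg
    rw [h]
    exact (hf w hw).trans (le_add_of_nonneg_left h0)

/-- The Weierstrass zeta function
`ζ(z) = 1/z + ∑_{ω ∈ Γ, ω ≠ 0} (1/(z-ω) + 1/ω + z/ω²)`. -/
def weierstrassZeta (L : PeriodPair) (z : ℂ) : ℂ :=
  1 / z + ∑' w : {w : L.lattice // w ≠ 0},
    (1 / (z - (w : L.lattice)) + 1 / ((w : L.lattice) : ℂ) + z / ((w : L.lattice) : ℂ) ^ 2)

/-- Index set of the basis: `Sum.inl a` stands for the index `2a`, `Sum.inr a` for `2a+3`. Thus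
the indices are `0` and all integers `≥ 2`. -/
abbrev BasisIndex : Type := ℕ ⊕ ℕ

/-- The integer which an element of `BasisIndex` stands for. -/
def BasisIndex.toInt : BasisIndex → ℤ
  | Sum.inl a => 2 * (a : ℤ)
  | Sum.inr a => 2 * (a : ℤ) + 3

/-- The functions `e_{2a} = ℘^a` and `e_{2a+3} = -(1/2) ℘^a ℘'` (meaningful off `Γ`). -/
def eFun (L : PeriodPair) : BasisIndex → ℂ → ℂ
  | Sum.inl a => fun z => L.weierstrassP z ^ a
  | Sum.inr a => fun z => -(1 / 2) * L.weierstrassP z ^ a * L.derivWeierstrassP z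

/-! ### Poisson brackets -/

/-- A Poisson bracket on a commutative `ℂ`-algebra: a bilinear operation that is alternating,
a derivation in each argument, and satisfies the Jacobi identity. -/
structure IsPoissonBracket {A : Type*} [CommRing A] [Algebra ℂ A]
    (br : A →ₗ[ℂ] A →ₗ[ℂ] A) : Prop where
  alternating : ∀ a, br a a = 0
  leibniz : ∀ a b c, br a (b * c) = br a b * c + b * br a c
  jacobi : ∀ a b c, br a (br b c) + br b (br c a) + br c (br a b) = 0

/-- The polynomial algebra `S^*𝓕`. -/
abbrev SymF (L : PeriodPair) : Type := SymmetricAlgebra ℂ (ellipticSpace L)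

/-- The canonical inclusion `𝓕 → S^*𝓕`. -/
abbrev inc (L : PeriodPair) : ellipticSpace L →ₗ[ℂ] SymF L :=
  SymmetricAlgebra.ι ℂ (ellipticSpace L)

/-- The linear form `f ↦ f(x)` on `𝓕`. -/
def evalAt (L : PeriodPair) (x : ℂ) : ellipticSpace L →ₗ[ℂ] ℂ :=
  (LinearMap.proj x).comp (ellipticSpace L).subtype

/-- The value at `(x, y)` of the symmetric function of two variables that corresponds to the
degree two part of `q ∈ S^*𝓕`; here the product `f g ∈ S²𝓕` corresponds to the function
`(x, y) ↦ f(x) g(y) + f(y) g(x)` (see `evalPair_mul`). It is the coefficient of `ψ₀ψ₁` in the image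
of `q` under the algebra map `f ↦ f(x) ψ₀ + f(y) ψ₁`. -/
def evalPair (L : PeriodPair) (x y : ℂ) (q : SymF L) : ℂ :=
  MvPolynomial.coeff (Finsupp.single 0 1 + Finsupp.single 1 1)
    (SymmetricAlgebra.lift
      ((evalAt L x).smulRight (MvPolynomial.X 0 : MvPolynomial (Fin 2) ℂ) +
        (evalAt L y).smulRight (MvPolynomial.X 1 : MvPolynomial (Fin 2) ℂ)) q)

theorem evalPair_mul (L : PeriodPair) (x y : ℂ) (f g : ellipticSpace L) :
    evalPair L x y (inc L f * inc L g)
      = (f : ℂ → ℂ) x * (g : ℂ → ℂ) y + (f : ℂ → ℂ) y * (g : ℂ → ℂ) x := by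
  have h01 : (Finsupp.single (0 : Fin 2) 1 + Finsupp.single 1 1 : Fin 2 →₀ ℕ) ≠
      Finsupp.single 0 1 + Finsupp.single 0 1 := by
    intro h
    simpa using DFunLike.congr_fun h 1
  have h11 : (Finsupp.single (0 : Fin 2) 1 + Finsupp.single 1 1 : Fin 2 →₀ ℕ) ≠
      Finsupp.single 1 1 + Finsupp.single 1 1 := by
    intro h
    simpa using DFunLike.congr_fun h 0
  have key : ∀ a b c d : ℂ, MvPolynomial.coeff (Finsupp.single 0 1 + Finsupp.single 1 1)
      ((a • (MvPolynomial.X 0 : MvPolynomial (Fin 2) ℂ) + b • MvPolynomial.X 1) *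
        (c • MvPolynomial.X 0 + d • MvPolynomial.X 1)) = a * d + b * c := by
    intro a b c d
    have hX : ∀ (i j : Fin 2), (MvPolynomial.X i * MvPolynomial.X j : MvPolynomial (Fin 2) ℂ)
        = MvPolynomial.monomial (Finsupp.single i 1 + Finsupp.single j 1) 1 := by
      intro i j
      simp [MvPolynomial.X, MvPolynomial.monomial_mul]
    simp only [add_mul, mul_add, smul_mul_smul_comm, hX, MvPolynomial.coeff_add,
      MvPolynomial.coeff_smul, MvPolynomial.coeff_monomial]
    rw [if_neg h01.symm, if_neg h11.symm, add_comm (Finsupp.single (1 : Fin 2) 1)]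
    simp [add_comm]
  simp only [evalPair, map_mul, SymmetricAlgebra.lift_ι_apply, LinearMap.add_apply,
    LinearMap.smulRight_apply, key]
  rfl

/-- The right-hand side of the formula for the bracket of `f, g ∈ 𝓕`, as a function of `x, y`:
`n (ζ(x-y) - ζ(x) + ζ(y)) (f(x)g(y) - f(y)g(x)) - f'(x)g(y) - f'(y)g(x) + f(x)g'(y) + f(y)g'(x)`. -/
def bracketFun (L : PeriodPair) (n : ℂ) (f g : ℂ → ℂ) (x y : ℂ) : ℂ :=
  n * (weierstrassZeta L (x - y) - weierstrassZeta L x + weierstrassZeta L y)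
      * (f x * g y - f y * g x)
    - deriv f x * g y - deriv f y * g x + f x * deriv g y + f y * deriv g x

/-- `br` is a Poisson bracket on `S^*𝓕` which maps `𝓕 × 𝓕` to `S²𝓕` and is given there by
`bracketFun`. -/
structure IsEllipticBracket (L : PeriodPair) (n : ℂ)
    (br : SymF L →ₗ[ℂ] SymF L →ₗ[ℂ] SymF L) : Prop where
  poisson : IsPoissonBracket br
  mem_sq : ∀ f g : ellipticSpace L, br (inc L f) (inc L g) ∈ LinearMap.range (inc L) ^ 2
  formula : ∀ f g : ellipticSpace L, ∀ x y : ℂ,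
    x ∉ L.lattice → y ∉ L.lattice → x - y ∉ L.lattice →
      evalPair L x y (br (inc L f) (inc L g)) = bracketFun L n f g x y

/-- The image of `𝓕_N` in `S^*𝓕`. -/
def incLE (L : PeriodPair) (N : ℕ) : Submodule ℂ (SymF L) :=
  (ellipticSpaceLE L N).map (inc L)

/-- The canonical algebra map `S^*𝓕_N → S^*𝓕`. -/
def symIncl (L : PeriodPair) (N : ℕ) :
    SymmetricAlgebra ℂ (ellipticSpaceLE L N) →ₐ[ℂ] SymF L :=
  SymmetricAlgebra.lift ((inc L).comp (ellipticSpaceLE L N).subtype)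

/-! ### The three brackets in coordinates

They are written as formal (a priori infinite) sums of monomials in variables `e_α`, `α ∈ ℤ`. -/

/-- The variable `e_α`, `α ∈ ℤ`. -/
def eVar (a : ℤ) : MvPowerSeries ℤ ℂ := MvPowerSeries.X a

/-- `S_k(e_a, e_b) = ∑_{r ≥ 0} e_{a+kr} e_{b-kr}`, a formal sum of monomials, given by its
coefficients (for `k ≥ 1` every monomial occurs only finitely often). -/
def formalS (k : ℕ) (a b : ℤ) : MvPowerSeries ℤ ℂ := fun m =>
  ∑ᶠ r : ℕ, MvPowerSeries.coeff m (eVar (a + k * r) * eVar (b - k * r))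

/-- `{e_α, e_β}_1` for `α, β ∈ ℤ`. -/
def coordBracketOne (n : ℂ) (α β : ℤ) : MvPowerSeries ℤ ℂ :=
  (n / 2) • (formalS 1 (α + 1) β - formalS 1 (β + 1) α)
    + ((α : ℂ) - n) • (eVar (α + 1) * eVar β)
    - ((β : ℂ) - n) • (eVar α * eVar (β + 1))

/-- `{e_{2α}, e_{2β+3}}_2`. -/
def coordBracketTwoEvenOdd (n : ℂ) (α β : ℤ) : MvPowerSeries ℤ ℂ :=
  (n / 8) • (formalS 2 (2 * β + 2) (2 * α - 2) - formalS 2 (2 * α) (2 * β))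
    + (1 / 4 * (2 * (β : ℂ) + 1)) • (eVar (2 * α) * eVar (2 * β))

/-- `{e_{2α+3}, e_{2β+3}}_2`. -/
def coordBracketTwoOddOdd (n : ℂ) (α β : ℤ) : MvPowerSeries ℤ ℂ :=
  (n / 4) • (formalS 2 (2 * β + 2) (2 * α + 1) - formalS 2 (2 * α + 2) (2 * β + 1))
    - (1 / 4 * (2 * (α : ℂ) + 1)) • (eVar (2 * α) * eVar (2 * β + 3))
    + (1 / 4 * (2 * (β : ℂ) + 1)) • (eVar (2 * α + 3) * eVar (2 * β))

/-- `{e_i, e_j}_2`; the odd-even case is given by skew-symmetry. -/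
def coordBracketTwo (n : ℂ) : BasisIndex → BasisIndex → MvPowerSeries ℤ ℂ
  | Sum.inl _, Sum.inl _ => 0
  | Sum.inl α, Sum.inr β => coordBracketTwoEvenOdd n α β
  | Sum.inr α, Sum.inl β => -coordBracketTwoEvenOdd n β α
  | Sum.inr α, Sum.inr β => coordBracketTwoOddOdd n α β

/-- `{e_{2α}, e_{2β+3}}_3`. -/
def coordBracketThreeEvenOdd (n : ℂ) (α β : ℤ) : MvPowerSeries ℤ ℂ :=
  (n / 8) • (formalS 2 (2 * β) (2 * α - 2) - formalS 2 (2 * α) (2 * β - 2))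
    + (1 / 2 * (β : ℂ)) • (eVar (2 * α) * eVar (2 * β - 2))

/-- `{e_{2α+3}, e_{2β+3}}_3`. -/
def coordBracketThreeOddOdd (n : ℂ) (α β : ℤ) : MvPowerSeries ℤ ℂ :=
  (n / 4) • (formalS 2 (2 * β) (2 * α + 1) - formalS 2 (2 * α) (2 * β + 1))
    - (1 / 2 * (α : ℂ)) • (eVar (2 * α - 2) * eVar (2 * β + 3))
    + (1 / 2 * (β : ℂ)) • (eVar (2 * α + 3) * eVar (2 * β - 2))

/-- `{e_i, e_j}_3`; the odd-even case is given by skew-symmetry. -/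
def coordBracketThree (n : ℂ) : BasisIndex → BasisIndex → MvPowerSeries ℤ ℂ
  | Sum.inl _, Sum.inl _ => 0
  | Sum.inl α, Sum.inr β => coordBracketThreeEvenOdd n α β
  | Sum.inr α, Sum.inl β => -coordBracketThreeEvenOdd n β α
  | Sum.inr α, Sum.inr β => coordBracketThreeOddOdd n α β

/-- The polynomial `P` in the variables `e_0, e_2, e_3, …` regarded as a formal sum of monomials in
all the variables `e_α`, `α ∈ ℤ`. -/
def toFormal (P : MvPolynomial BasisIndex ℂ) : MvPowerSeries ℤ ℂ :=
  (MvPolynomial.rename BasisIndex.toInt P : MvPolynomial ℤ ℂ)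

end OdesskiiElliptic

end

open Filter Topology PeriodPair

noncomputable section

namespace OdesskiiElliptic

/-! ### Complements of the lattice and Liouville's theorem -/

/-! The whole statement rests on an explicit formula for the bracket of two basis functions. The
kernel ζ(x-y) - ζ(x) + ζ(y) equals (℘'(x) + ℘'(y)) / (2(℘(x) - ℘(y))) by the addition formula
`zetaKernel_mul`. Multiplying the bracket by ℘(x) - ℘(y) therefore leaves an expression in which
only ℘' acts on the e_k. Up to terms with g₂ and g₃, multiplication by ℘'/2 sends e_k to -e_{k+3},
and multiplication by ℘ sends e_k to e_{k+2}. On the coordinate side, (℘(x) - ℘(y)) times the value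
of a monomial e_a e_b is a difference of two 2×2 minors, so the sums S_k telescope. The two sides
agree after this multiplication (`exists_coord_int`), the factor is cancelled where it is nonzero,
and continuity covers the remaining points (`exists_coord`).

That the e_k form a basis follows by comparing leading terms at the origin, once elliptic functions
with a single simple pole are excluded (`simple_pole_residue_eq_zero`). This is done without contour
integrals: such a function would satisfy a Riccati equation with constant coefficients and hence
omit a value, contradicting Liouville's theorem (`eq_const_of_tendsto`).

A biderivation of a symmetric algebra can be prescribed freely on a basis (`exists_isBiderivation`),
and skew-symmetry and the Jacobi identity need only be checked on generators. There the defects are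
quadratic and cubic elements, which are determined by their values at generic pairs and triples of
points (`eq_zero_of_pairing`, `eq_zero_of_triplePairing`). Evaluated at such a triple, the Jacobi
identity is a polynomial identity in the values and derivatives of the three functions and of the
kernel (`jacobi_inc`). The same principle gives uniqueness.

For n = N the only coordinate terms whose index can exceed N carry a factor α - n or β - n that
vanishes exactly in the critical case. Hence the bracket preserves poles of order at most N
(`IsEllipticBracket.apply_mem_incLE`), and it pulls back along the injective map `symIncl`. -/

lemma isOpen_latticeCompl (L : PeriodPair) : IsOpen ((L.lattice : Set ℂ)ᶜ) :=
  L.isClosed_lattice.isOpen_compl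

lemma isPreconnected_latticeCompl (L : PeriodPair) : IsPreconnected ((L.lattice : Set ℂ)ᶜ) :=
  (Set.Countable.isConnected_compl_of_one_lt_rank (by simp)
    (countable_of_Lindelof_of_discrete (X := L.lattice))).2

lemma eventually_notMem_lattice {L : PeriodPair} {x : ℂ} (hx : x ∉ L.lattice) :
    ∀ᶠ z in 𝓝 x, z ∉ L.lattice :=
  (isOpen_latticeCompl L).mem_nhds hx

lemma eventually_nhdsNE_notMem_lattice (L : PeriodPair) (x : ℂ) :
    ∀ᶠ z in 𝓝[≠] x, z ∉ L.lattice := by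
  filter_upwards [self_mem_nhdsWithin, mem_nhdsWithin_of_mem_nhds
    (L.compl_lattice_sdiff_singleton_mem_nhds x)] with z hz hz' hzL
  exact hz' ⟨hzL, hz⟩

lemma tendsto_sub_nhdsNE (x w : ℂ) : Tendsto (fun z => z - w) (𝓝[≠] x) (𝓝[≠] (x - w)) := by
  refine tendsto_nhdsWithin_iff.2
    ⟨(continuous_sub_right w).continuousAt.tendsto.mono_left nhdsWithin_le_nhds, ?_⟩
  filter_upwards [self_mem_nhdsWithin] with z hz h
  exact hz (sub_left_injective h)

/-- An elliptic function without poles is constant. -/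
theorem eq_const_of_tendsto (L : PeriodPair) {f : ℂ → ℂ} {c : ℂ}
    (hd : DifferentiableOn ℂ f ((L.lattice : Set ℂ)ᶜ))
    (hp : ∀ w ∈ L.lattice, ∀ z ∉ L.lattice, f (z + w) = f z)
    (h0 : Tendsto f (𝓝[≠] 0) (𝓝 c)) : ∀ z ∉ L.lattice, f z = c := by
  classical
  -- The value `c` at lattice points makes `g` continuous there, so the singularities are removable.
  set g : ℂ → ℂ := fun z => if z ∈ L.lattice then c else f z with hg
  have hgz : ∀ z ∉ L.lattice, g z = f z := fun z hz => if_neg hz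
  have hgp : ∀ z w, w ∈ L.lattice → g (z + w) = g z := by
    intro z w hw
    by_cases hz : z ∈ L.lattice
    · simp [hg, hz, L.lattice.add_mem hz hw]
    · have : z + w ∉ L.lattice := fun h => hz (by simpa using L.lattice.sub_mem h hw)
      rw [hgz _ hz, hgz _ this, hp w hw z hz]
  have hdiff : ∀ z ∉ L.lattice, DifferentiableAt ℂ g z := by
    intro z hz
    refine ((hd z hz).differentiableAt
      ((isOpen_latticeCompl L).mem_nhds hz)).congr_of_eventuallyEq ?_
    filter_upwards [eventually_notMem_lattice hz] with u hu using hgz u hu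
  have hlim : ∀ w ∈ L.lattice, Tendsto g (𝓝[≠] w) (𝓝 c) := by
    intro w hw
    have h1 : Tendsto g (𝓝[≠] 0) (𝓝 c) := by
      refine h0.congr' ?_
      filter_upwards [eventually_nhdsNE_notMem_lattice L 0] with u hu using (hgz u hu).symm
    have h2 := tendsto_sub_nhdsNE w w
    rw [sub_self] at h2
    refine (h1.comp h2).congr fun z => ?_
    have := hgp (z - w) w hw
    rw [sub_add_cancel] at this
    exact this.symm
  have hall : Differentiable ℂ g := by
    intro z
    by_cases hz : z ∈ L.lattice
    · refine (Complex.analyticAt_of_differentiable_on_punctured_nhds_of_continuousAt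
        ?_ ?_).differentiableAt
      · filter_upwards [eventually_nhdsNE_notMem_lattice L z] with u hu using hdiff u hu
      · rw [continuousAt_iff_punctured_nhds]
        simpa [hg, hz] using hlim z hz
    · exact hdiff z hz
  intro z hz
  -- Liouville: an entire function periodic under a full lattice has compact range.
  have := hall.apply_eq_apply_of_bounded
    (IsZLattice.isCompact_range_of_periodic L.lattice _ hall.continuous hgp).isBounded z 0
  rw [← hgz z hz, this]
  exact if_pos L.lattice.zero_mem

/-- A meromorphic function on the plane with a pole takes any given value in a discrete set. -/
theorem eventually_ne_of_pole {f : ℂ → ℂ} (hf : Meromorphic f) {a : ℂ}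
    (ha : meromorphicOrderAt f a < 0) (c x : ℂ) : ∀ᶠ z in 𝓝[≠] x, f z ≠ c := by
  have hm : Meromorphic (fun z => f z - c) := fun z => (hf z).sub (MeromorphicAt.const c z)
  -- Infinite order would make `f` tend to `c` at its pole. Finiteness of the order then spreads
  -- over the connected plane.
  have h1 : meromorphicOrderAt (fun z => f z - c) a ≠ ⊤ := by
    intro h
    have h3 : Tendsto f (𝓝[≠] a) (𝓝 c) := by
      refine tendsto_const_nhds.congr' ?_
      filter_upwards [meromorphicOrderAt_eq_top_iff.1 h] with z hz
      exact (sub_eq_zero.1 hz).symm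
    have := (tendsto_nhds_iff_meromorphicOrderAt_nonneg (hf a)).1 ⟨c, h3⟩
    exact absurd ha (not_lt.2 this)
  have h2 := MeromorphicOn.meromorphicOrderAt_ne_top_of_isPreconnected
    (U := Set.univ) (y := x) (meromorphicOn_univ.2 hm) isPreconnected_univ trivial trivial h1
  filter_upwards [(meromorphicOrderAt_ne_top_iff_eventually_ne_zero (hm x)).1 h2] with z hz h
  exact hz (sub_eq_zero.2 h)

lemma eventually_weierstrassP_ne (L : PeriodPair) (c x : ℂ) :
    ∀ᶠ z in 𝓝[≠] x, ℘[L] z ≠ c := by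
  refine eventually_ne_of_pole L.meromorphic_weierstrassP (a := 0) ?_ c x
  rw [L.order_weierstrassP 0 L.lattice.zero_mem]
  decide

lemma order_derivWeierstrassP (L : PeriodPair) (l₀ : ℂ) (h : l₀ ∈ L.lattice) :
    meromorphicOrderAt ℘'[L] l₀ = (-3 : ℤ) := by
  rw [← deriv_weierstrassP]
  exact meromorphicOrderAt_deriv_eq_sub_one (n := -2)
    (show ((-2 : ℤ) : ℂ) ≠ 0 by norm_num)
    (by rw [L.order_weierstrassP l₀ h]; rfl)

lemma eventually_derivWeierstrassP_ne (L : PeriodPair) (c x : ℂ) :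
    ∀ᶠ z in 𝓝[≠] x, ℘'[L] z ≠ c := by
  refine eventually_ne_of_pole L.meromorphic_derivWeierstrassP (a := 0) ?_ c x
  rw [order_derivWeierstrassP L 0 L.lattice.zero_mem]
  decide

lemma hasDerivAt_weierstrassP (L : PeriodPair) {x : ℂ} (hx : x ∉ L.lattice) :
    HasDerivAt ℘[L] (℘'[L] x) x := by
  rw [← deriv_weierstrassP]
  exact ((L.analyticOnNhd_weierstrassP x hx).differentiableAt).hasDerivAt

/-- Two functions which are continuous at `x` and agree near `x` outside `x` agree at `x`. -/
lemma eq_of_eventually_nhdsNE {f g : ℂ → ℂ} {x : ℂ} (hf : ContinuousAt f x) (hg : ContinuousAt g x)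
    (h : ∀ᶠ z in 𝓝[≠] x, f z = g z) : f x = g x :=
  tendsto_nhds_unique ((hf.tendsto.mono_left nhdsWithin_le_nhds).congr' h)
    (hg.tendsto.mono_left nhdsWithin_le_nhds)

/-- `℘'' = 6 ℘² - g₂/2`. -/
theorem hasDerivAt_derivWeierstrassP (L : PeriodPair) {x : ℂ} (hx : x ∉ L.lattice) :
    HasDerivAt ℘'[L] (6 * ℘[L] x ^ 2 - L.g₂ / 2) x := by
  have han : ∀ z ∉ L.lattice, AnalyticAt ℂ ℘'[L] z := fun z hz =>
    L.analyticOnNhd_derivWeierstrassP z hz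
  -- Differentiating the Weierstrass equation gives the claim multiplied by 2℘'. The zeros of ℘' are
  -- isolated, so continuity supplies the claim there.
  have key : ∀ z ∉ L.lattice, ℘'[L] z ≠ 0 → deriv ℘'[L] z = 6 * ℘[L] z ^ 2 - L.g₂ / 2 := by
    intro z hz hne
    have h1 := ((han z hz).differentiableAt.hasDerivAt).pow 2
    have hP := hasDerivAt_weierstrassP L hz
    have h2 : HasDerivAt (fun z => 4 * ℘[L] z ^ 3 - L.g₂ * ℘[L] z - L.g₃)
        (4 * (3 * ℘[L] z ^ 2 * ℘'[L] z) - L.g₂ * ℘'[L] z) z := by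
      simpa using (((hP.pow 3).const_mul 4).sub (hP.const_mul L.g₂)).sub_const L.g₃
    have h3 : (fun z => ℘'[L] z ^ 2) =ᶠ[𝓝 z]
        (fun z => 4 * ℘[L] z ^ 3 - L.g₂ * ℘[L] z - L.g₃) := by
      filter_upwards [eventually_notMem_lattice hz] with u hu using L.derivWeierstrassP_sq u hu
    have h4 := h1.unique (h2.congr_of_eventuallyEq h3)
    apply mul_left_cancel₀ hne
    simp only [Nat.cast_ofNat] at h4
    linear_combination h4 / 2
  have hd := (han x hx).differentiableAt.hasDerivAt
  have : deriv ℘'[L] x = 6 * ℘[L] x ^ 2 - L.g₂ / 2 := by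
    refine eq_of_eventually_nhdsNE (f := deriv ℘'[L]) (g := fun z => 6 * ℘[L] z ^ 2 - L.g₂ / 2)
      (han x hx).deriv.continuousAt ?_ ?_
    · have := (hasDerivAt_weierstrassP L hx).continuousAt
      fun_prop
    · filter_upwards [eventually_derivWeierstrassP_ne L 0 x, eventually_nhdsNE_notMem_lattice L x]
        with z h1 h2 using key z h2 h1
  rwa [this] at hd

/-! ### The zeta function -/

/-- The regular part `ζ(z) - 1/z` of the zeta function at the origin. -/
def zetaRegular (L : PeriodPair) (z : ℂ) : ℂ :=
  ∑' l : L.lattice, if l.1 = 0 then 0 else (1 / (z - l) + 1 / l + z / (l : ℂ) ^ 2)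

lemma weierstrassZeta_eq (L : PeriodPair) (z : ℂ) :
    weierstrassZeta L z = 1 / z + zetaRegular L z := by
  rw [weierstrassZeta, zetaRegular]
  congr 1
  have h := tsum_subtype {w : L.lattice | w ≠ 0}
    (fun l : L.lattice => 1 / (z - l) + 1 / (l : ℂ) + z / (l : ℂ) ^ 2)
  refine h.trans (tsum_congr fun l => ?_)
  by_cases hl : l = 0 <;> simp [Set.indicator, hl]

/-- The three fractions combine to s² / ((s - l) l²), of order |l|⁻³, which is summable over a
lattice of rank two. -/
lemma zetaRegular_bound (r : ℝ) (hr : 0 < r) (s : ℂ) (hs : ‖s‖ < r) (l : ℂ) (h : 2 * r ≤ ‖l‖) :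
    ‖1 / (s - l) + 1 / l + s / l ^ 2‖ ≤ 2 * r ^ 2 * ‖l‖ ^ (-3 : ℝ) := by
  have hl : 0 < ‖l‖ := by linarith
  have hl0 : l ≠ 0 := norm_pos_iff.1 hl
  have h1 : ‖l‖ / 2 ≤ ‖s - l‖ := by
    rw [norm_sub_rev]
    exact .trans (by linarith) (norm_sub_norm_le l s)
  have hsl : s - l ≠ 0 := norm_pos_iff.1 (by linarith)
  have h2 : 1 / (s - l) + 1 / l + s / l ^ 2 = s ^ 2 / ((s - l) * l ^ 2) := by
    field_simp
    ring
  rw [h2, norm_div, norm_mul, norm_pow, norm_pow]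
  calc ‖s‖ ^ 2 / (‖s - l‖ * ‖l‖ ^ 2) ≤ r ^ 2 / (‖l‖ / 2 * ‖l‖ ^ 2) := by gcongr
    _ = 2 * r ^ 2 / ‖l‖ ^ 3 := by field
    _ = _ := by norm_cast

lemma hasSumLocallyUniformly_zetaRegular (L : PeriodPair) :
    HasSumLocallyUniformly
      (fun (l : L.lattice) (z : ℂ) ↦ if l.1 = 0 then 0 else (1 / (z - l) + 1 / l + z / (l : ℂ) ^ 2))
      (zetaRegular L) := by
  refine L.hasSumLocallyUniformly_aux (u := (2 * · ^ 2 * ‖·‖ ^ (-3 : ℝ))) _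
    (fun _ _ ↦ (ZLattice.summable_norm_rpow _ _ (by simp; norm_num)).mul_left _) fun r hr ↦
    Filter.eventually_atTop.mpr ⟨2 * r, ?_⟩
  rintro _ h s hs l rfl
  split_ifs
  · simpa using! show 0 ≤ 2 * r ^ 2 * (‖↑l‖ ^ 3)⁻¹ by positivity
  · exact zetaRegular_bound r hr s hs l h

lemma differentiableOn_zetaRegular (L : PeriodPair) :
    DifferentiableOn ℂ (zetaRegular L) (L.lattice \ {0})ᶜ := by
  refine (hasSumLocallyUniformly_zetaRegular L).tendstoLocallyUniformlyOn.differentiableOn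
    (.of_forall fun s ↦ .fun_sum fun i hi ↦ ?_) L.isOpen_compl_lattice_sdiff
  split_ifs
  · simp
  · exact .add (.add (.div (by fun_prop) (by fun_prop) (fun x hx => by
      have : x ≠ i := by rintro rfl; simp_all
      simpa [sub_eq_zero])) (by fun_prop)) (by fun_prop)

/-- Locally uniform convergence permits termwise differentiation, and the derivative of each term is
minus the corresponding term of the ℘-series. -/
lemma deriv_zetaRegular (L : PeriodPair) {x : ℂ} (hx : x ∈ ((L.lattice : Set ℂ) \ {0})ᶜ) :
    deriv (zetaRegular L) x = -weierstrassPExcept L 0 x := by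
  have hne : ∀ l : L.lattice, l.1 ≠ 0 → ∀ x ∈ ((L.lattice : Set ℂ) \ {0})ᶜ, x - l ≠ 0 := by
    intro l hl x hx e
    obtain rfl := sub_eq_zero.mp e
    simp [hl] at hx
  refine ((hasSumLocallyUniformly_zetaRegular L).tendstoLocallyUniformlyOn.deriv
    (.of_forall fun s ↦ ?_) L.isOpen_compl_lattice_sdiff).unique ?_ hx
    (g := fun z => -weierstrassPExcept L 0 z)
  · refine .fun_sum fun i hi ↦ ?_
    split_ifs with h
    · simp
    exact .add (.add (.div (by fun_prop) (by fun_prop) (hne i h)) (by fun_prop)) (by fun_prop)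
  · refine ((L.hasSumLocallyUniformly_weierstrassPExcept 0).tendstoLocallyUniformlyOn.neg).congr ?_
    intro s l hl
    simp only [Function.comp_apply, Pi.neg_apply]
    rw [deriv_fun_sum, ← Finset.sum_neg_distrib]
    · congr with x
      split_ifs with hl₁
      · simp
      have h1 := hne x hl₁ l hl
      have : HasDerivAt (fun z : ℂ => 1 / (z - x) + 1 / (x : ℂ) + z / (x : ℂ) ^ 2)
          (-1 / (l - x) ^ 2 + 1 / (x : ℂ) ^ 2) l := by
        have := (((hasDerivAt_id l).sub_const (x : ℂ)).inv h1)
        simpa using! (this.add_const (1 / (x : ℂ))).add ((hasDerivAt_id l).div_const ((x : ℂ) ^ 2))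
      rw [this.deriv]
      ring
    · intro x hxs
      split_ifs with hl₁
      · simp
      have h1 := hne x hl₁ l hl
      exact .add (.add (.div (by fun_prop) (by fun_prop) h1) (by fun_prop)) (by fun_prop)

lemma zetaRegular_neg (L : PeriodPair) (z : ℂ) : zetaRegular L (-z) = -zetaRegular L z := by
  simp only [zetaRegular]
  rw [← (Equiv.neg L.lattice).tsum_eq, ← tsum_neg]
  congr with l
  simp only [Equiv.neg_apply, NegMemClass.coe_neg, neg_eq_zero]
  split_ifs
  · simp
  · rw [← sub_eq_zero]
    have : (-z - -(l : ℂ)) = -(z - l) := by ring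
    rw [this]
    simp only [one_div, inv_neg, even_two.neg_pow]
    ring

lemma weierstrassZeta_neg (L : PeriodPair) (z : ℂ) :
    weierstrassZeta L (-z) = -weierstrassZeta L z := by
  rw [weierstrassZeta_eq, weierstrassZeta_eq, zetaRegular_neg]
  simp only [one_div, inv_neg]
  ring

lemma zetaRegular_zero (L : PeriodPair) : zetaRegular L 0 = 0 := by
  have := zetaRegular_neg L 0
  rw [neg_zero] at this
  linear_combination this / 2

lemma weierstrassPExcept_zero_eq (L : PeriodPair) (z : ℂ) :
    weierstrassPExcept L 0 z = ℘[L] z - 1 / z ^ 2 := by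
  have := L.weierstrassPExcept_def 0 z
  simp only [ZeroMemClass.coe_zero] at this
  rw [this]
  simp [sub_eq_add_neg]

/-- `ζ' = -℘`. -/
theorem hasDerivAt_weierstrassZeta (L : PeriodPair) {x : ℂ} (hx : x ∉ L.lattice) :
    HasDerivAt (weierstrassZeta L) (-℘[L] x) x := by
  have hx0 : x ≠ 0 := by rintro rfl; exact hx L.lattice.zero_mem
  have hmem : x ∈ ((L.lattice : Set ℂ) \ {0})ᶜ := fun h => hx h.1
  have h1 := ((differentiableOn_zetaRegular L x hmem).differentiableAt
    (L.isOpen_compl_lattice_sdiff.mem_nhds hmem)).hasDerivAt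
  rw [deriv_zetaRegular L hmem, weierstrassPExcept_zero_eq] at h1
  have h2 := (hasDerivAt_inv hx0).add h1
  have h3 : weierstrassZeta L = (fun z => z⁻¹) + zetaRegular L := by
    funext z
    simp [weierstrassZeta_eq]
  rw [h3]
  convert! h2 using 1
  ring

/-- The zeta function is quasi-periodic. -/
theorem weierstrassZeta_add_sub (L : PeriodPair) {w : ℂ} (hw : w ∈ L.lattice) {x y : ℂ}
    (hx : x ∉ L.lattice) (hy : y ∉ L.lattice) :
    weierstrassZeta L (x + w) - weierstrassZeta L x
      = weierstrassZeta L (y + w) - weierstrassZeta L y := by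
  have hadd : ∀ z ∉ L.lattice, z + w ∉ L.lattice := fun z hz h =>
    hz (by simpa using L.lattice.sub_mem h hw)
  have hd : ∀ z ∉ L.lattice,
      HasDerivAt (fun z => weierstrassZeta L (z + w) - weierstrassZeta L z) 0 z := by
    intro z hz
    have h1 := (hasDerivAt_weierstrassZeta L (hadd z hz)).comp_add_const z w
    have h2 := h1.sub (hasDerivAt_weierstrassZeta L hz)
    have h3 := L.weierstrassP_add_coe z ⟨w, hw⟩
    simp only at h3
    rw [h3, sub_self] at h2
    exact h2
  -- Since ζ' = -℘ is periodic, the increment has derivative zero; the complement of a countable set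
  -- in the plane is connected, so a single constant serves everywhere.
  exact (isOpen_latticeCompl L).is_const_of_deriv_eq_zero (isPreconnected_latticeCompl L)
    (f := fun z => weierstrassZeta L (z + w) - weierstrassZeta L z)
    (fun z hz => (hd z hz).differentiableAt.differentiableWithinAt)
    (fun z hz => (hd z hz).deriv) hx hy

/-! ### The addition formula for the zeta function -/

/-- The combination of zeta functions which occurs in the bracket. -/
def zetaKernel (L : PeriodPair) (x y : ℂ) : ℂ :=
  weierstrassZeta L (x - y) - weierstrassZeta L x + weierstrassZeta L y

/-- Splits off one Taylor term; the quotient is `dslope f 0`. Iterating it replaces power series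
expansions in the cancellations of poles below. -/
lemma exists_eq_mul_of_apply_zero {f : ℂ → ℂ} (hf : AnalyticAt ℂ f 0) (h0 : f 0 = 0) :
    ∃ g : ℂ → ℂ, AnalyticAt ℂ g 0 ∧ g 0 = deriv f 0 ∧ ∀ z, f z = z * g z := by
  obtain ⟨p, hp⟩ := hf
  refine ⟨dslope f 0, hp.has_fpower_series_dslope_fslope.analyticAt, dslope_same f 0, fun z => ?_⟩
  have := sub_smul_dslope f 0 z
  simp only [sub_zero, smul_eq_mul, h0] at this
  exact this.symm

lemma analyticAt_zetaRegular (L : PeriodPair) : AnalyticAt ℂ (zetaRegular L) 0 :=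
  (differentiableOn_zetaRegular L).analyticAt (L.isOpen_compl_lattice_sdiff.mem_nhds (by simp))

lemma analyticAt_weierstrassZeta (L : PeriodPair) {x : ℂ} (hx : x ∉ L.lattice) :
    AnalyticAt ℂ (weierstrassZeta L) x :=
  DifferentiableOn.analyticAt (s := (L.lattice : Set ℂ)ᶜ)
    (fun _ hz => (hasDerivAt_weierstrassZeta L hz).differentiableAt.differentiableWithinAt)
    ((isOpen_latticeCompl L).mem_nhds hx)

lemma neg_notMem_lattice {L : PeriodPair} {x : ℂ} (hx : x ∉ L.lattice) : -x ∉ L.lattice :=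
  fun h => hx (by simpa using L.lattice.neg_mem h)

lemma add_notMem_lattice {L : PeriodPair} {x w : ℂ} (hx : x ∉ L.lattice) (hw : w ∈ L.lattice) :
    x + w ∉ L.lattice := fun h => hx (by simpa using L.lattice.sub_mem h hw)

lemma derivWeierstrassPExcept_zero_eq (L : PeriodPair) (z : ℂ) :
    derivWeierstrassPExcept L 0 z = ℘'[L] z + 2 / z ^ 3 := by
  have := L.derivWeierstrassPExcept_def 0 z
  simp only [ZeroMemClass.coe_zero] at this
  rw [this]
  simp

/-- The behaviour at the origin of the difference of the two sides of the addition formula. -/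
lemma exists_tendsto_zetaKernel (L : PeriodPair) {y : ℂ} (hy : y ∉ L.lattice) :
    ∃ c, Tendsto (fun x => zetaKernel L x y * (℘[L] x - ℘[L] y) - (℘'[L] x + ℘'[L] y) / 2)
      (𝓝[≠] 0) (𝓝 c) := by
  have hy' := neg_notMem_lattice hy
  obtain ⟨P, hP, hP0, hPe⟩ := exists_eq_mul_of_apply_zero (L.analyticAt_weierstrassPExcept 0)
    (L.weierstrassPExcept_zero 0)
  -- `A` is the kernel with its pole -1/x removed. It vanishes at 0 because ζ is odd, and its
  -- derivative there is -℘(y).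
  set A : ℂ → ℂ := fun x => weierstrassZeta L (x - y) + weierstrassZeta L y - zetaRegular L x
  have hz : AnalyticAt ℂ (fun x => weierstrassZeta L (x - y)) 0 :=
    AnalyticAt.fun_comp (f := fun x => x - y) (by simpa using analyticAt_weierstrassZeta L hy')
      (by fun_prop)
  have hA : AnalyticAt ℂ A 0 := (hz.add analyticAt_const).sub (analyticAt_zetaRegular L)
  have hA0 : A 0 = 0 := by
    simp [A, weierstrassZeta_neg, zetaRegular_zero]
  have hAd : HasDerivAt A (-℘[L] y) 0 := by
    have h1 : HasDerivAt (fun x => weierstrassZeta L (x - y)) (-℘[L] (0 - y)) 0 :=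
      HasDerivAt.comp_sub_const 0 y (hasDerivAt_weierstrassZeta L (by simpa using hy'))
    have h2 := (analyticAt_zetaRegular L).differentiableAt.hasDerivAt
    rw [deriv_zetaRegular L (by simp), L.weierstrassPExcept_zero] at h2
    have := (h1.add_const (weierstrassZeta L y)).sub h2
    simpa using! this
  obtain ⟨B, hB, hB0, hBe⟩ := exists_eq_mul_of_apply_zero hA hA0
  rw [hAd.deriv] at hB0
  obtain ⟨C, hC, -, hCe⟩ := exists_eq_mul_of_apply_zero (f := fun x => B x + ℘[L] y)
    (hB.add analyticAt_const) (by simp [hB0])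
  -- What remains after the poles cancel: the cubic ones between -1/x · 1/x² and ℘'/2, the simple
  -- ones between ℘(y)/x and A(x)/x² = C(x) - ℘(y)/x.
  set D : ℂ → ℂ := fun x => C x - P x + A x * (x * P x - ℘[L] y)
    - (derivWeierstrassPExcept L 0 x + ℘'[L] y) / 2 with hD
  have hDa : ContinuousAt D 0 := by
    have h1 := hC.continuousAt
    have h2 := hP.continuousAt
    have h3 := hA.continuousAt
    have h4 := (L.analyticAt_derivWeierstrassPExcept 0).continuousAt
    fun_prop
  refine ⟨D 0, (hDa.tendsto.mono_left nhdsWithin_le_nhds).congr' ?_⟩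
  filter_upwards [self_mem_nhdsWithin] with x hx
  have hx : x ≠ 0 := hx
  have e1 : zetaKernel L x y = -1 / x + A x := by
    simp only [zetaKernel, A, weierstrassZeta_eq L x]
    ring
  have e2 : ℘[L] x = 1 / x ^ 2 + x * P x := by
    rw [← hPe, weierstrassPExcept_zero_eq]
    ring
  have e3 : ℘'[L] x = derivWeierstrassPExcept L 0 x - 2 / x ^ 3 := by
    rw [derivWeierstrassPExcept_zero_eq]
    ring
  have e4 : B x = x * C x - ℘[L] y := by rw [← hCe]; ring
  rw [e1, e2, e3, hD]
  simp only
  rw [hBe, e4]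
  field_simp
  ring

lemma zetaKernel_add_left (L : PeriodPair) {x y w : ℂ} (hx : x ∉ L.lattice)
    (hxy : x - y ∉ L.lattice) (hw : w ∈ L.lattice) :
    zetaKernel L (x + w) y = zetaKernel L x y := by
  have := weierstrassZeta_add_sub L hw hx hxy
  rw [zetaKernel, zetaKernel, show x + w - y = x - y + w by ring]
  linear_combination -this

/-- The addition formula for the zeta function. -/
theorem zetaKernel_mul (L : PeriodPair) {x y : ℂ} (hx : x ∉ L.lattice) (hy : y ∉ L.lattice)
    (hxy : x - y ∉ L.lattice) :
    zetaKernel L x y * (℘[L] x - ℘[L] y) = (℘'[L] x + ℘'[L] y) / 2 := by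
  classical
  set K : ℂ → ℂ := fun x => zetaKernel L x y * (℘[L] x - ℘[L] y) - (℘'[L] x + ℘'[L] y) / 2 with hK
  -- On y + Γ the function `K` has limit 0, since the simple pole of ζ(x-y) meets the zero of ℘(x) -
  -- ℘(y). With this value the constant can be read off at x = y.
  set g : ℂ → ℂ := fun x => if x - y ∈ L.lattice then 0 else K x with hg
  obtain ⟨c, hc⟩ := exists_tendsto_zetaKernel L hy
  have hgK : ∀ z, z - y ∉ L.lattice → g z = K z := fun z hz => if_neg hz
  have hev : ∀ z, ∀ᶠ u in 𝓝[≠] z, u - y ∉ L.lattice := fun z =>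
    (tendsto_sub_nhdsNE z y).eventually (eventually_nhdsNE_notMem_lattice L (z - y))
  have hper : ∀ w ∈ L.lattice, ∀ z ∉ L.lattice, g (z + w) = g z := by
    intro w hw z hz
    by_cases hzy : z - y ∈ L.lattice
    · have : z + w - y ∈ L.lattice := by
        rw [show z + w - y = z - y + w by ring]
        exact L.lattice.add_mem hzy hw
      simp [hg, hzy, this]
    · have : z + w - y ∉ L.lattice := by
        rw [show z + w - y = z - y + w by ring]
        exact add_notMem_lattice hzy hw
      rw [hgK _ hzy, hgK _ this, hK]
      have h1 := L.weierstrassP_add_coe z ⟨w, hw⟩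
      have h2 := L.derivWeierstrassP_add_coe z ⟨w, hw⟩
      simp only at h1 h2
      simp only [h1, h2, zetaKernel_add_left L hz hzy hw]
  have hd1 : ∀ z ∉ L.lattice, z - y ∉ L.lattice → DifferentiableAt ℂ g z := by
    intro z hz hzy
    have hKd : DifferentiableAt ℂ K z := by
      have h1 := (hasDerivAt_weierstrassZeta L hz).differentiableAt
      have h2 : DifferentiableAt ℂ (fun x => weierstrassZeta L (x - y)) z :=
        ((hasDerivAt_weierstrassZeta L hzy).comp_sub_const z y).differentiableAt
      have h3 := (hasDerivAt_weierstrassP L hz).differentiableAt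
      have h4 := (hasDerivAt_derivWeierstrassP L hz).differentiableAt
      simp only [hK, zetaKernel]
      fun_prop
    refine hKd.congr_of_eventuallyEq ?_
    have : ∀ᶠ u in 𝓝 z, u - y ∉ L.lattice :=
      (continuous_sub_right y).continuousAt.eventually (eventually_notMem_lattice hzy)
    filter_upwards [this] with u hu using hgK u hu
  have hlim : ∀ z, z - y ∈ L.lattice → Tendsto g (𝓝[≠] z) (𝓝 0) := by
    intro z hzy
    have hz : z ∉ L.lattice := fun h => hy (by simpa using L.lattice.sub_mem h hzy)
    have hPz : ℘[L] z = ℘[L] y := by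
      have h1 := L.weierstrassP_add_coe y ⟨z - y, hzy⟩
      simpa using h1
    have hPz' : ℘'[L] z = ℘'[L] y := by
      have h1 := L.derivWeierstrassP_add_coe y ⟨z - y, hzy⟩
      simpa using h1
    obtain ⟨Q, hQ, hQ0, hQe⟩ := exists_eq_mul_of_apply_zero
      (f := fun u => ℘[L] (u + z) - ℘[L] z)
      ((AnalyticAt.fun_comp (g := ℘[L]) (f := fun u => u + z)
        (by simpa using L.analyticOnNhd_weierstrassP z hz) (by fun_prop)).sub analyticAt_const)
      (by simp)
    have hQd : HasDerivAt (fun u => ℘[L] (u + z) - ℘[L] z) (℘'[L] z) 0 := by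
      refine HasDerivAt.sub_const _ (HasDerivAt.comp_add_const 0 z ?_)
      simpa using hasDerivAt_weierstrassP L hz
    rw [hQd.deriv] at hQ0
    -- near `z` the zeta function of `u - y` is a constant plus `1 / (u - z)` plus a regular term
    have hquasi : ∃ η : ℂ, ∀ v ∉ L.lattice,
        weierstrassZeta L (v + (z - y)) = weierstrassZeta L v + η := by
      refine ⟨weierstrassZeta L (y + (z - y)) - weierstrassZeta L y, fun v hv => ?_⟩
      linear_combination weierstrassZeta_add_sub L hzy hv hy
    obtain ⟨η, hη⟩ := hquasi
    -- A continuous expression for `K` near `z`. At `z` it equals ℘'(z) + 0 - ℘'(z): `Q 0` is the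
    -- derivative of ℘, and the factor ℘(u) - ℘(y) vanishes.
    set H : ℂ → ℂ := fun u => Q (u - z) + (zetaRegular L (u - z) + η - weierstrassZeta L u
      + weierstrassZeta L y) * (℘[L] u - ℘[L] y) - (℘'[L] u + ℘'[L] y) / 2 with hH
    have hHc : ContinuousAt H z := by
      have h1 : ContinuousAt (fun u => Q (u - z)) z :=
        ContinuousAt.comp' (f := fun u => u - z) (by simpa using hQ.continuousAt) (by fun_prop)
      have h2 : ContinuousAt (fun u => zetaRegular L (u - z)) z :=
        ContinuousAt.comp' (f := fun u => u - z)
          (by simpa using (analyticAt_zetaRegular L).continuousAt) (by fun_prop)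
      have h3 := (hasDerivAt_weierstrassZeta L hz).continuousAt
      have h4 := (hasDerivAt_weierstrassP L hz).continuousAt
      have h5 := (hasDerivAt_derivWeierstrassP L hz).continuousAt
      exact (h1.add (((h2.add continuousAt_const).sub h3 |>.add continuousAt_const).mul
        (h4.sub continuousAt_const))).sub ((h5.add continuousAt_const).div_const 2)
    have hHz : H z = 0 := by
      simp only [hH, sub_self, hQ0, hPz, hPz']
      ring
    rw [← hHz]
    refine (hHc.tendsto.mono_left nhdsWithin_le_nhds).congr' ?_
    filter_upwards [hev z, self_mem_nhdsWithin] with u hu hne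
    have hne : u - z ≠ 0 := sub_ne_zero.2 hne
    have huz : u - z ∉ L.lattice := fun h => hu (by
      simpa using L.lattice.add_mem h hzy)
    have e1 := hη _ huz
    rw [show u - z + (z - y) = u - y by ring, weierstrassZeta_eq L (u - z)] at e1
    have e2 := hQe (u - z)
    simp only [sub_add_cancel, hPz] at e2
    rw [hgK u hu, hK, hH]
    simp only [zetaKernel, e1]
    have e3 : 1 / (u - z) * (℘[L] u - ℘[L] y) = Q (u - z) := by
      rw [e2]
      field_simp
    linear_combination -e3
  have hdiff : DifferentiableOn ℂ g ((L.lattice : Set ℂ)ᶜ) := by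
    intro z hz
    by_cases hzy : z - y ∈ L.lattice
    · refine (Complex.analyticAt_of_differentiable_on_punctured_nhds_of_continuousAt ?_
        ?_).differentiableAt.differentiableWithinAt
      · filter_upwards [hev z, eventually_nhdsNE_notMem_lattice L z] with u h1 h2 using hd1 u h2 h1
      · rw [continuousAt_iff_punctured_nhds]
        have : g z = 0 := if_pos hzy
        rw [this]
        exact hlim z hzy
    · exact (hd1 z hz hzy).differentiableWithinAt
  have hg0 : Tendsto g (𝓝[≠] 0) (𝓝 c) := by
    refine hc.congr' ?_
    filter_upwards [hev 0] with u hu using (hgK u hu).symm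
  have hconst := eq_const_of_tendsto L hdiff hper hg0
  have h1 := hconst y hy
  have h2 := hconst x hx
  rw [show g y = 0 by simp [hg]] at h1
  rw [hgK x hxy, ← h1] at h2
  exact sub_eq_zero.1 h2

lemma zetaKernel_swap (L : PeriodPair) (x y : ℂ) : zetaKernel L y x = -zetaKernel L x y := by
  have := weierstrassZeta_neg L (x - y)
  rw [neg_sub] at this
  rw [zetaKernel, zetaKernel, this]
  ring

lemma hasDerivAt_zetaKernel_left (L : PeriodPair) {x y : ℂ} (hx : x ∉ L.lattice)
    (hxy : x - y ∉ L.lattice) :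
    HasDerivAt (fun t => zetaKernel L t y) (℘[L] x - ℘[L] (x - y)) x := by
  have h1 := (hasDerivAt_weierstrassZeta L hxy).comp_sub_const x y
  have h2 := (h1.sub (hasDerivAt_weierstrassZeta L hx)).add_const (weierstrassZeta L y)
  convert! h2 using 1
  ring

/-! ### Pole orders in terms of limits at the origin -/

lemma order_eq_order_zero (L : PeriodPair) (f : ellipticSpace L) {w : ℂ} (hw : w ∈ L.lattice) :
    meromorphicOrderAt (f : ℂ → ℂ) w = meromorphicOrderAt (f : ℂ → ℂ) 0 := by
  have h := meromorphicOrderAt_comp_add_const_eq_meromorphicOrderAt (f := (f : ℂ → ℂ)) (x := 0)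
    (c := w)
  rw [zero_add] at h
  rw [← h]
  congr 1
  funext z
  exact f.2.2.2.1 w hw z

lemma meromorphicAt_pow_mul (L : PeriodPair) (f : ellipticSpace L) (N : ℕ) :
    MeromorphicAt (fun z => z ^ N * (f : ℂ → ℂ) z) 0 :=
  ((MeromorphicAt.id 0).pow N).mul (f.2.1 0)

lemma order_pow_mul (L : PeriodPair) (f : ellipticSpace L) (N : ℕ) :
    meromorphicOrderAt (fun z => z ^ N * (f : ℂ → ℂ) z) 0
      = ((N : ℤ) : WithTop ℤ) + meromorphicOrderAt (f : ℂ → ℂ) 0 := by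
  have h := meromorphicOrderAt_mul (f := (fun z : ℂ => z ^ N)) ((MeromorphicAt.id (0 : ℂ)).pow N)
    (f.2.1 0)
  have h2 : meromorphicOrderAt (fun z : ℂ => z ^ N) 0 = ((N : ℤ) : WithTop ℤ) := by
    have := meromorphicOrderAt_pow (MeromorphicAt.id (0 : ℂ)) (n := N)
    rw [meromorphicOrderAt_id, mul_one] at this
    exact this
  rw [h2] at h
  exact h

lemma mem_ellipticSpaceLE_iff (L : PeriodPair) (f : ellipticSpace L) (N : ℕ) :
    f ∈ ellipticSpaceLE L N ↔ 0 ≤ meromorphicOrderAt (fun z => z ^ N * (f : ℂ → ℂ) z) 0 := by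
  rw [order_pow_mul]
  have h1 : f ∈ ellipticSpaceLE L N ↔
      ((-(N : ℤ) : ℤ) : WithTop ℤ) ≤ meromorphicOrderAt (f : ℂ → ℂ) 0 :=
    ⟨fun h => h 0 L.lattice.zero_mem, fun h w hw => by rwa [order_eq_order_zero L f hw]⟩
  rw [h1]
  cases hm : meromorphicOrderAt (f : ℂ → ℂ) 0 with
  | top => simp
  | coe m =>
    norm_cast
    omega

lemma mem_ellipticSpaceLE_iff_tendsto (L : PeriodPair) (f : ellipticSpace L) (N : ℕ) :
    f ∈ ellipticSpaceLE L N ↔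
      ∃ c, Tendsto (fun z => z ^ N * (f : ℂ → ℂ) z) (𝓝[≠] 0) (𝓝 c) := by
  rw [mem_ellipticSpaceLE_iff, tendsto_nhds_iff_meromorphicOrderAt_nonneg
    (meromorphicAt_pow_mul L f N)]

/-- Orders are integers, so a positive order after multiplication by z^(N+1) means order at least 0
after multiplication by z^N. This is the descent step for subtracting leading terms. -/
lemma mem_ellipticSpaceLE_of_tendsto_zero (L : PeriodPair) (f : ellipticSpace L) (N : ℕ)
    (h : Tendsto (fun z => z ^ (N + 1) * (f : ℂ → ℂ) z) (𝓝[≠] 0) (𝓝 0)) :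
    f ∈ ellipticSpaceLE L N := by
  rw [tendsto_zero_iff_meromorphicOrderAt_pos (meromorphicAt_pow_mul L f (N + 1)),
    order_pow_mul] at h
  rw [mem_ellipticSpaceLE_iff, order_pow_mul]
  cases hm : meromorphicOrderAt (f : ℂ → ℂ) 0 with
  | top => simp
  | coe m =>
    rw [hm] at h
    norm_cast at h ⊢
    push_cast at h
    omega

lemma exists_mem_ellipticSpaceLE (L : PeriodPair) (f : ellipticSpace L) :
    ∃ N, f ∈ ellipticSpaceLE L N := by
  cases hm : meromorphicOrderAt (f : ℂ → ℂ) 0 with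
  | top => exact ⟨0, by rw [mem_ellipticSpaceLE_iff, order_pow_mul, hm]; simp⟩
  | coe m =>
    refine ⟨m.natAbs, ?_⟩
    rw [mem_ellipticSpaceLE_iff, order_pow_mul, hm]
    norm_cast
    linarith [neg_abs_le m]

lemma differentiableAt_of_mem (L : PeriodPair) (f : ellipticSpace L) {x : ℂ} (hx : x ∉ L.lattice) :
    DifferentiableAt ℂ (f : ℂ → ℂ) x :=
  (f.2.2.1 x hx).differentiableAt ((isOpen_latticeCompl L).mem_nhds hx)

lemma analyticAt_of_mem (L : PeriodPair) (f : ellipticSpace L) {x : ℂ} (hx : x ∉ L.lattice) :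
    AnalyticAt ℂ (f : ℂ → ℂ) x :=
  f.2.2.1.analyticAt ((isOpen_latticeCompl L).mem_nhds hx)

/-! ### The basis functions -/

/-- The pole order of the function `e_i`. -/
def BasisIndex.toNat : BasisIndex → ℕ
  | Sum.inl a => 2 * a
  | Sum.inr a => 2 * a + 3

lemma BasisIndex.toInt_eq (i : BasisIndex) : i.toInt = (i.toNat : ℤ) := by
  rcases i with a | a <;> simp [BasisIndex.toInt, BasisIndex.toNat]

lemma BasisIndex.toNat_injective : Function.Injective BasisIndex.toNat := by
  rintro (a | a) (b | b) h <;> simp only [BasisIndex.toNat] at h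
  · congr 1; omega
  · omega
  · omega
  · congr 1; omega

lemma BasisIndex.toInt_injective : Function.Injective BasisIndex.toInt := fun i j h =>
  BasisIndex.toNat_injective (by
    rw [BasisIndex.toInt_eq, BasisIndex.toInt_eq] at h; exact_mod_cast h)

/-- The only missing pole order is 1. For odd `N` this makes `a ≥ 1`, so the truncated `a - 1` is a
true subtraction. -/
lemma BasisIndex.exists_toNat_eq {N : ℕ} (hN : N ≠ 1) : ∃ i : BasisIndex, i.toNat = N := by
  rcases Nat.even_or_odd' N with ⟨a, h | h⟩
  · exact ⟨Sum.inl a, h.symm⟩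
  · refine ⟨Sum.inr (a - 1), ?_⟩
    simp only [BasisIndex.toNat]
    omega

lemma meromorphic_eFun (L : PeriodPair) (i : BasisIndex) (z : ℂ) : MeromorphicAt (eFun L i) z := by
  have h1 := L.meromorphic_weierstrassP z
  have h2 := L.meromorphic_derivWeierstrassP z
  rcases i with a | a <;> simp only [eFun]
  · exact h1.pow a
  · exact ((MeromorphicAt.const _ z).mul (h1.pow a)).mul h2

open Classical in
/-- The function `e_i` as an element of `𝓕`. -/
def eElem (L : PeriodPair) (i : BasisIndex) : ellipticSpace L :=
  ⟨fun z => if z ∈ L.lattice then 0 else eFun L i z, by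
    refine ⟨fun z => (meromorphic_eFun L i z).congr ?_, ?_, ?_, fun w hw => if_pos hw⟩
    · filter_upwards [eventually_nhdsNE_notMem_lattice L z] with u hu
      exact (if_neg hu).symm
    · intro z hz
      refine DifferentiableAt.differentiableWithinAt ?_
      have h : DifferentiableAt ℂ (eFun L i) z := by
        have h1 := (hasDerivAt_weierstrassP L hz).differentiableAt
        have h2 := (hasDerivAt_derivWeierstrassP L hz).differentiableAt
        rcases i with a | a <;> simp only [eFun] <;> fun_prop
      refine h.congr_of_eventuallyEq ?_
      filter_upwards [eventually_notMem_lattice hz] with u hu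
      exact if_neg hu
    · intro w hw z
      have h1 := L.weierstrassP_add_coe z ⟨w, hw⟩
      have h2 := L.derivWeierstrassP_add_coe z ⟨w, hw⟩
      simp only at h1 h2
      have h3 : z + w ∈ L.lattice ↔ z ∈ L.lattice :=
        ⟨fun h => by simpa using L.lattice.sub_mem h hw, fun h => L.lattice.add_mem h hw⟩
      have h4 : eFun L i (z + w) = eFun L i z := by
        rcases i with a | a <;> simp only [eFun, h1, h2]
      simp only [h3, h4]⟩

lemma eElem_apply (L : PeriodPair) (i : BasisIndex) {z : ℂ} (hz : z ∉ L.lattice) :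
    (eElem L i : ℂ → ℂ) z = eFun L i z := if_neg hz

lemma tendsto_sq_mul_weierstrassP (L : PeriodPair) :
    Tendsto (fun z => z ^ 2 * ℘[L] z) (𝓝[≠] 0) (𝓝 1) := by
  have h : ContinuousAt (fun z => 1 + z ^ 2 * weierstrassPExcept L 0 z) 0 := by
    have := (L.analyticAt_weierstrassPExcept 0).continuousAt
    fun_prop
  have h2 := h.tendsto.mono_left (nhdsWithin_le_nhds (s := {0}ᶜ))
  simp only [ne_eq, OfNat.ofNat_ne_zero, not_false_eq_true, zero_pow, zero_mul, add_zero] at h2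
  refine h2.congr' ?_
  filter_upwards [self_mem_nhdsWithin] with z hz
  have hz : z ≠ 0 := hz
  rw [weierstrassPExcept_zero_eq]
  field_simp
  ring

lemma tendsto_cube_mul_derivWeierstrassP (L : PeriodPair) :
    Tendsto (fun z => z ^ 3 * ℘'[L] z) (𝓝[≠] 0) (𝓝 (-2)) := by
  have h : ContinuousAt (fun z => -2 + z ^ 3 * derivWeierstrassPExcept L 0 z) 0 := by
    have := (L.analyticAt_derivWeierstrassPExcept 0).continuousAt
    fun_prop
  have h2 := h.tendsto.mono_left (nhdsWithin_le_nhds (s := {0}ᶜ))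
  simp only [ne_eq, OfNat.ofNat_ne_zero, not_false_eq_true, zero_pow, zero_mul, add_zero] at h2
  refine h2.congr' ?_
  filter_upwards [self_mem_nhdsWithin] with z hz
  have hz : z ≠ 0 := hz
  rw [derivWeierstrassPExcept_zero_eq]
  field_simp
  ring

lemma tendsto_pow_mul_eElem (L : PeriodPair) (i : BasisIndex) :
    Tendsto (fun z => z ^ i.toNat * (eElem L i : ℂ → ℂ) z) (𝓝[≠] 0) (𝓝 1) := by
  have h1 := tendsto_sq_mul_weierstrassP L
  have h2 := tendsto_cube_mul_derivWeierstrassP L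
  have h3 : Tendsto (fun z => z ^ i.toNat * eFun L i z) (𝓝[≠] 0) (𝓝 1) := by
    rcases i with a | a
    · have := h1.pow a
      rw [one_pow] at this
      refine this.congr fun z => ?_
      simp only [BasisIndex.toNat, eFun]
      ring
    · have := ((h1.pow a).mul h2).const_mul (-(1 / 2))
      norm_num at this
      refine this.congr fun z => ?_
      simp only [BasisIndex.toNat, eFun]
      ring
  refine h3.congr' ?_
  filter_upwards [eventually_nhdsNE_notMem_lattice L 0] with z hz
  rw [eElem_apply L i hz]

lemma tendsto_pow_mul_eElem_of_lt (L : PeriodPair) (i : BasisIndex) {N : ℕ} (h : i.toNat < N) :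
    Tendsto (fun z => z ^ N * (eElem L i : ℂ → ℂ) z) (𝓝[≠] 0) (𝓝 0) := by
  obtain ⟨k, rfl⟩ := Nat.exists_eq_add_of_lt h
  have h1 : Tendsto (fun z : ℂ => z ^ (k + 1)) (𝓝[≠] 0) (𝓝 0) := by
    have := (continuous_pow (M := ℂ) (k + 1)).continuousAt (x := 0) |>.tendsto
    simp only [ne_eq, Nat.add_eq_zero_iff, one_ne_zero, and_false, not_false_eq_true, zero_pow]
      at this
    exact this.mono_left nhdsWithin_le_nhds
  have := h1.mul (tendsto_pow_mul_eElem L i)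
  rw [zero_mul] at this
  refine this.congr fun z => ?_
  ring

lemma eElem_mem_ellipticSpaceLE (L : PeriodPair) (i : BasisIndex) {N : ℕ} (h : i.toNat ≤ N) :
    eElem L i ∈ ellipticSpaceLE L N := by
  rw [mem_ellipticSpaceLE_iff_tendsto]
  rcases h.lt_or_eq with h | h
  · exact ⟨0, tendsto_pow_mul_eElem_of_lt L i h⟩
  · exact ⟨1, h ▸ tendsto_pow_mul_eElem L i⟩

/-- The pole orders are pairwise distinct. Multiplying a relation by the power of z belonging to the
highest order with nonzero coefficient and passing to the limit at 0 isolates that coefficient. -/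
lemma linearIndependent_eElem (L : PeriodPair) : LinearIndependent ℂ (eElem L) := by
  classical
  rw [linearIndependent_iff']
  intro s g hg
  by_contra! hne
  obtain ⟨i, hi, hgi⟩ := hne
  obtain ⟨j, hj, hmax⟩ := (s.filter (g · ≠ 0)).exists_max_image BasisIndex.toNat
    ⟨i, Finset.mem_filter.2 ⟨hi, hgi⟩⟩
  rw [Finset.mem_filter] at hj
  have hterm : ∀ k ∈ s, Tendsto (fun z => g k * (z ^ j.toNat * (eElem L k : ℂ → ℂ) z)) (𝓝[≠] 0)
      (𝓝 (if k = j then g j else 0)) := by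
    intro k hk
    by_cases hgk : g k = 0
    · have : (if k = j then g j else 0) = 0 := by
        split_ifs with h
        · rw [← h, hgk]
        · rfl
      simp [this, hgk]
    · have hle := hmax k (Finset.mem_filter.2 ⟨hk, hgk⟩)
      split_ifs with h
      · subst h
        simpa using (tendsto_pow_mul_eElem L k).const_mul (g k)
      · have hlt : k.toNat < j.toNat :=
          lt_of_le_of_ne hle fun e => h (BasisIndex.toNat_injective e)
        simpa using (tendsto_pow_mul_eElem_of_lt L k hlt).const_mul (g k)
  have hsum := tendsto_finsetSum s hterm
  rw [Finset.sum_ite_eq' s j, if_pos hj.1] at hsum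
  have hzero : ∀ z, ∑ k ∈ s, g k * (z ^ j.toNat * (eElem L k : ℂ → ℂ) z) = 0 := by
    intro z
    have h1 : ((∑ k ∈ s, g k • eElem L k : ellipticSpace L) : ℂ → ℂ) z = 0 := by
      rw [hg]; rfl
    simp only [Submodule.coe_sum, Submodule.coe_smul, Finset.sum_apply, Pi.smul_apply,
      smul_eq_mul] at h1
    calc _ = z ^ j.toNat * ∑ k ∈ s, g k * (eElem L k : ℂ → ℂ) z := by
          rw [Finset.mul_sum]
          exact Finset.sum_congr rfl fun k _ => by ring
      _ = 0 := by rw [h1, mul_zero]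
  simp only [hzero] at hsum
  exact hj.2 (tendsto_nhds_unique tendsto_const_nhds hsum).symm

/-! ### There are no elliptic functions with a single simple pole -/

/-- A solution of a Riccati equation with constant coefficients which takes the value of a constant
solution is locally constant. -/
lemma apply_ne_of_riccati {f : ℂ → ℂ} {z₀ c r s : ℂ} (hc : c ≠ 0) (hf : AnalyticAt ℂ f z₀)
    (hne : ∀ᶠ z in 𝓝[≠] z₀, f z ≠ r)
    (hode : ∀ᶠ z in 𝓝 z₀, c * deriv f z = -((f z - r) * (f z - s))) : f z₀ ≠ r := by
  intro h0
  have hu : AnalyticAt ℂ (fun z => f z - r) z₀ := hf.sub analyticAt_const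
  have h1 : meromorphicOrderAt (fun z => f z - r) z₀ ≠ ⊤ := by
    rw [meromorphicOrderAt_ne_top_iff_eventually_ne_zero hu.meromorphicAt]
    filter_upwards [hne] with z hz using sub_ne_zero.2 hz
  have h2 : 0 < meromorphicOrderAt (fun z => f z - r) z₀ := by
    rw [← tendsto_zero_iff_meromorphicOrderAt_pos hu.meromorphicAt]
    have := hu.continuousAt.tendsto.mono_left (nhdsWithin_le_nhds (s := {z₀}ᶜ))
    simpa [h0] using this
  -- At a zero of f - r its logarithmic derivative has a simple pole, whereas the equation
  -- identifies it with the analytic function -(f - s)/c.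
  have h3 := meromorphicOrderAt_logDeriv_eq_neg_one hu.meromorphicAt h2.ne' h1
  have h4 : meromorphicOrderAt (logDeriv fun z => f z - r) z₀
      = meromorphicOrderAt (fun z => -(f z - s) / c) z₀ := by
    refine meromorphicOrderAt_congr ?_
    filter_upwards [hne, hode.filter_mono nhdsWithin_le_nhds] with z hz ho
    rw [logDeriv_apply, deriv_sub_const, div_eq_div_iff (sub_ne_zero.2 hz) hc]
    linear_combination ho
  have h5 : AnalyticAt ℂ (fun z => -(f z - s) / c) z₀ := by fun_prop
  have h6 := h5.meromorphicOrderAt_nonneg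
  rw [← h4, h3] at h6
  exact absurd h6 (by decide)

lemma exists_weierstrassP_eq (L : PeriodPair) :
    ∃ P : ℂ → ℂ, AnalyticAt ℂ P 0 ∧ ∀ z, ℘[L] z = 1 / z ^ 2 + P z :=
  ⟨weierstrassPExcept L 0, L.analyticAt_weierstrassPExcept 0, fun z => by
    rw [weierstrassPExcept_zero_eq]; ring⟩

/-- If c ≠ 0, then F² - 2h(0)F - c²℘ and F' + c℘ have no poles, where F = c/z + h(z) near 0, so both
are constant. Eliminating ℘ yields c F' = -(F - r)(F - r') with constants r, r'. A nonconstant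
solution never takes the value r, so 1/(F - r) is elliptic without poles and tends to 0 at the
origin; it would vanish identically, which is absurd. -/
theorem simple_pole_residue_eq_zero (L : PeriodPair) (f : ellipticSpace L) {c : ℂ}
    (hf : Tendsto (fun z => z ^ 1 * (f : ℂ → ℂ) z) (𝓝[≠] 0) (𝓝 c)) : c = 0 := by
  by_contra hc
  set F : ℂ → ℂ := (f : ℂ → ℂ) with hF
  have hm := meromorphicAt_pow_mul L f 1
  have h0 : 0 ≤ meromorphicOrderAt (fun z => z ^ 1 * F z) 0 :=
    (tendsto_nhds_iff_meromorphicOrderAt_nonneg hm).1 ⟨c, hf⟩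
  have hord : meromorphicOrderAt F 0 < 0 := by
    have h1 := (tendsto_ne_zero_iff_meromorphicOrderAt_eq_zero hm).1 ⟨c, hc, hf⟩
    rw [order_pow_mul] at h1
    change _ + meromorphicOrderAt F 0 = 0 at h1
    cases hm : meromorphicOrderAt F 0 with
    | top => rw [hm] at h1; simp at h1
    | coe m =>
      rw [hm] at h1
      norm_cast at h1 ⊢
      omega
  obtain ⟨g, hg, hgf⟩ := hm.meromorphicOrderAt_nonneg_iff.1 h0
  have hg0 : g 0 = c :=
    tendsto_nhds_unique (hg.continuousAt.tendsto.mono_left nhdsWithin_le_nhds) (hf.congr' hgf)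
  obtain ⟨h, hh, -, hhe⟩ := exists_eq_mul_of_apply_zero (f := fun z => g z - c)
    (hg.sub analyticAt_const) (by simp [hg0])
  -- The expansion F = c/z + h(0) + z k(z) shows which multiple of F removes the simple pole of F² -
  -- c²℘.
  obtain ⟨k, hk, -, hke⟩ := exists_eq_mul_of_apply_zero (f := fun z => h z - h 0)
    (hh.sub analyticAt_const) (by simp)
  obtain ⟨P, hP, hPe⟩ := exists_weierstrassP_eq L
  have hexp : F =ᶠ[𝓝[≠] 0] fun z => c / z + h z := by
    filter_upwards [hgf, self_mem_nhdsWithin] with z hz hz0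
    have hz0 : z ≠ 0 := hz0
    have := hhe z
    have h2 : z * F z = c + z * h z := by linear_combination hz + this
    field_simp
    linear_combination h2
  have hFd : ∀ z ∉ L.lattice, AnalyticAt ℂ F z := fun z hz => analyticAt_of_mem L f hz
  have hFp : ∀ w ∈ L.lattice, ∀ z, F (z + w) = F z := fun w hw z => f.2.2.2.1 w hw z
  have hPp : ∀ w ∈ L.lattice, ∀ z, ℘[L] (z + w) = ℘[L] z := fun w hw z =>
    L.weierstrassP_add_coe z ⟨w, hw⟩
  have hPd : ∀ z ∉ L.lattice, DifferentiableAt ℂ ℘[L] z := fun z hz =>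
    (hasDerivAt_weierstrassP L hz).differentiableAt
  -- the square of `F`
  obtain ⟨A, hA⟩ : ∃ A, ∀ z ∉ L.lattice, F z ^ 2 - 2 * h 0 * F z - c ^ 2 * ℘[L] z = A := by
    have hcont : ContinuousAt
        (fun z => 2 * c * k z + h z ^ 2 - 2 * h 0 * h z - c ^ 2 * P z) 0 := by
      have := hk.continuousAt
      have := hh.continuousAt
      have := hP.continuousAt
      fun_prop
    refine ⟨_, eq_const_of_tendsto L
      (f := fun z => F z ^ 2 - 2 * h 0 * F z - c ^ 2 * ℘[L] z) ?_ ?_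
      ((hcont.tendsto.mono_left nhdsWithin_le_nhds).congr' ?_)⟩
    · intro z hz
      have := (hFd z hz).differentiableAt
      have := hPd z hz
      exact DifferentiableAt.differentiableWithinAt (by fun_prop)
    · intro w hw z _
      simp only [hFp w hw, hPp w hw]
    · filter_upwards [hexp, self_mem_nhdsWithin] with z hz hz0
      have hz0 : z ≠ 0 := hz0
      have := hke z
      have e : h z = h 0 + z * k z := by linear_combination this
      rw [hz, hPe]
      field_simp
      rw [e]
      ring
  -- the derivative of `F`
  obtain ⟨B, hB⟩ : ∃ B, ∀ z ∉ L.lattice, deriv F z + c * ℘[L] z = B := by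
    have hcont : ContinuousAt (fun z => deriv h z + c * P z) 0 := by
      have := hh.deriv.continuousAt
      have := hP.continuousAt
      fun_prop
    refine ⟨_, eq_const_of_tendsto L
      (f := fun z => deriv F z + c * ℘[L] z) ?_ ?_
      ((hcont.tendsto.mono_left nhdsWithin_le_nhds).congr' ?_)⟩
    · intro z hz
      have := (hFd z hz).deriv.differentiableAt
      have := hPd z hz
      exact DifferentiableAt.differentiableWithinAt (by fun_prop)
    · intro w hw z _
      have h1 : deriv F (z + w) = deriv F z := by
        rw [← deriv_comp_add_const]
        congr 1
        funext u
        exact hFp w hw u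
      simp only [h1, hPp w hw]
    · filter_upwards [hexp.nhdsNE_deriv, self_mem_nhdsWithin,
        hh.eventually_analyticAt.filter_mono nhdsWithin_le_nhds] with z hz hz0 hhz
      have hz0 : z ≠ 0 := hz0
      have hd : HasDerivAt (fun z => c / z + h z) (c * -(z ^ 2)⁻¹ + deriv h z) z := by
        have := ((hasDerivAt_inv hz0).const_mul c).add hhz.differentiableAt.hasDerivAt
        simpa only [div_eq_mul_inv] using! this
      rw [hz, hd.deriv, hPe]
      ring
  -- `h 0 ± s` are the roots of F² - 2h(0)F - A - cB, the quadratic polynomial produced by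
  -- eliminating ℘.
  obtain ⟨s, hs⟩ := IsAlgClosed.exists_pow_nat_eq (h 0 ^ 2 + A + c * B) (n := 2) two_pos
  have hode : ∀ z ∉ L.lattice,
      c * deriv F z = -((F z - (h 0 + s)) * (F z - (h 0 - s))) := by
    intro z hz
    linear_combination c * hB z hz + hA z hz - hs
  have hFne : ∀ z ∉ L.lattice, F z - (h 0 + s) ≠ 0 := by
    intro z hz
    refine sub_ne_zero.2 (apply_ne_of_riccati (s := h 0 - s) hc (hFd z hz)
      (eventually_ne_of_pole f.2.1 hord _ z) ?_)
    filter_upwards [eventually_notMem_lattice hz] with u hu using hode u hu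
  have hinv : ∀ z ∉ L.lattice, (F z - (h 0 + s))⁻¹ = 0 := by
    refine eq_const_of_tendsto L (f := fun z => (F z - (h 0 + s))⁻¹) ?_ ?_ ?_
    · intro z hz
      exact (((hFd z hz).differentiableAt.sub_const _).inv (hFne z hz)).differentiableWithinAt
    · intro w hw z _
      simp only [hFp w hw]
    · have hid : Tendsto (fun z : ℂ => z) (𝓝[≠] 0) (𝓝 0) :=
        tendsto_id.mono_left nhdsWithin_le_nhds
      have h1 : Tendsto (fun z => z ^ 1 * F z - z * (h 0 + s)) (𝓝[≠] 0) (𝓝 c) := by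
        simpa using hf.sub (hid.mul_const (h 0 + s))
      have h2 := hid.div h1 hc
      rw [zero_div] at h2
      refine h2.congr' ?_
      filter_upwards [self_mem_nhdsWithin] with z hz0
      have hz0 : z ≠ 0 := hz0
      rw [Pi.div_apply, pow_one, ← mul_sub, ← div_div, div_self hz0, one_div]
  exact hFne _ L.ω₁_div_two_notMem_lattice (inv_eq_zero.1 (hinv _ L.ω₁_div_two_notMem_lattice))

/-! ### The basis of the space of elliptic functions -/

/-- Induction on the pole order: subtracting the right multiple of the basis function of order N + 1
lowers it. At order 1 no basis function is available, but there the leading coefficient is zero by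
`simple_pole_residue_eq_zero`. -/
theorem mem_span_eElem (L : PeriodPair) (N : ℕ) (f : ellipticSpace L)
    (hf : f ∈ ellipticSpaceLE L N) :
    f ∈ Submodule.span ℂ (eElem L '' {i | i.toNat ≤ N}) := by
  induction N generalizing f with
  | zero =>
    obtain ⟨c, hc⟩ := (mem_ellipticSpaceLE_iff_tendsto L f 0).1 hf
    simp only [pow_zero, one_mul] at hc
    have h1 := eq_const_of_tendsto L f.2.2.1 (fun w hw z _ => f.2.2.2.1 w hw z) hc
    have h2 : f = c • eElem L (Sum.inl 0) := by
      apply Subtype.ext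
      funext z
      by_cases hz : z ∈ L.lattice
      · rw [f.2.2.2.2 z hz, (c • eElem L (Sum.inl 0)).2.2.2.2 z hz]
      · rw [h1 z hz]
        change c = c * (eElem L (Sum.inl 0) : ℂ → ℂ) z
        rw [eElem_apply L _ hz]
        simp [eFun]
    rw [h2]
    exact Submodule.smul_mem _ _ (Submodule.subset_span ⟨_, by simp [BasisIndex.toNat], rfl⟩)
  | succ N ih =>
    have hmono : Submodule.span ℂ (eElem L '' {i | i.toNat ≤ N}) ≤
        Submodule.span ℂ (eElem L '' {i | i.toNat ≤ N + 1}) :=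
      Submodule.span_mono (Set.image_mono fun i (hi : i.toNat ≤ N) => Nat.le_succ_of_le hi)
    obtain ⟨c, hc⟩ := (mem_ellipticSpaceLE_iff_tendsto L f (N + 1)).1 hf
    rcases eq_or_ne N 0 with rfl | hN
    · obtain rfl := simple_pole_residue_eq_zero L f hc
      exact hmono (ih f (mem_ellipticSpaceLE_of_tendsto_zero L f 0 hc))
    · obtain ⟨i, hi⟩ := BasisIndex.exists_toNat_eq (N := N + 1) (by omega)
      have h1 : Tendsto (fun z => z ^ (N + 1) * ((f - c • eElem L i : ellipticSpace L) : ℂ → ℂ) z)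
          (𝓝[≠] 0) (𝓝 0) := by
        have h2 := hc.sub ((tendsto_pow_mul_eElem L i).const_mul c)
        rw [mul_one, sub_self, hi] at h2
        refine h2.congr fun z => ?_
        simp only [Submodule.coe_sub, Submodule.coe_smul, Pi.sub_apply, Pi.smul_apply, smul_eq_mul]
        ring
      have h2 := hmono (ih _ (mem_ellipticSpaceLE_of_tendsto_zero L _ N h1))
      have h3 : c • eElem L i ∈ Submodule.span ℂ (eElem L '' {i | i.toNat ≤ N + 1}) :=
        Submodule.smul_mem _ _ (Submodule.subset_span ⟨i, hi.le, rfl⟩)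
      simpa using Submodule.add_mem _ h2 h3

/-- The functions `e_i` form a basis of `𝓕`. -/
def ellipticBasis (L : PeriodPair) : Module.Basis BasisIndex ℂ (ellipticSpace L) :=
  Module.Basis.mk (linearIndependent_eElem L) fun f _ => by
    obtain ⟨N, hN⟩ := exists_mem_ellipticSpaceLE L f
    exact Submodule.span_mono (Set.image_subset_range _ _) (mem_span_eElem L N f hN)

lemma ellipticBasis_apply (L : PeriodPair) (i : BasisIndex) : ellipticBasis L i = eElem L i :=
  Module.Basis.mk_apply _ _ i

lemma ellipticSpaceLE_eq_span (L : PeriodPair) (N : ℕ) :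
    ellipticSpaceLE L N = Submodule.span ℂ (eElem L '' {i | i.toNat ≤ N}) := by
  refine le_antisymm (fun f hf => mem_span_eElem L N f hf) (Submodule.span_le.2 ?_)
  rintro _ ⟨i, hi, rfl⟩
  exact eElem_mem_ellipticSpaceLE L i hi

/-! ### Formal sums of monomials -/

lemma coeff_eVar_mul_eVar (m : ℤ →₀ ℕ) (a b : ℤ) :
    MvPowerSeries.coeff m (eVar a * eVar b)
      = if m = Finsupp.single a 1 + Finsupp.single b 1 then 1 else 0 := by
  classical
  rw [eVar, eVar, MvPowerSeries.X_def, MvPowerSeries.X_def, MvPowerSeries.monomial_mul_monomial,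
    MvPowerSeries.coeff_monomial, mul_one]

/-- A term contributes to the coefficient of `m` only if a + kr lies in the support of `m`, and this
index determines r. Without finiteness the `finsum` would take its default value 0. -/
lemma finite_support_formalS {k : ℕ} (hk : 0 < k) (a b : ℤ) (m : ℤ →₀ ℕ) :
    {r : ℕ | MvPowerSeries.coeff m (eVar (a + k * r) * eVar (b - k * r)) ≠ 0}.Finite := by
  have hinj : Function.Injective fun r : ℕ => a + (k : ℤ) * r := by
    intro r s h
    have h1 : (k : ℤ) * r = k * s := by simpa using h
    have h2 : (k : ℤ) ≠ 0 := by exact_mod_cast hk.ne'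
    exact_mod_cast mul_left_cancel₀ h2 h1
  refine (m.support.finite_toSet.preimage hinj.injOn).subset fun r hr => ?_
  simp only [Set.mem_ofPred_eq, coeff_eVar_mul_eVar] at hr
  have hm := (ite_ne_right_iff.1 hr).1
  simp [hm]

/-- Splitting off the first term of a formal sum. -/
lemma formalS_eq_add {k : ℕ} (hk : 0 < k) (a b : ℤ) :
    formalS k a b = eVar a * eVar b + formalS k (a + k) (b - k) := by
  ext m
  rw [map_add]
  change (∑ᶠ r : ℕ, _) = _ + ∑ᶠ r : ℕ, _
  obtain ⟨N, hN⟩ := (finite_support_formalS hk a b m).bddAbove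
  have hshift : ∀ r : ℕ, MvPowerSeries.coeff m (eVar (a + k + k * r) * eVar (b - k - k * r))
      = MvPowerSeries.coeff m (eVar (a + k * (r + 1 : ℕ)) * eVar (b - k * (r + 1 : ℕ))) := by
    intro r
    congr 3 <;> push_cast <;> ring
  rw [finsum_eq_sum_of_support_subset (s := Finset.range (N + 1)),
    finsum_eq_sum_of_support_subset (s := Finset.range N), Finset.sum_range_succ', add_comm]
  · congr 1
    · simp
    · exact Finset.sum_congr rfl fun r _ => (hshift r).symm
  · intro r hr
    rw [Function.mem_support, hshift] at hr
    have := hN hr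
    simpa using this
  · intro r hr
    have := hN hr
    simpa [Nat.lt_succ_iff] using this

/-- The span of the quadratic monomials with indices in a given set. -/
def quadSpan {σ : Type*} (S : Set σ) : Submodule ℂ (MvPolynomial σ ℂ) :=
  Submodule.span ℂ {P | ∃ a ∈ S, ∃ b ∈ S, P = MvPolynomial.X a * MvPolynomial.X b}

lemma X_mul_X_mem_quadSpan {σ : Type*} {S : Set σ} {a b : σ} (ha : a ∈ S) (hb : b ∈ S) :
    (MvPolynomial.X a * MvPolynomial.X b : MvPolynomial σ ℂ) ∈ quadSpan S :=
  Submodule.subset_span ⟨a, ha, b, hb, rfl⟩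

lemma coe_X_mul_X (a b : ℤ) :
    ((MvPolynomial.X a * MvPolynomial.X b : MvPolynomial ℤ ℂ) : MvPowerSeries ℤ ℂ)
      = eVar a * eVar b := by
  rw [MvPolynomial.coe_mul, MvPolynomial.coe_X, MvPolynomial.coe_X]
  rfl

/-- The formal difference of two sums `S_k` is a polynomial when one arises from the other by a
shift; a linear form which telescopes along the sums takes the expected value on it. -/
lemma exists_formalS_sub_of_nat {k : ℕ} (hk : 0 < k) (a b : ℤ) (s : ℕ) :
    ∃ Q : MvPolynomial ℤ ℂ,
      (Q : MvPowerSeries ℤ ℂ) = formalS k a b - formalS k (a + k * s) (b - k * s) ∧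
      (∀ S : Set ℤ, (∀ t : ℤ, 0 ≤ t → t < s → a + k * t ∈ S ∧ b - k * t ∈ S) → Q ∈ quadSpan S) ∧
      ∀ (E : MvPolynomial ℤ ℂ →ₗ[ℂ] ℂ) (Φ : ℤ → ℤ → ℂ),
        (∀ a b, E (MvPolynomial.X a * MvPolynomial.X b) = Φ a b - Φ (a + k) (b - k)) →
        E Q = Φ a b - Φ (a + k * s) (b - k * s) := by
  induction s with
  | zero =>
    exact ⟨0, by simp, fun S _ => Submodule.zero_mem _, fun E Φ _ => by simp⟩
  | succ s ih =>
    obtain ⟨Q, h1, h2, h3⟩ := ih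
    have e1 : a + (k : ℤ) * (s + 1 : ℕ) = a + k * s + k := by push_cast; ring
    have e2 : b - (k : ℤ) * (s + 1 : ℕ) = b - k * s - k := by push_cast; ring
    refine ⟨Q + MvPolynomial.X (a + k * s) * MvPolynomial.X (b - k * s), ?_, fun S hS => ?_,
      fun E Φ hΦ => ?_⟩
    · rw [MvPolynomial.coe_add, h1, coe_X_mul_X, formalS_eq_add hk (a + k * s), e1, e2]
      ring
    · refine Submodule.add_mem _ (h2 S fun t ht0 ht => hS t ht0 (by push_cast; omega)) ?_
      have := hS s (by omega) (by push_cast; omega)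
      exact X_mul_X_mem_quadSpan this.1 this.2
    · rw [map_add, h3 E Φ hΦ, hΦ, e1, e2]
      ring

/-- A negative shift is a positive one started at the other end, with opposite sign. Keeping the
indices that occur and the telescoped value together with `Q` makes its explicit terms unnecessary
later. -/
lemma exists_formalS_sub {k : ℕ} (hk : 0 < k) (a b s : ℤ) :
    ∃ Q : MvPolynomial ℤ ℂ,
      (Q : MvPowerSeries ℤ ℂ) = formalS k a b - formalS k (a + k * s) (b - k * s) ∧
      (∀ S : Set ℤ, (∀ t : ℤ, (0 ≤ t ∧ t < s) ∨ (s ≤ t ∧ t < 0) →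
        a + k * t ∈ S ∧ b - k * t ∈ S) → Q ∈ quadSpan S) ∧
      ∀ (E : MvPolynomial ℤ ℂ →ₗ[ℂ] ℂ) (Φ : ℤ → ℤ → ℂ),
        (∀ a b, E (MvPolynomial.X a * MvPolynomial.X b) = Φ a b - Φ (a + k) (b - k)) →
        E Q = Φ a b - Φ (a + k * s) (b - k * s) := by
  rcases le_total 0 s with hs | hs
  · lift s to ℕ using hs
    obtain ⟨Q, h1, h2, h3⟩ := exists_formalS_sub_of_nat hk a b s
    exact ⟨Q, h1, fun S hS => h2 S fun t h0 h => hS t (Or.inl ⟨h0, h⟩), h3⟩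
  · obtain ⟨r, hr⟩ := Int.eq_ofNat_of_zero_le (neg_nonneg.2 hs)
    obtain rfl : s = -(r : ℤ) := by rw [← hr]; ring
    obtain ⟨Q, h1, h2, h3⟩ := exists_formalS_sub_of_nat hk (a + k * -(r : ℤ)) (b - k * -(r : ℤ)) r
    have e1 : a + (k : ℤ) * -(r : ℤ) + k * r = a := by ring
    have e2 : b - (k : ℤ) * -(r : ℤ) - k * r = b := by ring
    rw [e1, e2] at h1
    refine ⟨-Q, ?_, fun S hS => Submodule.neg_mem _ (h2 S fun t h0 h => ?_), fun E Φ hΦ => ?_⟩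
    · have : ((-Q : MvPolynomial ℤ ℂ) : MvPowerSeries ℤ ℂ) = -(Q : MvPowerSeries ℤ ℂ) :=
        map_neg (MvPolynomial.coeToMvPowerSeries.ringHom (σ := ℤ) (R := ℂ)) Q
      rw [this, h1, neg_sub]
    · have := hS (t - r) (Or.inr ⟨by omega, by omega⟩)
      rw [show a + (k : ℤ) * -(r : ℤ) + k * t = a + k * (t - r) by ring,
        show b - (k : ℤ) * -(r : ℤ) - k * t = b - k * (t - r) by ring]
      exact this
    · have := h3 E Φ hΦ
      rw [e1, e2] at this
      rw [map_neg, this, neg_sub]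

/-! ### Evaluation of quadratic polynomials at a pair of points -/

/-- The coefficient of `ψ₀ψ₁` in the value of a polynomial at `k ↦ u k ψ₀ + v k ψ₁`. -/
def evalQuad {σ : Type*} (u v : σ → ℂ) : MvPolynomial σ ℂ →ₗ[ℂ] ℂ :=
  (MvPolynomial.lcoeff ℂ (Finsupp.single 0 1 + Finsupp.single 1 1)).comp
    (MvPolynomial.aeval fun k =>
      u k • (MvPolynomial.X 0 : MvPolynomial (Fin 2) ℂ) + v k • MvPolynomial.X 1).toLinearMap

lemma coeff_linear_mul_linear (a b c d : ℂ) :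
    MvPolynomial.coeff (Finsupp.single 0 1 + Finsupp.single 1 1)
      ((a • (MvPolynomial.X 0 : MvPolynomial (Fin 2) ℂ) + b • MvPolynomial.X 1) *
        (c • MvPolynomial.X 0 + d • MvPolynomial.X 1)) = a * d + b * c := by
  have h01 : (Finsupp.single (0 : Fin 2) 1 + Finsupp.single 1 1 : Fin 2 →₀ ℕ) ≠
      Finsupp.single 0 1 + Finsupp.single 0 1 := by
    intro h
    simpa using DFunLike.congr_fun h 1
  have h11 : (Finsupp.single (0 : Fin 2) 1 + Finsupp.single 1 1 : Fin 2 →₀ ℕ) ≠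
      Finsupp.single 1 1 + Finsupp.single 1 1 := by
    intro h
    simpa using DFunLike.congr_fun h 0
  have hX : ∀ (i j : Fin 2), (MvPolynomial.X i * MvPolynomial.X j : MvPolynomial (Fin 2) ℂ)
      = MvPolynomial.monomial (Finsupp.single i 1 + Finsupp.single j 1) 1 := by
    intro i j
    simp [MvPolynomial.X, MvPolynomial.monomial_mul]
  simp only [add_mul, mul_add, smul_mul_smul_comm, hX, MvPolynomial.coeff_add,
    MvPolynomial.coeff_smul, MvPolynomial.coeff_monomial]
  rw [if_neg h01.symm, if_neg h11.symm, add_comm (Finsupp.single (1 : Fin 2) 1)]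
  simp [add_comm]

lemma evalQuad_X_mul_X {σ : Type*} (u v : σ → ℂ) (a b : σ) :
    evalQuad u v (MvPolynomial.X a * MvPolynomial.X b) = u a * v b + u b * v a := by
  have h : evalQuad u v (MvPolynomial.X a * MvPolynomial.X b)
      = MvPolynomial.coeff (Finsupp.single 0 1 + Finsupp.single 1 1)
        ((u a • (MvPolynomial.X 0 : MvPolynomial (Fin 2) ℂ) + v a • MvPolynomial.X 1) *
          (u b • MvPolynomial.X 0 + v b • MvPolynomial.X 1)) := by
    simp [evalQuad]
  rw [h, coeff_linear_mul_linear]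
  ring

lemma evalQuad_rename {σ τ : Type*} (g : σ → τ) (u v : τ → ℂ) (P : MvPolynomial σ ℂ) :
    evalQuad u v (MvPolynomial.rename g P) = evalQuad (u ∘ g) (v ∘ g) P := by
  simp only [evalQuad, LinearMap.comp_apply, AlgHom.toLinearMap_apply, MvPolynomial.aeval_rename]
  rfl

/-- The determinant `u a * v b - u b * v a`. -/
def minor (u v : ℤ → ℂ) (a b : ℤ) : ℂ := u a * v b - u b * v a

/-- This is the source of all telescoping: for u = e(x), v = e(y) the recurrences hold with p = ℘(x)
and q = ℘(y), and p - q is the denominator of the kernel. -/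
lemma mul_evalQuad_X_mul_X {u v : ℤ → ℂ} {p q : ℂ} (hu : ∀ j, u (j + 2) = p * u j)
    (hv : ∀ j, v (j + 2) = q * v j) (a b : ℤ) :
    (p - q) * evalQuad u v (MvPolynomial.X a * MvPolynomial.X b)
      = minor u v (a + 2) b - minor u v a (b + 2) := by
  rw [evalQuad_X_mul_X, minor, minor, hu, hu, hv, hv]
  ring

/-- The potential is Φ(a, b) = -minor a (b+2). The right side is left unsimplified so that it
matches Φ(a, b) - Φ(a+k, b-k) with k = 2. -/
lemma mul_evalQuad_telescope_two {u v : ℤ → ℂ} {p q : ℂ} (hu : ∀ j, u (j + 2) = p * u j)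
    (hv : ∀ j, v (j + 2) = q * v j) (a b : ℤ) :
    ((p - q) • evalQuad u v) (MvPolynomial.X a * MvPolynomial.X b)
      = -minor u v a (b + 2) - -minor u v (a + (2 : ℕ)) (b - (2 : ℕ) + 2) := by
  rw [LinearMap.smul_apply, smul_eq_mul, mul_evalQuad_X_mul_X hu hv]
  push_cast
  rw [sub_add_cancel]
  ring

/-- The recurrence has step 2 while the sum has step 1, so the potential is the sum of two
consecutive minors. -/
lemma mul_evalQuad_telescope_one {u v : ℤ → ℂ} {p q : ℂ} (hu : ∀ j, u (j + 2) = p * u j)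
    (hv : ∀ j, v (j + 2) = q * v j) (a b : ℤ) :
    ((p - q) • evalQuad u v) (MvPolynomial.X a * MvPolynomial.X b)
      = (-minor u v a (b + 2) - minor u v (a + 1) (b + 1))
        - (-minor u v (a + (1 : ℕ)) (b - (1 : ℕ) + 2)
          - minor u v (a + (1 : ℕ) + 1) (b - (1 : ℕ) + 1)) := by
  rw [LinearMap.smul_apply, smul_eq_mul, mul_evalQuad_X_mul_X hu hv]
  push_cast
  rw [sub_add_cancel, show a + 1 + 1 = a + 2 by ring, show b - 1 + 2 = b + 1 by ring]
  ring

/-! ### The coordinate brackets are polynomials -/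

/-- The indices of the basis that are at most `N`. -/
def indexSet (N : ℤ) : Set ℤ := {k | k ≤ N ∧ (k = 0 ∨ 2 ≤ k)}

lemma coe_smul' (c : ℂ) (Q : MvPolynomial ℤ ℂ) :
    ((c • Q : MvPolynomial ℤ ℂ) : MvPowerSeries ℤ ℂ) = c • (Q : MvPowerSeries ℤ ℂ) := by
  ext m
  simp

lemma coe_sub' (P Q : MvPolynomial ℤ ℂ) :
    ((P - Q : MvPolynomial ℤ ℂ) : MvPowerSeries ℤ ℂ) = (P : MvPowerSeries ℤ ℂ) - Q :=
  map_sub (MvPolynomial.coeToMvPowerSeries.ringHom (σ := ℤ) (R := ℂ)) P Q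

lemma coe_neg' (P : MvPolynomial ℤ ℂ) :
    ((-P : MvPolynomial ℤ ℂ) : MvPowerSeries ℤ ℂ) = -(P : MvPowerSeries ℤ ℂ) :=
  map_neg (MvPolynomial.coeToMvPowerSeries.ringHom (σ := ℤ) (R := ℂ)) P

lemma minor_swap (u v : ℤ → ℂ) (a b : ℤ) : minor u v b a = -minor u v a b := by
  rw [minor, minor]; ring

/-- Forbidden indices are allowed when the coefficient vanishes. This covers α = N = n in the first
bracket and the index -2 in the third. -/
lemma smul_mem_quadSpan_of {S : Set ℤ} {a b : ℤ} {c : ℂ} (h : c ≠ 0 → a ∈ S ∧ b ∈ S) :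
    c • (MvPolynomial.X a * MvPolynomial.X b : MvPolynomial ℤ ℂ) ∈ quadSpan S := by
  by_cases hc : c = 0
  · simp [hc]
  · exact Submodule.smul_mem _ _ (X_mul_X_mem_quadSpan (h hc).1 (h hc).2)

/-- The sums S₁ differ by a shift, and the indices left between them run from β + 1 to α. Only the
two explicit monomials reach α + 1 or β + 1 with coefficients α - n and β - n, which gives the bound
N. Minors with index raised by 3 are the form produced by the factor ℘'/2. -/
lemma exists_coordBracketOne_of_le (n : ℂ) {α β : ℤ} (hβ : β = 0 ∨ 2 ≤ β) (hα : α = 0 ∨ 2 ≤ α)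
    (hle : β ≤ α) :
    ∃ Q : MvPolynomial ℤ ℂ, (Q : MvPowerSeries ℤ ℂ) = coordBracketOne n α β ∧
      (∀ N : ℤ, α ≤ N → β ≤ N → (α = N → (α : ℂ) = n) → (β = N → (β : ℂ) = n) →
        Q ∈ quadSpan (indexSet N)) ∧
      ∀ (u v : ℤ → ℂ) (p q : ℂ), (∀ j, u (j + 2) = p * u j) → (∀ j, v (j + 2) = q * v j) →
        (p - q) * evalQuad u v Q = -n * (minor u v (α + 3) β + minor u v α (β + 3))
          + (p - q) * (α * (u (α + 1) * v β + u β * v (α + 1))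
            - β * (u α * v (β + 1) + u (β + 1) * v α)) := by
  have hval : ∀ (u v : ℤ → ℂ) (p q : ℂ), (∀ j, u (j + 2) = p * u j) → (∀ j, v (j + 2) = q * v j) →
      -n * (minor u v (α + 1) (β + 2) + minor u v (α + 2) (β + 1))
        + (α - n) * ((p - q) * (u (α + 1) * v β + u β * v (α + 1)))
        - (β - n) * ((p - q) * (u α * v (β + 1) + u (β + 1) * v α))
      = -n * (minor u v (α + 3) β + minor u v α (β + 3))
          + (p - q) * (α * (u (α + 1) * v β + u β * v (α + 1))
            - β * (u α * v (β + 1) + u (β + 1) * v α)) := by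
    intro u v p q hu hv
    have h1 := hu (α + 1)
    have h2 := hu (β + 1)
    have h3 := hv (α + 1)
    have h4 := hv (β + 1)
    rw [show α + 1 + 2 = α + 3 by ring] at h1 h3
    rw [show β + 1 + 2 = β + 3 by ring] at h2 h4
    simp only [minor, h1, h2, h3, h4, hu, hv]
    ring
  rcases hβ with rfl | hβ
  · rcases hα with rfl | hα
    · refine ⟨0, ?_, fun N _ _ _ _ => Submodule.zero_mem _, fun u v p q hu hv => ?_⟩
      · rw [coordBracketOne, sub_self, mul_comm (eVar (0 + 1))]
        simp
      · rw [minor_swap u v 0 (0 + 3)]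
        simp
    -- For β = 0 the forbidden variable e₁ appears at both ends of the sum, contributing -n e₁e_α in
    -- total; this cancels the explicit term n e_αe₁. `Q` is the sum with both ends removed.
    · obtain ⟨Q, h1, h2, h3⟩ := exists_formalS_sub one_pos α 1 (2 - α)
      refine ⟨(n / 2) • Q + ((α : ℂ) - n) • (MvPolynomial.X (α + 1) * MvPolynomial.X 0), ?_,
        fun N hN _ hαN _ => ?_, fun u v p q hu hv => ?_⟩
      · rw [MvPolynomial.coe_add, coe_smul', coe_smul', h1, coe_X_mul_X, coordBracketOne]
        have e1 := formalS_eq_add one_pos α 1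
        have e2 := formalS_eq_add one_pos 1 α
        push_cast at e1 e2 ⊢
        rw [show α + 1 * (2 - α) = 2 by ring, show 1 - 1 * (2 - α) = α - 1 by ring, e1,
          e2, mul_comm (eVar 1)]
        module
      · refine Submodule.add_mem _ (Submodule.smul_mem _ _ (h2 _ fun t ht => ?_))
          (smul_mem_quadSpan_of fun hc => ?_)
        · simp only [indexSet, Set.mem_ofPred_eq]
          push_cast
          omega
        · have : α ≠ N := fun h => hc (by rw [hαN h, sub_self])
          exact ⟨⟨by omega, by omega⟩, by omega, Or.inl rfl⟩
      · rw [map_add, map_smul, map_smul, smul_eq_mul, smul_eq_mul, evalQuad_X_mul_X,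
          ← hval u v p q hu hv]
        have h4 := h3 _ (fun a b => -minor u v a (b + 2) - minor u v (a + 1) (b + 1))
          (mul_evalQuad_telescope_one hu hv)
        rw [LinearMap.smul_apply, smul_eq_mul] at h4
        push_cast at h4 ⊢
        rw [show α + 1 * (2 - α) = 2 by ring, show 1 - 1 * (2 - α) = α - 1 by ring,
          show α - 1 + 2 = α + 1 by ring, show α - 1 + 1 = α by ring] at h4
        have e1 : u 3 = p * u 1 := hu 1
        have e2 : v 3 = q * v 1 := hv 1
        have e3 := hu α
        have e4 := hv α
        simp only [minor, Int.reduceAdd, e1, e2, e3, e4] at h4 ⊢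
        linear_combination (n / 2) * h4
  · obtain ⟨Q, h1, h2, h3⟩ := exists_formalS_sub one_pos (α + 1) β (β - α)
    refine ⟨(n / 2) • Q + ((α : ℂ) - n) • (MvPolynomial.X (α + 1) * MvPolynomial.X β)
      - ((β : ℂ) - n) • (MvPolynomial.X α * MvPolynomial.X (β + 1)), ?_,
      fun N hN hN' hαN hβN => ?_, fun u v p q hu hv => ?_⟩
    · rw [coe_sub', MvPolynomial.coe_add, coe_smul', coe_smul', coe_smul', h1, coe_X_mul_X,
        coe_X_mul_X, coordBracketOne]
      push_cast
      rw [show α + 1 + 1 * (β - α) = β + 1 by ring, show β - 1 * (β - α) = α by ring]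
    · refine Submodule.sub_mem _ (Submodule.add_mem _ (Submodule.smul_mem _ _
        (h2 _ fun t ht => ?_)) (smul_mem_quadSpan_of fun hc => ?_))
        (smul_mem_quadSpan_of fun hc => ?_)
      · simp only [indexSet, Set.mem_ofPred_eq]
        push_cast
        omega
      · have : α ≠ N := fun h => hc (by rw [hαN h, sub_self])
        simp only [indexSet, Set.mem_ofPred_eq]
        omega
      · have : β ≠ N := fun h => hc (by rw [hβN h, sub_self])
        simp only [indexSet, Set.mem_ofPred_eq]
        omega
    · rw [map_sub, map_add, map_smul, map_smul, map_smul, smul_eq_mul, smul_eq_mul, smul_eq_mul,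
        evalQuad_X_mul_X, evalQuad_X_mul_X, ← hval u v p q hu hv]
      have h4 := h3 _ (fun a b => -minor u v a (b + 2) - minor u v (a + 1) (b + 1))
        (mul_evalQuad_telescope_one hu hv)
      rw [LinearMap.smul_apply, smul_eq_mul] at h4
      push_cast at h4
      rw [show α + 1 + 1 * (β - α) = β + 1 by ring, show β - 1 * (β - α) = α by ring,
        show α + 1 + 1 = α + 2 by ring, show β + 1 + 1 = β + 2 by ring] at h4
      simp only [minor] at h4 ⊢
      linear_combination (n / 2) * h4

lemma exists_coordBracketOne (n : ℂ) {α β : ℤ} (hα : α = 0 ∨ 2 ≤ α) (hβ : β = 0 ∨ 2 ≤ β) :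
    ∃ Q : MvPolynomial ℤ ℂ, (Q : MvPowerSeries ℤ ℂ) = coordBracketOne n α β ∧
      (∀ N : ℤ, α ≤ N → β ≤ N → (α = N → (α : ℂ) = n) → (β = N → (β : ℂ) = n) →
        Q ∈ quadSpan (indexSet N)) ∧
      ∀ (u v : ℤ → ℂ) (p q : ℂ), (∀ j, u (j + 2) = p * u j) → (∀ j, v (j + 2) = q * v j) →
        (p - q) * evalQuad u v Q = -n * (minor u v (α + 3) β + minor u v α (β + 3))
          + (p - q) * (α * (u (α + 1) * v β + u β * v (α + 1))
            - β * (u α * v (β + 1) + u (β + 1) * v α)) := by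
  rcases le_total β α with h | h
  · exact exists_coordBracketOne_of_le n hβ hα h
  · obtain ⟨Q, h1, h2, h3⟩ := exists_coordBracketOne_of_le n hα hβ h
    refine ⟨-Q, ?_, fun N a b c d => Submodule.neg_mem _ (h2 N b a d c), fun u v p q hu hv => ?_⟩
    · rw [coe_neg', h1, coordBracketOne, coordBracketOne, mul_comm (eVar α),
        mul_comm (eVar (α + 1))]
      module
    · rw [map_neg, mul_neg, h3 u v p q hu hv]
      simp only [minor]
      ring

/-- The shift by α - β - 1 carries the first pair of indices to the second. Every index is even and
nonnegative, so e₁ cannot occur. -/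
lemma exists_coordBracketTwoEvenOdd (n : ℂ) {α β : ℤ} (hα : 0 ≤ α) (hβ : 0 ≤ β) :
    ∃ Q : MvPolynomial ℤ ℂ, (Q : MvPowerSeries ℤ ℂ) = coordBracketTwoEvenOdd n α β ∧
      (∀ N : ℤ, 2 * α ≤ N → 2 * β + 3 ≤ N → Q ∈ quadSpan (indexSet N)) ∧
      ∀ (u v : ℤ → ℂ) (p q : ℂ), (∀ j, u (j + 2) = p * u j) → (∀ j, v (j + 2) = q * v j) →
        (p - q) * evalQuad u v Q = n / 4 * minor u v (2 * α) (2 * β + 2)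
          + (p - q) * (1 / 4 * (2 * β + 1)
            * (u (2 * α) * v (2 * β) + u (2 * β) * v (2 * α))) := by
  obtain ⟨Q, h1, h2, h3⟩ := exists_formalS_sub two_pos (2 * β + 2) (2 * α - 2) (α - β - 1)
  refine ⟨(n / 8) • Q + (1 / 4 * (2 * (β : ℂ) + 1)) •
    (MvPolynomial.X (2 * α) * MvPolynomial.X (2 * β)), ?_, fun N hN hN' => ?_,
    fun u v p q hu hv => ?_⟩
  · rw [MvPolynomial.coe_add, coe_smul', coe_smul', h1, coe_X_mul_X, coordBracketTwoEvenOdd]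
    push_cast
    rw [show 2 * β + 2 + 2 * (α - β - 1) = 2 * α by ring,
      show 2 * α - 2 - 2 * (α - β - 1) = 2 * β by ring]
  · refine Submodule.add_mem _ (Submodule.smul_mem _ _ (h2 _ fun t ht => ?_))
      (smul_mem_quadSpan_of fun _ => ?_)
    · simp only [indexSet, Set.mem_ofPred_eq]
      push_cast
      omega
    · simp only [indexSet, Set.mem_ofPred_eq]
      omega
  · have h4 := h3 _ (fun a b => -minor u v a (b + 2)) (mul_evalQuad_telescope_two hu hv)
    rw [LinearMap.smul_apply, smul_eq_mul] at h4
    push_cast at h4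
    rw [show 2 * β + 2 + 2 * (α - β - 1) = 2 * α by ring,
      show 2 * α - 2 - 2 * (α - β - 1) = 2 * β by ring, sub_add_cancel] at h4
    rw [map_add, map_smul, map_smul, smul_eq_mul, smul_eq_mul, evalQuad_X_mul_X]
    simp only [minor] at h4 ⊢
    linear_combination (n / 8) * h4

/-- Here the shift is α - β, and the odd indices that survive are at least 3. -/
lemma exists_coordBracketTwoOddOdd (n : ℂ) {α β : ℤ} (hα : 0 ≤ α) (hβ : 0 ≤ β) :
    ∃ Q : MvPolynomial ℤ ℂ, (Q : MvPowerSeries ℤ ℂ) = coordBracketTwoOddOdd n α β ∧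
      (∀ N : ℤ, 2 * α + 3 ≤ N → 2 * β + 3 ≤ N → Q ∈ quadSpan (indexSet N)) ∧
      ∀ (u v : ℤ → ℂ) (p q : ℂ), (∀ j, u (j + 2) = p * u j) → (∀ j, v (j + 2) = q * v j) →
        (p - q) * evalQuad u v Q
          = n / 4 * (minor u v (2 * α + 3) (2 * β + 2) + minor u v (2 * α + 2) (2 * β + 3))
          + (p - q) * (-(1 / 4 * (2 * α + 1)
              * (u (2 * α) * v (2 * β + 3) + u (2 * β + 3) * v (2 * α)))
            + 1 / 4 * (2 * β + 1)
              * (u (2 * α + 3) * v (2 * β) + u (2 * β) * v (2 * α + 3))) := by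
  obtain ⟨Q, h1, h2, h3⟩ := exists_formalS_sub two_pos (2 * β + 2) (2 * α + 1) (α - β)
  refine ⟨(n / 4) • Q - (1 / 4 * (2 * (α : ℂ) + 1)) •
    (MvPolynomial.X (2 * α) * MvPolynomial.X (2 * β + 3)) + (1 / 4 * (2 * (β : ℂ) + 1)) •
    (MvPolynomial.X (2 * α + 3) * MvPolynomial.X (2 * β)), ?_, fun N hN hN' => ?_,
    fun u v p q hu hv => ?_⟩
  · rw [MvPolynomial.coe_add, coe_sub', coe_smul', coe_smul', coe_smul', h1, coe_X_mul_X,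
      coe_X_mul_X, coordBracketTwoOddOdd]
    push_cast
    rw [show 2 * β + 2 + 2 * (α - β) = 2 * α + 2 by ring,
      show 2 * α + 1 - 2 * (α - β) = 2 * β + 1 by ring]
  · refine Submodule.add_mem _ (Submodule.sub_mem _ (Submodule.smul_mem _ _
      (h2 _ fun t ht => ?_)) (smul_mem_quadSpan_of fun _ => ?_)) (smul_mem_quadSpan_of fun _ => ?_)
    all_goals
      simp only [indexSet, Set.mem_ofPred_eq]
      push_cast
      omega
  · have h4 := h3 _ (fun a b => -minor u v a (b + 2)) (mul_evalQuad_telescope_two hu hv)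
    rw [LinearMap.smul_apply, smul_eq_mul] at h4
    push_cast at h4
    rw [show 2 * β + 2 + 2 * (α - β) = 2 * α + 2 by ring,
      show 2 * α + 1 - 2 * (α - β) = 2 * β + 1 by ring,
      show 2 * α + 1 + 2 = 2 * α + 3 by ring, show 2 * β + 1 + 2 = 2 * β + 3 by ring] at h4
    rw [map_add, map_sub, map_smul, map_smul, map_smul, smul_eq_mul, smul_eq_mul, smul_eq_mul,
      evalQuad_X_mul_X, evalQuad_X_mul_X]
    simp only [minor] at h4 ⊢
    linear_combination (n / 4) * h4

lemma exists_coordBracketThreeEvenOdd (n : ℂ) {α β : ℤ} (hα : 0 ≤ α) (hβ : 0 ≤ β) :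
    ∃ Q : MvPolynomial ℤ ℂ, (Q : MvPowerSeries ℤ ℂ) = coordBracketThreeEvenOdd n α β ∧
      (∀ N : ℤ, 2 * α ≤ N → 2 * β + 3 ≤ N → Q ∈ quadSpan (indexSet N)) ∧
      ∀ (u v : ℤ → ℂ) (p q : ℂ), (∀ j, u (j + 2) = p * u j) → (∀ j, v (j + 2) = q * v j) →
        (p - q) * evalQuad u v Q = n / 4 * minor u v (2 * α) (2 * β)
          + (p - q) * (1 / 2 * β
            * (u (2 * α) * v (2 * β - 2) + u (2 * β - 2) * v (2 * α))) := by
  obtain ⟨Q, h1, h2, h3⟩ := exists_formalS_sub two_pos (2 * β) (2 * α - 2) (α - β)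
  refine ⟨(n / 8) • Q + (1 / 2 * (β : ℂ)) •
    (MvPolynomial.X (2 * α) * MvPolynomial.X (2 * β - 2)), ?_, fun N hN hN' => ?_,
    fun u v p q hu hv => ?_⟩
  · rw [MvPolynomial.coe_add, coe_smul', coe_smul', h1, coe_X_mul_X, coordBracketThreeEvenOdd]
    push_cast
    rw [show 2 * β + 2 * (α - β) = 2 * α by ring,
      show 2 * α - 2 - 2 * (α - β) = 2 * β - 2 by ring]
  · refine Submodule.add_mem _ (Submodule.smul_mem _ _ (h2 _ fun t ht => ?_))
      (smul_mem_quadSpan_of fun hc => ?_)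
    · simp only [indexSet, Set.mem_ofPred_eq]
      push_cast
      omega
    -- The monomial containing e_{-2} occurs only for β = 0, where its coefficient vanishes.
    · have : β ≠ 0 := by rintro rfl; simp at hc
      simp only [indexSet, Set.mem_ofPred_eq]
      omega
  · have h4 := h3 _ (fun a b => -minor u v a (b + 2)) (mul_evalQuad_telescope_two hu hv)
    rw [LinearMap.smul_apply, smul_eq_mul] at h4
    push_cast at h4
    rw [show 2 * β + 2 * (α - β) = 2 * α by ring,
      show 2 * α - 2 - 2 * (α - β) = 2 * β - 2 by ring, sub_add_cancel, sub_add_cancel] at h4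
    rw [map_add, map_smul, map_smul, smul_eq_mul, smul_eq_mul, evalQuad_X_mul_X]
    simp only [minor] at h4 ⊢
    linear_combination (n / 8) * h4

lemma exists_coordBracketThreeOddOdd (n : ℂ) {α β : ℤ} (hα : 0 ≤ α) (hβ : 0 ≤ β) :
    ∃ Q : MvPolynomial ℤ ℂ, (Q : MvPowerSeries ℤ ℂ) = coordBracketThreeOddOdd n α β ∧
      (∀ N : ℤ, 2 * α + 3 ≤ N → 2 * β + 3 ≤ N → Q ∈ quadSpan (indexSet N)) ∧
      ∀ (u v : ℤ → ℂ) (p q : ℂ), (∀ j, u (j + 2) = p * u j) → (∀ j, v (j + 2) = q * v j) →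
        (p - q) * evalQuad u v Q
          = n / 4 * (minor u v (2 * α + 3) (2 * β) + minor u v (2 * α) (2 * β + 3))
          + (p - q) * (-(1 / 2 * α
              * (u (2 * α - 2) * v (2 * β + 3) + u (2 * β + 3) * v (2 * α - 2)))
            + 1 / 2 * β
              * (u (2 * α + 3) * v (2 * β - 2) + u (2 * β - 2) * v (2 * α + 3))) := by
  obtain ⟨Q, h1, h2, h3⟩ := exists_formalS_sub two_pos (2 * β) (2 * α + 1) (α - β)
  refine ⟨(n / 4) • Q - (1 / 2 * (α : ℂ)) •
    (MvPolynomial.X (2 * α - 2) * MvPolynomial.X (2 * β + 3)) + (1 / 2 * (β : ℂ)) •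
    (MvPolynomial.X (2 * α + 3) * MvPolynomial.X (2 * β - 2)), ?_, fun N hN hN' => ?_,
    fun u v p q hu hv => ?_⟩
  · rw [MvPolynomial.coe_add, coe_sub', coe_smul', coe_smul', coe_smul', h1, coe_X_mul_X,
      coe_X_mul_X, coordBracketThreeOddOdd]
    push_cast
    rw [show 2 * β + 2 * (α - β) = 2 * α by ring,
      show 2 * α + 1 - 2 * (α - β) = 2 * β + 1 by ring]
  · refine Submodule.add_mem _ (Submodule.sub_mem _ (Submodule.smul_mem _ _
      (h2 _ fun t ht => ?_)) (smul_mem_quadSpan_of fun hc => ?_))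
      (smul_mem_quadSpan_of fun hc => ?_)
    · simp only [indexSet, Set.mem_ofPred_eq]
      push_cast
      omega
    · have : α ≠ 0 := by rintro rfl; simp at hc
      simp only [indexSet, Set.mem_ofPred_eq]
      omega
    · have : β ≠ 0 := by rintro rfl; simp at hc
      simp only [indexSet, Set.mem_ofPred_eq]
      omega
  · have h4 := h3 _ (fun a b => -minor u v a (b + 2)) (mul_evalQuad_telescope_two hu hv)
    rw [LinearMap.smul_apply, smul_eq_mul] at h4
    push_cast at h4
    rw [show 2 * β + 2 * (α - β) = 2 * α by ring,
      show 2 * α + 1 - 2 * (α - β) = 2 * β + 1 by ring,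
      show 2 * α + 1 + 2 = 2 * α + 3 by ring, show 2 * β + 1 + 2 = 2 * β + 3 by ring] at h4
    rw [map_add, map_sub, map_smul, map_smul, map_smul, smul_eq_mul, smul_eq_mul, smul_eq_mul,
      evalQuad_X_mul_X, evalQuad_X_mul_X]
    simp only [minor] at h4 ⊢
    linear_combination (n / 4) * h4

/-! ### The bracket of two basis functions -/

/-- The value of `e_k`, `k ∈ ℤ`, in terms of the values `p` of `℘` and `P` of `℘'`. -/
def eInt (p P : ℂ) (k : ℤ) : ℂ :=
  if Even k then p ^ (k / 2) else -(1 / 2) * p ^ ((k - 3) / 2) * P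

lemma eInt_even (p P : ℂ) (m : ℤ) : eInt p P (2 * m) = p ^ m := by
  rw [eInt, if_pos (even_two_mul m)]
  simp

lemma eInt_odd (p P : ℂ) (m : ℤ) : eInt p P (2 * m + 3) = -(1 / 2) * p ^ m * P := by
  rw [eInt, if_neg (by rw [Int.not_even_iff_odd]; exact ⟨m + 1, by ring⟩)]
  simp

lemma eInt_add_two {p : ℂ} (hp : p ≠ 0) (P : ℂ) (k : ℤ) :
    eInt p P (k + 2) = p * eInt p P k := by
  rcases Int.even_or_odd' k with ⟨m, rfl | rfl⟩
  · rw [show 2 * m + 2 = 2 * (m + 1) by ring, eInt_even, eInt_even, zpow_add_one₀ hp, mul_comm]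
  · rw [show 2 * m + 1 + 2 = 2 * m + 3 by ring, show 2 * m + 1 = 2 * (m - 1) + 3 by ring,
      eInt_odd, eInt_odd, zpow_sub_one₀ hp]
    field_simp

lemma eFun_eq_eInt (L : PeriodPair) (i : BasisIndex) (z : ℂ) :
    eFun L i z = eInt (℘[L] z) (℘'[L] z) i.toInt := by
  rcases i with a | a
  · rw [eFun, BasisIndex.toInt, eInt_even, zpow_natCast]
  · rw [eFun, BasisIndex.toInt, eInt_odd, zpow_natCast]

/-- The value of the derivative of `e_i` in terms of the values `p` of `℘` and `P` of `℘'`. -/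
def eDeriv (g₂ p P : ℂ) : BasisIndex → ℂ
  | Sum.inl a => a * p ^ (a - 1) * P
  | Sum.inr a => -(1 / 2) * (a * p ^ (a - 1) * P * P + p ^ a * (6 * p ^ 2 - g₂ / 2))

lemma hasDerivAt_eElem (L : PeriodPair) (i : BasisIndex) {x : ℂ} (hx : x ∉ L.lattice) :
    HasDerivAt (eElem L i : ℂ → ℂ) (eDeriv L.g₂ (℘[L] x) (℘'[L] x) i) x := by
  have h : HasDerivAt (eFun L i) (eDeriv L.g₂ (℘[L] x) (℘'[L] x) i) x := by
    have h1 := hasDerivAt_weierstrassP L hx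
    have h2 := hasDerivAt_derivWeierstrassP L hx
    rcases i with a | a
    · exact h1.pow a
    · have := ((h1.pow a).mul h2).const_mul (-(1 / 2))
      convert! this using 1
      funext z
      simp only [eFun, Pi.mul_apply, Pi.pow_apply]
      ring
  refine h.congr_of_eventuallyEq ?_
  filter_upwards [eventually_notMem_lattice hx] with u hu using eElem_apply L i hu

/-- The truncated exponent is harmless at a = 0 because of the factor a. -/
lemma natCast_mul_pow_sub_one (p : ℂ) (a : ℕ) :
    (a : ℂ) * p ^ (a - 1) * p = a * p ^ (a : ℤ) := by
  rw [zpow_natCast]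
  rcases a with _ | a
  · simp
  · simp [pow_succ, mul_assoc]

section

variable {g₂ g₃ p P : ℂ}

lemma eDeriv_inl (hp : p ≠ 0) (a : ℕ) :
    eDeriv g₂ p P (Sum.inl a) = -(2 * a) * eInt p P (2 * a + 1) := by
  rw [eDeriv, show (2 : ℤ) * a + 1 = 2 * (a - 1) + 3 by ring, eInt_odd, zpow_sub_one₀ hp]
  have := natCast_mul_pow_sub_one p a
  field_simp
  linear_combination P * this

/-- Replacing P² by the cubic leaves only even-indexed e's. The coefficients of g₂ and g₃ are those
of the explicit monomials in the second and third brackets. -/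
lemma eDeriv_inr (hp : p ≠ 0) (hP : P ^ 2 = 4 * p ^ 3 - g₂ * p - g₃) (a : ℕ) :
    eDeriv g₂ p P (Sum.inr a) = -(2 * a + 3) * eInt p P (2 * a + 4)
      + g₂ * (1 / 4 * (2 * a + 1)) * eInt p P (2 * a)
      + g₃ * (1 / 2 * a) * eInt p P (2 * a - 2) := by
  rw [eDeriv, show (2 : ℤ) * a + 4 = 2 * (a + 1 + 1) by ring,
    show (2 : ℤ) * a - 2 = 2 * (a - 1) by ring, eInt_even, eInt_even, eInt_even,
    zpow_sub_one₀ hp, zpow_add_one₀ hp, zpow_add_one₀ hp, ← zpow_natCast p a]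
  have := natCast_mul_pow_sub_one p a
  field_simp
  linear_combination -8 * P ^ 2 * this - 8 * a * p ^ (a : ℤ) * hP

lemma mul_eInt_even (m : ℤ) : P / 2 * eInt p P (2 * m) = -eInt p P (2 * m + 3) := by
  rw [eInt_even, eInt_odd]
  ring

/-- The numerator of the kernel acts by such multiplications. The corrections with g₂ and g₃ account
for the minors in the second and third brackets. -/
lemma mul_eInt_odd (hp : p ≠ 0) (hP : P ^ 2 = 4 * p ^ 3 - g₂ * p - g₃) (m : ℤ) :
    P / 2 * eInt p P (2 * m + 3) = -eInt p P (2 * m + 6) + g₂ / 4 * eInt p P (2 * m + 2)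
      + g₃ / 4 * eInt p P (2 * m) := by
  rw [show 2 * m + 6 = 2 * (m + 1 + 1 + 1) by ring, show 2 * m + 2 = 2 * (m + 1) by ring,
    eInt_odd, eInt_even, eInt_even, eInt_even, zpow_add_one₀ hp, zpow_add_one₀ hp,
    zpow_add_one₀ hp]
  linear_combination -(1 / 4) * p ^ m * hP

end

lemma BasisIndex.toInt_cases (i : BasisIndex) : i.toInt = 0 ∨ 2 ≤ i.toInt := by
  rcases i with a | a <;> simp only [BasisIndex.toInt] <;> omega

/-- The coordinate brackets as polynomials in the variables `e_k`, `k ∈ ℤ`, and their values. -/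
lemma exists_coord_int (n g₂ g₃ : ℂ) (i j : BasisIndex) :
    ∃ Q₁ Q₂ Q₃ : MvPolynomial ℤ ℂ,
      (Q₁ : MvPowerSeries ℤ ℂ) = coordBracketOne n i.toInt j.toInt ∧
      (Q₂ : MvPowerSeries ℤ ℂ) = coordBracketTwo n i j ∧
      (Q₃ : MvPowerSeries ℤ ℂ) = coordBracketThree n i j ∧
      (∀ N : ℤ, i.toInt ≤ N → j.toInt ≤ N → (i.toInt = N → (i.toInt : ℂ) = n) →
        (j.toInt = N → (j.toInt : ℂ) = n) → Q₁ ∈ quadSpan (indexSet N) ∧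
          Q₂ ∈ quadSpan (indexSet N) ∧ Q₃ ∈ quadSpan (indexSet N)) ∧
      ∀ p P q Q : ℂ, p ≠ 0 → q ≠ 0 → P ^ 2 = 4 * p ^ 3 - g₂ * p - g₃ →
        Q ^ 2 = 4 * q ^ 3 - g₂ * q - g₃ →
        (p - q) * evalQuad (eInt p P) (eInt q Q) (Q₁ + g₂ • Q₂ + g₃ • Q₃)
          = n * ((P + Q) / 2) * minor (eInt p P) (eInt q Q) i.toInt j.toInt
            + (p - q) * (-(eDeriv g₂ p P i * eInt q Q j.toInt)
              - eDeriv g₂ q Q i * eInt p P j.toInt + eInt p P i.toInt * eDeriv g₂ q Q j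
              + eInt q Q i.toInt * eDeriv g₂ p P j) := by
  obtain ⟨Q₁, h11, h12, h13⟩ := exists_coordBracketOne n i.toInt_cases j.toInt_cases
  -- In each parity case the three telescoped values are added with weights 1, g₂, g₃, and the
  -- minors shifted by 3 are traded for multiplication by P/2 and Q/2.
  rcases i with a | a <;> rcases j with b | b
  · refine ⟨Q₁, 0, 0, h11, by simp [coordBracketTwo], by simp [coordBracketThree],
      fun N h1 h2 h3 h4 => ⟨h12 N h1 h2 h3 h4, Submodule.zero_mem _, Submodule.zero_mem _⟩, ?_⟩
    intro p P q Q hp hq hP hQ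
    have e1 := h13 _ _ p q (eInt_add_two hp P) (eInt_add_two hq Q)
    simp only [smul_zero, add_zero, e1, eDeriv_inl hp, eDeriv_inl hq, BasisIndex.toInt, minor]
    have ha := mul_eInt_even (p := p) (P := P) a
    have hb := mul_eInt_even (p := p) (P := P) b
    have ha' := mul_eInt_even (p := q) (P := Q) a
    have hb' := mul_eInt_even (p := q) (P := Q) b
    push_cast
    linear_combination -n * (eInt q Q (2 * b) * ha - eInt q Q (2 * a) * hb
      + eInt p P (2 * a) * hb' - eInt p P (2 * b) * ha')
  · obtain ⟨Q₂, h21, h22, h23⟩ := exists_coordBracketTwoEvenOdd n (Int.natCast_nonneg a)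
      (Int.natCast_nonneg b)
    obtain ⟨Q₃, h31, h32, h33⟩ := exists_coordBracketThreeEvenOdd n (Int.natCast_nonneg a)
      (Int.natCast_nonneg b)
    refine ⟨Q₁, Q₂, Q₃, h11, h21, h31,
      fun N h1 h2 h3 h4 => ⟨h12 N h1 h2 h3 h4, h22 N h1 h2, h32 N h1 h2⟩, ?_⟩
    intro p P q Q hp hq hP hQ
    have e1 := h13 _ _ p q (eInt_add_two hp P) (eInt_add_two hq Q)
    have e2 := h23 _ _ p q (eInt_add_two hp P) (eInt_add_two hq Q)
    have e3 := h33 _ _ p q (eInt_add_two hp P) (eInt_add_two hq Q)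
    simp only [map_add, map_smul, smul_eq_mul, eDeriv_inl hp, eDeriv_inl hq, eDeriv_inr hp hP,
      eDeriv_inr hq hQ, BasisIndex.toInt, minor] at e1 e2 e3 ⊢
    have ha := mul_eInt_even (p := p) (P := P) a
    have hb := mul_eInt_odd hp hP b
    have ha' := mul_eInt_even (p := q) (P := Q) a
    have hb' := mul_eInt_odd hq hQ b
    rw [show (2 : ℤ) * b + 3 + 3 = 2 * b + 6 by ring,
      show (2 : ℤ) * b + 3 + 1 = 2 * b + 4 by ring] at e1
    push_cast at e1 e2 e3 ⊢
    linear_combination e1 + g₂ * e2 + g₃ * e3 - n * (eInt q Q (2 * b + 3) * ha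
      - eInt q Q (2 * a) * hb + eInt p P (2 * a) * hb' - eInt p P (2 * b + 3) * ha')
  · obtain ⟨Q₂, h21, h22, h23⟩ := exists_coordBracketTwoEvenOdd n (Int.natCast_nonneg b)
      (Int.natCast_nonneg a)
    obtain ⟨Q₃, h31, h32, h33⟩ := exists_coordBracketThreeEvenOdd n (Int.natCast_nonneg b)
      (Int.natCast_nonneg a)
    refine ⟨Q₁, -Q₂, -Q₃, h11, by rw [coe_neg', h21]; rfl, by rw [coe_neg', h31]; rfl,
      fun N h1 h2 h3 h4 => ⟨h12 N h1 h2 h3 h4, Submodule.neg_mem _ (h22 N h2 h1),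
        Submodule.neg_mem _ (h32 N h2 h1)⟩, ?_⟩
    intro p P q Q hp hq hP hQ
    have e1 := h13 _ _ p q (eInt_add_two hp P) (eInt_add_two hq Q)
    have e2 := h23 _ _ p q (eInt_add_two hp P) (eInt_add_two hq Q)
    have e3 := h33 _ _ p q (eInt_add_two hp P) (eInt_add_two hq Q)
    simp only [map_add, map_smul, map_neg, smul_eq_mul, eDeriv_inl hp, eDeriv_inl hq,
      eDeriv_inr hp hP, eDeriv_inr hq hQ, BasisIndex.toInt, minor] at e1 e2 e3 ⊢
    have ha := mul_eInt_odd hp hP a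
    have hb := mul_eInt_even (p := p) (P := P) b
    have ha' := mul_eInt_odd hq hQ a
    have hb' := mul_eInt_even (p := q) (P := Q) b
    rw [show (2 : ℤ) * a + 3 + 3 = 2 * a + 6 by ring,
      show (2 : ℤ) * a + 3 + 1 = 2 * a + 4 by ring] at e1
    push_cast at e1 e2 e3 ⊢
    linear_combination e1 - g₂ * e2 - g₃ * e3 - n * (eInt q Q (2 * b) * ha
      - eInt q Q (2 * a + 3) * hb + eInt p P (2 * a + 3) * hb' - eInt p P (2 * b) * ha')
  · obtain ⟨Q₂, h21, h22, h23⟩ := exists_coordBracketTwoOddOdd n (Int.natCast_nonneg a)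
      (Int.natCast_nonneg b)
    obtain ⟨Q₃, h31, h32, h33⟩ := exists_coordBracketThreeOddOdd n (Int.natCast_nonneg a)
      (Int.natCast_nonneg b)
    refine ⟨Q₁, Q₂, Q₃, h11, h21, h31,
      fun N h1 h2 h3 h4 => ⟨h12 N h1 h2 h3 h4, h22 N h1 h2, h32 N h1 h2⟩, ?_⟩
    intro p P q Q hp hq hP hQ
    have e1 := h13 _ _ p q (eInt_add_two hp P) (eInt_add_two hq Q)
    have e2 := h23 _ _ p q (eInt_add_two hp P) (eInt_add_two hq Q)
    have e3 := h33 _ _ p q (eInt_add_two hp P) (eInt_add_two hq Q)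
    simp only [map_add, map_smul, smul_eq_mul, eDeriv_inr hp hP,
      eDeriv_inr hq hQ, BasisIndex.toInt, minor] at e1 e2 e3 ⊢
    have ha := mul_eInt_odd hp hP a
    have hb := mul_eInt_odd hp hP b
    have ha' := mul_eInt_odd hq hQ a
    have hb' := mul_eInt_odd hq hQ b
    rw [show (2 : ℤ) * a + 3 + 3 = 2 * a + 6 by ring,
      show (2 : ℤ) * a + 3 + 1 = 2 * a + 4 by ring, show (2 : ℤ) * b + 3 + 3 = 2 * b + 6 by ring,
      show (2 : ℤ) * b + 3 + 1 = 2 * b + 4 by ring] at e1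
    push_cast at e1 e2 e3 ⊢
    linear_combination e1 + g₂ * e2 + g₃ * e3 - n * (eInt q Q (2 * b + 3) * ha
      - eInt q Q (2 * a + 3) * hb + eInt p P (2 * a + 3) * hb' - eInt p P (2 * b + 3) * ha')

/-- The nonnegative integers other than 1 are exactly the indices of the basis. Renaming is
injective, so one preimage `P` satisfies the index bound for every N at once. -/
lemma exists_rename_eq (Q : MvPolynomial ℤ ℂ) {M : ℤ} (hM : Q ∈ quadSpan (indexSet M)) :
    ∃ P : MvPolynomial BasisIndex ℂ, MvPolynomial.rename BasisIndex.toInt P = Q ∧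
      ∀ N : ℤ, Q ∈ quadSpan (indexSet N) → P ∈ quadSpan {i : BasisIndex | i.toInt ≤ N} := by
  have key : ∀ N : ℤ, Q ∈ quadSpan (indexSet N) →
      ∃ P ∈ quadSpan {i : BasisIndex | i.toInt ≤ N},
        MvPolynomial.rename BasisIndex.toInt P = Q := by
    have hidx : ∀ {N k : ℤ}, k ∈ indexSet N → ∃ i : BasisIndex, i.toInt ≤ N ∧ i.toInt = k := by
      intro N k hk
      obtain ⟨i, hi⟩ := BasisIndex.exists_toNat_eq (N := k.toNat) (by
        have := hk.2; omega)
      have : i.toInt = k := by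
        rw [BasisIndex.toInt_eq, hi]
        have := hk.2
        omega
      exact ⟨i, this ▸ hk.1, this⟩
    intro N hQ
    refine Submodule.span_induction
      (p := fun Q _ => ∃ P ∈ quadSpan {i : BasisIndex | i.toInt ≤ N},
        MvPolynomial.rename BasisIndex.toInt P = Q) ?_ ?_ ?_ ?_ hQ
    · rintro _ ⟨a, ha, b, hb, rfl⟩
      obtain ⟨i, hi, rfl⟩ := hidx ha
      obtain ⟨j, hj, rfl⟩ := hidx hb
      exact ⟨MvPolynomial.X i * MvPolynomial.X j, X_mul_X_mem_quadSpan hi hj, by simp⟩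
    · exact ⟨0, Submodule.zero_mem _, map_zero _⟩
    · rintro _ _ _ _ ⟨P, hP, rfl⟩ ⟨P', hP', rfl⟩
      exact ⟨P + P', Submodule.add_mem _ hP hP', map_add _ _ _⟩
    · rintro c _ _ ⟨P, hP, rfl⟩
      exact ⟨c • P, Submodule.smul_mem _ c hP, map_smul _ _ _⟩
  obtain ⟨P, -, rfl⟩ := key M hM
  refine ⟨P, rfl, fun N hN => ?_⟩
  obtain ⟨P', hP', h⟩ := key N hN
  rwa [MvPolynomial.rename_injective _ BasisIndex.toInt_injective h] at hP'

/-! ### Continuity and symmetry in the two points -/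

lemma continuousAt_evalQuad_left (L : PeriodPair) {x : ℂ} (hx : x ∉ L.lattice)
    (v : BasisIndex → ℂ) {S : Set BasisIndex} {P : MvPolynomial BasisIndex ℂ}
    (hP : P ∈ quadSpan S) :
    ContinuousAt (fun z => evalQuad (fun k => (eElem L k : ℂ → ℂ) z) v P) x := by
  refine Submodule.span_induction
    (p := fun P _ => ContinuousAt (fun z => evalQuad (fun k => (eElem L k : ℂ → ℂ) z) v P) x)
    ?_ ?_ ?_ ?_ hP
  · rintro _ ⟨a, -, b, -, rfl⟩
    simp only [evalQuad_X_mul_X]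
    have h1 := (analyticAt_of_mem L (eElem L a) hx).continuousAt
    have h2 := (analyticAt_of_mem L (eElem L b) hx).continuousAt
    fun_prop
  · simp only [map_zero]
    exact continuousAt_const
  · intro P P' _ _ h h'
    simp only [map_add]
    exact h.add h'
  · intro c P _ h
    simp only [map_smul]
    exact h.const_smul c

lemma evalQuad_swap {σ : Type*} (u v : σ → ℂ) {S : Set σ} {P : MvPolynomial σ ℂ}
    (hP : P ∈ quadSpan S) : evalQuad v u P = evalQuad u v P := by
  refine Submodule.span_induction (p := fun P _ => evalQuad v u P = evalQuad u v P)
    ?_ ?_ ?_ ?_ hP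
  · rintro _ ⟨a, -, b, -, rfl⟩
    rw [evalQuad_X_mul_X, evalQuad_X_mul_X]
    ring
  · simp
  · intro P P' _ _ h h'
    rw [map_add, map_add, h, h']
  · intro c P _ h
    rw [map_smul, map_smul, h]

lemma bracketFun_eq (L : PeriodPair) (n : ℂ) (f g : ℂ → ℂ) (x y : ℂ) :
    bracketFun L n f g x y = n * zetaKernel L x y * (f x * g y - f y * g x)
      - deriv f x * g y - deriv f y * g x + f x * deriv g y + f y * deriv g x := rfl

lemma bracketFun_swap (L : PeriodPair) (n : ℂ) (f g : ℂ → ℂ) (x y : ℂ) :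
    bracketFun L n f g y x = bracketFun L n f g x y := by
  rw [bracketFun_eq, bracketFun_eq, zetaKernel_swap]
  ring

lemma continuousAt_bracketFun_left (L : PeriodPair) (n : ℂ) (f g : ellipticSpace L) {x y : ℂ}
    (hx : x ∉ L.lattice) (hxy : x - y ∉ L.lattice) :
    ContinuousAt (fun z => bracketFun L n f g z y) x := by
  have h1 := (hasDerivAt_zetaKernel_left L hx hxy).continuousAt
  have h2 := (analyticAt_of_mem L f hx).continuousAt
  have h3 := (analyticAt_of_mem L g hx).continuousAt
  have h4 := (analyticAt_of_mem L f hx).deriv.continuousAt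
  have h5 := (analyticAt_of_mem L g hx).deriv.continuousAt
  simp only [bracketFun_eq]
  fun_prop

lemma eventually_nhdsNE_sub_notMem (L : PeriodPair) (x y : ℂ) :
    ∀ᶠ z in 𝓝[≠] x, z - y ∉ L.lattice :=
  (tendsto_sub_nhdsNE x y).eventually (eventually_nhdsNE_notMem_lattice L (x - y))

/-- The bracket of two basis functions in coordinates. -/
theorem exists_coord (L : PeriodPair) (n : ℂ) (i j : BasisIndex) :
    ∃ P₁ P₂ P₃ : MvPolynomial BasisIndex ℂ,
      toFormal P₁ = coordBracketOne n i.toInt j.toInt ∧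
      toFormal P₂ = coordBracketTwo n i j ∧
      toFormal P₃ = coordBracketThree n i j ∧
      P₁ + L.g₂ • P₂ + L.g₃ • P₃ ∈ quadSpan Set.univ ∧
      (∀ N : ℕ, n = N → i.toNat ≤ N → j.toNat ≤ N →
        P₁ + L.g₂ • P₂ + L.g₃ • P₃ ∈ quadSpan {k : BasisIndex | k.toNat ≤ N}) ∧
      ∀ x y : ℂ, x ∉ L.lattice → y ∉ L.lattice → x - y ∉ L.lattice →
        evalQuad (fun k => (eElem L k : ℂ → ℂ) x) (fun k => (eElem L k : ℂ → ℂ) y)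
          (P₁ + L.g₂ • P₂ + L.g₃ • P₃) = bracketFun L n (eElem L i) (eElem L j) x y := by
  obtain ⟨Q₁, Q₂, Q₃, h1, h2, h3, hmem, hval⟩ := exists_coord_int n L.g₂ L.g₃ i j
  -- A strict bound makes the conditions relating the indices to n vacuous, so for every n the
  -- brackets involve basis variables only.
  obtain ⟨M, hiM, hjM⟩ : ∃ M : ℤ, i.toInt < M ∧ j.toInt < M :=
    ⟨max i.toInt j.toInt + 1, by omega, by omega⟩
  obtain ⟨m1, m2, m3⟩ := hmem M hiM.le hjM.le (fun h => absurd h hiM.ne) (fun h => absurd h hjM.ne)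
  obtain ⟨P₁, rfl, hP₁⟩ := exists_rename_eq Q₁ m1
  obtain ⟨P₂, rfl, hP₂⟩ := exists_rename_eq Q₂ m2
  obtain ⟨P₃, rfl, hP₃⟩ := exists_rename_eq Q₃ m3
  set P := P₁ + L.g₂ • P₂ + L.g₃ • P₃ with hPdef
  have hPmem : ∀ N : ℤ, MvPolynomial.rename BasisIndex.toInt P₁ ∈ quadSpan (indexSet N) ∧
      MvPolynomial.rename BasisIndex.toInt P₂ ∈ quadSpan (indexSet N) ∧
      MvPolynomial.rename BasisIndex.toInt P₃ ∈ quadSpan (indexSet N) →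
      P ∈ quadSpan {k : BasisIndex | k.toInt ≤ N} := fun N h =>
    Submodule.add_mem _ (Submodule.add_mem _ (hP₁ N h.1) (Submodule.smul_mem _ _ (hP₂ N h.2.1)))
      (Submodule.smul_mem _ _ (hP₃ N h.2.2))
  have huniv : P ∈ quadSpan Set.univ :=
    Submodule.span_mono (by rintro _ ⟨a, -, b, -, rfl⟩; exact ⟨a, trivial, b, trivial, rfl⟩)
      (hPmem M ⟨m1, m2, m3⟩)
  refine ⟨P₁, P₂, P₃, h1, h2, h3, huniv, fun N hn hi hj => ?_, ?_⟩
  · have := hPmem N (hmem N (by rw [BasisIndex.toInt_eq]; exact_mod_cast hi)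
      (by rw [BasisIndex.toInt_eq]; exact_mod_cast hj) (fun h => by rw [h, hn]; simp)
      (fun h => by rw [h, hn]; simp))
    simpa only [BasisIndex.toInt_eq, Nat.cast_le] using this
  -- the formula at points where it can be divided by `℘(x) - ℘(y)`
  have hgen : ∀ x y : ℂ, x ∉ L.lattice → y ∉ L.lattice → x - y ∉ L.lattice →
      ℘[L] x ≠ 0 → ℘[L] y ≠ 0 → ℘[L] x ≠ ℘[L] y →
      evalQuad (fun k => (eElem L k : ℂ → ℂ) x) (fun k => (eElem L k : ℂ → ℂ) y) P
        = bracketFun L n (eElem L i) (eElem L j) x y := by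
    intro x y hx hy hxy hpx hpy hne
    have hv := hval (℘[L] x) (℘'[L] x) (℘[L] y) (℘'[L] y) hpx hpy (L.derivWeierstrassP_sq x hx)
      (L.derivWeierstrassP_sq y hy)
    have hren : MvPolynomial.rename BasisIndex.toInt P₁
        + L.g₂ • MvPolynomial.rename BasisIndex.toInt P₂
        + L.g₃ • MvPolynomial.rename BasisIndex.toInt P₃
        = MvPolynomial.rename BasisIndex.toInt P := by
      rw [hPdef, map_add, map_add, map_smul, map_smul]
    have hu : ∀ z, z ∉ L.lattice → eInt (℘[L] z) (℘'[L] z) ∘ BasisIndex.toInt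
        = fun k => (eElem L k : ℂ → ℂ) z := by
      intro z hz
      funext k
      rw [Function.comp_apply, ← eFun_eq_eInt, eElem_apply L k hz]
    rw [hren, evalQuad_rename, hu x hx, hu y hy] at hv
    refine mul_left_cancel₀ (sub_ne_zero.2 hne) (hv.trans ?_)
    rw [bracketFun_eq, (hasDerivAt_eElem L i hx).deriv, (hasDerivAt_eElem L j hx).deriv,
      (hasDerivAt_eElem L i hy).deriv, (hasDerivAt_eElem L j hy).deriv, eElem_apply L i hx,
      eElem_apply L j hx, eElem_apply L i hy, eElem_apply L j hy, eFun_eq_eInt, eFun_eq_eInt,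
      eFun_eq_eInt, eFun_eq_eInt, minor]
    linear_combination -n * (eInt (℘[L] x) (℘'[L] x) i.toInt * eInt (℘[L] y) (℘'[L] y) j.toInt
      - eInt (℘[L] x) (℘'[L] x) j.toInt * eInt (℘[L] y) (℘'[L] y) i.toInt)
        * zetaKernel_mul L hx hy hxy
  -- For fixed y the exceptional x are isolated, and both sides are continuous in x. The remaining
  -- condition on y is removed afterwards in the same way, by symmetry.
  have hgen' : ∀ x y : ℂ, x ∉ L.lattice → y ∉ L.lattice → x - y ∉ L.lattice → ℘[L] y ≠ 0 →
      evalQuad (fun k => (eElem L k : ℂ → ℂ) x) (fun k => (eElem L k : ℂ → ℂ) y) P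
        = bracketFun L n (eElem L i) (eElem L j) x y := by
    intro x y hx hy hxy hpy
    refine eq_of_eventually_nhdsNE
      (f := fun x => evalQuad (fun k => (eElem L k : ℂ → ℂ) x) (fun k => (eElem L k : ℂ → ℂ) y) P)
      (continuousAt_evalQuad_left L hx _ huniv)
      (continuousAt_bracketFun_left L n (eElem L i) (eElem L j) hx hxy) ?_
    filter_upwards [eventually_nhdsNE_notMem_lattice L x, eventually_nhdsNE_sub_notMem L x y,
      eventually_weierstrassP_ne L 0 x, eventually_weierstrassP_ne L (℘[L] y) x] with z a b c d
      using hgen z y a hy b c hpy d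
  intro x y hx hy hxy
  have hyx : y - x ∉ L.lattice := fun h => hxy (by simpa using L.lattice.neg_mem h)
  rw [← evalQuad_swap _ _ huniv, ← bracketFun_swap]
  refine eq_of_eventually_nhdsNE
    (f := fun y => evalQuad (fun k => (eElem L k : ℂ → ℂ) y) (fun k => (eElem L k : ℂ → ℂ) x) P)
    (continuousAt_evalQuad_left L hy _ huniv)
    (continuousAt_bracketFun_left L n (eElem L i) (eElem L j) hy hyx) ?_
  filter_upwards [eventually_nhdsNE_notMem_lattice L y, eventually_nhdsNE_sub_notMem L y x,
    eventually_weierstrassP_ne L 0 y] with z a b c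
  rw [evalQuad_swap _ _ huniv, bracketFun_swap]
  exact hgen' x z hx a (fun h => b (by simpa using L.lattice.neg_mem h)) c

/-! ### Contractions on a symmetric algebra -/

section Contraction

variable {V σ : Type*} [AddCommGroup V] [Module ℂ V]

/-- The degree `k` part of the symmetric algebra. -/
abbrev symPow (V : Type*) [AddCommGroup V] [Module ℂ V] (k : ℕ) :
    Submodule ℂ (SymmetricAlgebra ℂ V) :=
  LinearMap.range (SymmetricAlgebra.ι ℂ V) ^ k

/-- The derivation of the symmetric algebra that extends a linear form. -/
def contract (b : Module.Basis σ ℂ V) (l : V →ₗ[ℂ] ℂ) :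
    SymmetricAlgebra ℂ V →ₗ[ℂ] SymmetricAlgebra ℂ V :=
  (SymmetricAlgebra.equivMvPolynomial b).symm.toLinearMap ∘ₗ
    (MvPolynomial.mkDerivation ℂ fun i => MvPolynomial.C (l (b i))).toLinearMap ∘ₗ
      (SymmetricAlgebra.equivMvPolynomial b).toLinearMap

lemma contract_apply (b : Module.Basis σ ℂ V) (l : V →ₗ[ℂ] ℂ) (a : SymmetricAlgebra ℂ V) :
    contract b l a = (SymmetricAlgebra.equivMvPolynomial b).symm
      (MvPolynomial.mkDerivation ℂ (fun i => MvPolynomial.C (l (b i)))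
        (SymmetricAlgebra.equivMvPolynomial b a)) := rfl

lemma contract_mul (b : Module.Basis σ ℂ V) (l : V →ₗ[ℂ] ℂ) (a a' : SymmetricAlgebra ℂ V) :
    contract b l (a * a') = a * contract b l a' + a' * contract b l a := by
  simp only [contract_apply, map_mul, Derivation.leibniz, map_add, smul_eq_mul,
    AlgEquiv.symm_apply_apply]

lemma contract_ι (b : Module.Basis σ ℂ V) (l : V →ₗ[ℂ] ℂ) (v : V) :
    contract b l (SymmetricAlgebra.ι ℂ V v) = algebraMap ℂ _ (l v) := by
  have h : (contract b l).comp (SymmetricAlgebra.ι ℂ V) = (Algebra.linearMap ℂ _).comp l := by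
    refine b.ext fun i => ?_
    simp only [LinearMap.comp_apply, contract_apply, SymmetricAlgebra.equivMvPolynomial_ι_apply,
      MvPolynomial.mkDerivation_X, Algebra.linearMap_apply]
    exact (SymmetricAlgebra.equivMvPolynomial b).symm.commutes (l (b i))
  exact LinearMap.congr_fun h v

lemma contract_mem (b : Module.Basis σ ℂ V) (l : V →ₗ[ℂ] ℂ) (k : ℕ) :
    ∀ a ∈ symPow V (k + 1), contract b l a ∈ symPow V k := by
  induction k with
  | zero =>
    intro a ha
    rw [symPow, zero_add, pow_one] at ha
    obtain ⟨v, rfl⟩ := ha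
    rw [contract_ι, symPow, pow_zero]
    exact Submodule.algebraMap_mem _
  | succ k ih =>
    intro a ha
    rw [symPow, pow_succ'] at ha
    refine Submodule.mul_induction_on ha ?_ ?_
    · rintro _ ⟨v, rfl⟩ a ha
      rw [contract_mul, contract_ι, mul_comm a, ← Algebra.smul_def]
      refine Submodule.add_mem _ ?_ (Submodule.smul_mem _ _ ha)
      rw [symPow, pow_succ']
      exact Submodule.mul_mem_mul ⟨v, rfl⟩ (ih a ha)
    · intro a a' h h'
      rw [map_add]
      exact Submodule.add_mem _ h h'

lemma algebraMapInv_eq_zero_of_mem (k : ℕ) :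
    ∀ a ∈ symPow V (k + 1), SymmetricAlgebra.algebraMapInv a = 0 := by
  intro a ha
  rw [symPow, pow_succ'] at ha
  refine Submodule.mul_induction_on ha ?_ ?_
  · rintro _ ⟨v, rfl⟩ a _
    rw [map_mul, SymmetricAlgebra.algebraMapInv_ι, zero_mul]
  · intro a a' h h'
    rw [map_add, h, h', add_zero]

/-- Only finitely many variables occur in `p`, so a constant-coefficient derivation acts on it as a
finite sum even when the basis is infinite. -/
lemma mkDerivation_C_eq_sum (c : σ → ℂ) (p : MvPolynomial σ ℂ) :
    MvPolynomial.mkDerivation ℂ (fun i => MvPolynomial.C (c i)) p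
      = ∑ i ∈ p.vars, c i • MvPolynomial.pderiv i p := by
  classical
  have hsum : ∀ (s : Finset σ) (q : MvPolynomial σ ℂ),
      (∑ i ∈ s, c i • MvPolynomial.pderiv i :
        Derivation ℂ (MvPolynomial σ ℂ) (MvPolynomial σ ℂ)) q
        = ∑ i ∈ s, (c i • MvPolynomial.pderiv i :
            Derivation ℂ (MvPolynomial σ ℂ) (MvPolynomial σ ℂ)) q := by
    intro s q
    induction s using Finset.induction_on with
    | empty => simp
    | insert i s hi ih => rw [Finset.sum_insert hi, Finset.sum_insert hi, Derivation.add_apply, ih]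
  have h : MvPolynomial.mkDerivation ℂ (fun i => (MvPolynomial.C (c i) : MvPolynomial σ ℂ)) p
      = (∑ i ∈ p.vars, c i • MvPolynomial.pderiv i :
          Derivation ℂ (MvPolynomial σ ℂ) (MvPolynomial σ ℂ)) p := by
    refine MvPolynomial.derivation_eq_of_forall_mem_vars fun j hj => ?_
    rw [MvPolynomial.mkDerivation_X, hsum, Finset.sum_eq_single j]
    · simp [MvPolynomial.C_eq_smul_one]
    · intro i _ hij
      simp [MvPolynomial.pderiv_X_of_ne hij.symm]
    · exact fun h => absurd hj h
  rw [h, hsum]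
  rfl

/-- An element of positive degree which is annihilated by sufficiently many contractions is zero. -/
theorem eq_zero_of_contract (b : Module.Basis σ ℂ V) (T : Set (V →ₗ[ℂ] ℂ))
    (hT : ∀ v, (∀ l ∈ T, l v = 0) → v = 0) {k : ℕ} {a : SymmetricAlgebra ℂ V}
    (ha : a ∈ symPow V (k + 1)) (h : ∀ l ∈ T, contract b l a = 0) : a = 0 := by
  classical
  set p := SymmetricAlgebra.equivMvPolynomial b a with hp
  have hd : ∀ l ∈ T, ∑ i ∈ p.vars, l (b i) • MvPolynomial.pderiv i p = 0 := by
    intro l hl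
    have := h l hl
    rw [contract_apply, map_eq_zero_iff _ (AlgEquiv.injective _)] at this
    rw [← mkDerivation_C_eq_sum]
    exact this
  have hpd : ∀ i, MvPolynomial.pderiv i p = 0 := by
    intro i
    by_cases hi : i ∈ p.vars
    · ext m
      -- The m-th coefficients of all partial derivatives form one vector, on which every form in
      -- `T` vanishes. It is therefore zero, and linear independence separates its entries.
      have hv : ∑ i ∈ p.vars, MvPolynomial.coeff m (MvPolynomial.pderiv i p) • b i = 0 := by
        refine hT _ fun l hl => ?_
        have := congrArg (MvPolynomial.coeff m) (hd l hl)
        rw [MvPolynomial.coeff_sum, MvPolynomial.coeff_zero] at this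
        rw [map_sum, ← this]
        refine Finset.sum_congr rfl fun j _ => ?_
        rw [map_smul, MvPolynomial.coeff_smul, smul_eq_mul, smul_eq_mul, mul_comm]
      exact linearIndependent_iff'.1 b.linearIndependent _ _ hv i hi
    · exact MvPolynomial.pderiv_eq_zero_of_notMem_vars hi
  -- In characteristic zero, vanishing partial derivatives leave only a constant, which the positive
  -- degree then excludes.
  have hp0 : p = MvPolynomial.C (MvPolynomial.coeff 0 p) := by
    ext m
    rw [MvPolynomial.coeff_C]
    split_ifs with hm
    · rw [hm]
    · obtain ⟨i, hi⟩ := Finsupp.ne_iff.1 (Ne.symm hm)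
      have h1 := MvPolynomial.coeff_pderiv (i := i) p (m - Finsupp.single i 1)
      rw [hpd i, MvPolynomial.coeff_zero, tsub_add_cancel_of_le (by
        rw [Finsupp.single_le_iff]; exact Nat.one_le_iff_ne_zero.2 hi)] at h1
      rcases mul_eq_zero.1 h1.symm with h2 | h2
      · exact h2
      · norm_cast at h2
  have ha' : a = algebraMap ℂ _ (MvPolynomial.coeff 0 p) := by
    have h1 := congrArg (SymmetricAlgebra.equivMvPolynomial b).symm hp0
    rw [hp, AlgEquiv.symm_apply_apply] at h1
    exact h1.trans ((SymmetricAlgebra.equivMvPolynomial b).symm.commutes _)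
  have h0 := algebraMapInv_eq_zero_of_mem k a ha
  rw [ha', SymmetricAlgebra.algebraMap_leftInverse] at h0
  rw [ha', h0, map_zero]

/-- The pairing of two linear forms with the degree two part of an element. -/
def pairing (b : Module.Basis σ ℂ V) (l₀ l₁ : V →ₗ[ℂ] ℂ) : SymmetricAlgebra ℂ V →ₗ[ℂ] ℂ :=
  SymmetricAlgebra.algebraMapInv.toLinearMap ∘ₗ contract b l₁ ∘ₗ contract b l₀

/-- The pairing of three linear forms with the degree three part of an element. -/
def triplePairing (b : Module.Basis σ ℂ V) (l₀ l₁ l₂ : V →ₗ[ℂ] ℂ) :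
    SymmetricAlgebra ℂ V →ₗ[ℂ] ℂ :=
  pairing b l₁ l₂ ∘ₗ contract b l₀

lemma contract_algebraMap (b : Module.Basis σ ℂ V) (l : V →ₗ[ℂ] ℂ) (r : ℂ) :
    contract b l (algebraMap ℂ _ r) = 0 := by
  rw [contract_apply, AlgEquiv.commutes, Derivation.map_algebraMap, map_zero]

lemma pairing_ι_mul_ι (b : Module.Basis σ ℂ V) (l₀ l₁ : V →ₗ[ℂ] ℂ) (v w : V) :
    pairing b l₀ l₁ (SymmetricAlgebra.ι ℂ V v * SymmetricAlgebra.ι ℂ V w)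
      = l₀ v * l₁ w + l₀ w * l₁ v := by
  simp only [pairing, LinearMap.comp_apply, contract_mul, contract_ι, map_add,
    contract_algebraMap, mul_zero, zero_add, AlgHom.toLinearMap_apply, map_mul,
    AlgHom.commutes, Algebra.algebraMap_self, RingHom.id_apply]
  ring

/-- Exactly one of the contractions must hit `v`: the term where none does is killed by
`algebraMapInv`, and none can hit it twice. -/
lemma triplePairing_mul_ι (b : Module.Basis σ ℂ V) (l₀ l₁ l₂ : V →ₗ[ℂ] ℂ)
    (a : SymmetricAlgebra ℂ V) (v : V) :
    triplePairing b l₀ l₁ l₂ (a * SymmetricAlgebra.ι ℂ V v)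
      = l₀ v * pairing b l₁ l₂ a + l₁ v * pairing b l₀ l₂ a + l₂ v * pairing b l₀ l₁ a := by
  simp only [triplePairing, pairing, LinearMap.comp_apply, contract_mul, contract_ι, map_add,
    contract_algebraMap, mul_zero, zero_add, add_zero, AlgHom.toLinearMap_apply, map_mul,
    AlgHom.commutes, Algebra.algebraMap_self, RingHom.id_apply, SymmetricAlgebra.algebraMapInv_ι,
    zero_mul]
  ring

lemma sq_induction {motive : SymmetricAlgebra ℂ V → Prop}
    (mul : ∀ v w, motive (SymmetricAlgebra.ι ℂ V v * SymmetricAlgebra.ι ℂ V w))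
    (add : ∀ a a', motive a → motive a' → motive (a + a'))
    {a : SymmetricAlgebra ℂ V} (ha : a ∈ symPow V 2) : motive a := by
  rw [symPow, pow_two] at ha
  refine Submodule.mul_induction_on ha ?_ add
  rintro _ ⟨v, rfl⟩ _ ⟨w, rfl⟩
  exact mul v w

lemma eq_zero_of_mem_symPow_zero {a : SymmetricAlgebra ℂ V} (ha : a ∈ symPow V 0)
    (h : SymmetricAlgebra.algebraMapInv a = 0) : a = 0 := by
  rw [symPow, pow_zero] at ha
  obtain ⟨r, rfl⟩ := Submodule.mem_one.1 ha
  rw [SymmetricAlgebra.algebraMap_leftInverse] at h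
  rw [h, map_zero]

end Contraction

/-! ### Brackets on a symmetric algebra -/

section Bracket

variable {V σ : Type*} [AddCommGroup V] [Module ℂ V]

/-- A bilinear operation that is a derivation in each argument. -/
structure IsBiderivation {A : Type*} [CommRing A] [Algebra ℂ A] (br : A →ₗ[ℂ] A →ₗ[ℂ] A) :
    Prop where
  leibniz_right : ∀ a b c, br a (b * c) = br a b * c + b * br a c
  leibniz_left : ∀ a b c, br (a * b) c = br a c * b + a * br b c

lemma IsPoissonBracket.skew {A : Type*} [CommRing A] [Algebra ℂ A] {br : A →ₗ[ℂ] A →ₗ[ℂ] A}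
    (h : IsPoissonBracket br) (a b : A) : br a b = -br b a := by
  have := h.alternating (a + b)
  simp only [map_add, LinearMap.add_apply, h.alternating, zero_add, add_zero] at this
  exact eq_neg_of_add_eq_zero_right this

lemma IsPoissonBracket.isBiderivation {A : Type*} [CommRing A] [Algebra ℂ A]
    {br : A →ₗ[ℂ] A →ₗ[ℂ] A} (h : IsPoissonBracket br) : IsBiderivation br :=
  ⟨h.leibniz, fun a b c => by rw [h.skew, h.leibniz, h.skew c a, h.skew c b]; ring⟩

lemma IsBiderivation.apply_algebraMap {A : Type*} [CommRing A] [Algebra ℂ A]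
    {br : A →ₗ[ℂ] A →ₗ[ℂ] A} (h : IsBiderivation br) (a : A) (r : ℂ) :
    br a (algebraMap ℂ A r) = 0 := by
  have := h.leibniz_right a 1 1
  rw [mul_one, mul_one, one_mul, left_eq_add] at this
  rw [Algebra.algebraMap_eq_smul_one, map_smul, this, smul_zero]

lemma IsBiderivation.algebraMap_apply {A : Type*} [CommRing A] [Algebra ℂ A]
    {br : A →ₗ[ℂ] A →ₗ[ℂ] A} (h : IsBiderivation br) (a : A) (r : ℂ) :
    br (algebraMap ℂ A r) a = 0 := by
  have := h.leibniz_left 1 1 a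
  rw [mul_one, mul_one, one_mul, left_eq_add] at this
  rw [Algebra.algebraMap_eq_smul_one, map_smul, LinearMap.smul_apply, this, smul_zero]

/-- Biderivations of a symmetric algebra are determined by their values on generators. -/
lemma IsBiderivation.ext_ι
    {br br' : SymmetricAlgebra ℂ V →ₗ[ℂ] SymmetricAlgebra ℂ V →ₗ[ℂ] SymmetricAlgebra ℂ V}
    (h : IsBiderivation br)
    (h' : IsBiderivation br')
    (hι : ∀ v w, br (SymmetricAlgebra.ι ℂ V v) (SymmetricAlgebra.ι ℂ V w)
      = br' (SymmetricAlgebra.ι ℂ V v) (SymmetricAlgebra.ι ℂ V w)) : br = br' := by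
  refine LinearMap.ext₂ fun a b => ?_
  induction a using SymmetricAlgebra.induction with
  | algebraMap r => rw [h.algebraMap_apply, h'.algebraMap_apply]
  | mul a a' ha ha' => rw [h.leibniz_left, h'.leibniz_left, ha, ha']
  | add a a' ha ha' => rw [map_add, map_add, LinearMap.add_apply, LinearMap.add_apply, ha, ha']
  | ι v =>
    induction b using SymmetricAlgebra.induction with
    | algebraMap r => rw [h.apply_algebraMap, h'.apply_algebraMap]
    | mul a a' ha ha' => rw [h.leibniz_right, h'.leibniz_right, ha, ha']
    | add a a' ha ha' => rw [map_add, map_add, ha, ha']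
    | ι w => exact hι v w

/-- The negative of the flipped operation is again a biderivation with the same values on
generators. -/
lemma IsBiderivation.skew_of_ι
    {br : SymmetricAlgebra ℂ V →ₗ[ℂ] SymmetricAlgebra ℂ V →ₗ[ℂ] SymmetricAlgebra ℂ V}
    (h : IsBiderivation br)
    (hι : ∀ v w, br (SymmetricAlgebra.ι ℂ V v) (SymmetricAlgebra.ι ℂ V w)
      = -br (SymmetricAlgebra.ι ℂ V w) (SymmetricAlgebra.ι ℂ V v)) (a b : SymmetricAlgebra ℂ V) :
    br a b = -br b a := by
  have h' : IsBiderivation (-br.flip) :=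
    ⟨fun a b c => by
      simp only [LinearMap.neg_apply, LinearMap.flip_apply, h.leibniz_left]; ring,
    fun a b c => by
      simp only [LinearMap.neg_apply, LinearMap.flip_apply, h.leibniz_right]; ring⟩
  have := h.ext_ι h' (fun v w => by simpa using hι v w)
  exact LinearMap.congr_fun₂ this a b

/-- By skew-symmetry the Jacobiator is a derivation in its last argument. Being cyclically
invariant, it can be reduced to generators one slot at a time, `hrot` moving each slot to the end.
-/
lemma IsBiderivation.jacobi_of_ι
    {br : SymmetricAlgebra ℂ V →ₗ[ℂ] SymmetricAlgebra ℂ V →ₗ[ℂ] SymmetricAlgebra ℂ V}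
    (h : IsBiderivation br)
    (hs : ∀ a b, br a b = -br b a)
    (hι : ∀ u v w, br (SymmetricAlgebra.ι ℂ V u)
        (br (SymmetricAlgebra.ι ℂ V v) (SymmetricAlgebra.ι ℂ V w))
      + br (SymmetricAlgebra.ι ℂ V v) (br (SymmetricAlgebra.ι ℂ V w) (SymmetricAlgebra.ι ℂ V u))
      + br (SymmetricAlgebra.ι ℂ V w) (br (SymmetricAlgebra.ι ℂ V u) (SymmetricAlgebra.ι ℂ V v))
      = 0) (a b c : SymmetricAlgebra ℂ V) :
    br a (br b c) + br b (br c a) + br c (br a b) = 0 := by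
  have hscal : ∀ (a b : SymmetricAlgebra ℂ V) (r : ℂ), br a (br b (algebraMap ℂ _ r))
      + br b (br (algebraMap ℂ _ r) a) + br (algebraMap ℂ _ r) (br a b) = 0 := by
    intro a b r
    simp only [h.apply_algebraMap, h.algebraMap_apply, map_zero, add_zero]
  have hadd : ∀ a b c c' : SymmetricAlgebra ℂ V,
      br a (br b c) + br b (br c a) + br c (br a b) = 0 →
      br a (br b c') + br b (br c' a) + br c' (br a b) = 0 →
      br a (br b (c + c')) + br b (br (c + c') a) + br (c + c') (br a b) = 0 := by
    intro a b c c' h1 h2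
    simp only [map_add, LinearMap.add_apply]
    linear_combination h1 + h2
  have hmul : ∀ a b c c' : SymmetricAlgebra ℂ V,
      br a (br b c) + br b (br c a) + br c (br a b) = 0 →
      br a (br b c') + br b (br c' a) + br c' (br a b) = 0 →
      br a (br b (c * c')) + br b (br (c * c') a) + br (c * c') (br a b) = 0 := by
    intro a b c c' h1 h2
    simp only [h.leibniz_left, h.leibniz_right, map_add] at h1 h2 ⊢
    rw [hs c a, hs c' a] at *
    linear_combination c' * h1 + c * h2
  have hrot : ∀ a b c : SymmetricAlgebra ℂ V,
      br a (br b c) + br b (br c a) + br c (br a b) = 0 →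
      br b (br c a) + br c (br a b) + br a (br b c) = 0 := by
    intro a b c h
    linear_combination h
  induction c using SymmetricAlgebra.induction with
  | algebraMap r => exact hscal a b r
  | mul c c' h1 h2 => exact hmul a b c c' h1 h2
  | add c c' h1 h2 => exact hadd a b c c' h1 h2
  | ι w =>
    refine hrot _ _ _ ?_
    induction b using SymmetricAlgebra.induction with
    | algebraMap r => exact hscal _ _ r
    | mul c c' h1 h2 => exact hmul _ _ c c' h1 h2
    | add c c' h1 h2 => exact hadd _ _ c c' h1 h2
    | ι v =>
      refine hrot _ _ _ ?_
      induction a using SymmetricAlgebra.induction with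
      | algebraMap r => exact hscal _ _ r
      | mul c c' h1 h2 => exact hmul _ _ c c' h1 h2
      | add c c' h1 h2 => exact hadd _ _ c c' h1 h2
      | ι u => exact hrot _ _ _ (hι u v w)

/-- A biderivation of a symmetric algebra with prescribed values on a basis. -/
lemma exists_isBiderivation (b : Module.Basis σ ℂ V) (c : σ → σ → SymmetricAlgebra ℂ V) :
    ∃ br : SymmetricAlgebra ℂ V →ₗ[ℂ] SymmetricAlgebra ℂ V →ₗ[ℂ] SymmetricAlgebra ℂ V,
      IsBiderivation br ∧
      ∀ i j, br (SymmetricAlgebra.ι ℂ V (b i)) (SymmetricAlgebra.ι ℂ V (b j)) = c i j := by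
  set e := SymmetricAlgebra.equivMvPolynomial b with he
  -- A derivation with values in the module of derivations is a biderivation; the universal property
  -- of polynomials is applied twice.
  set D : Derivation ℂ (MvPolynomial σ ℂ)
      (Derivation ℂ (MvPolynomial σ ℂ) (MvPolynomial σ ℂ)) :=
    MvPolynomial.mkDerivation ℂ fun i => MvPolynomial.mkDerivation ℂ fun j => e (c i j) with hD
  refine ⟨LinearMap.mk₂ ℂ (fun x y => e.symm (D (e x) (e y))) ?_ ?_ ?_ ?_, ⟨?_, ?_⟩, ?_⟩
  · intro x x' y
    simp only [map_add, Derivation.add_apply]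
  · intro r x y
    rw [map_smul, Derivation.map_smul, Derivation.smul_apply, map_smul]
  · intro x y y'
    simp only [map_add]
  · intro r x y
    rw [map_smul, Derivation.map_smul, map_smul]
  · intro x y z
    simp only [LinearMap.mk₂_apply, map_mul, Derivation.leibniz, map_add, smul_eq_mul,
      AlgEquiv.symm_apply_apply]
    ring
  · intro x y z
    simp only [LinearMap.mk₂_apply, map_mul, Derivation.leibniz, Derivation.add_apply,
      Derivation.smul_apply, map_add, smul_eq_mul, AlgEquiv.symm_apply_apply]
    ring
  · intro i j
    simp only [LinearMap.mk₂_apply, he, SymmetricAlgebra.equivMvPolynomial_ι_apply, hD,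
      MvPolynomial.mkDerivation_X, AlgEquiv.symm_apply_apply]

end Bracket

/-! ### Evaluation at generic points determines quadratic and cubic elements -/

lemma sub_notMem_lattice_comm {L : PeriodPair} {x y : ℂ} (h : x - y ∉ L.lattice) :
    y - x ∉ L.lattice := by
  simpa using neg_notMem_lattice h

/-- The two excluded cosets leave room for the other points of a generic triple. They are discrete,
so continuity fills them in; on Γ the representative is 0 by convention. -/
lemma eq_zero_of_evalAt (L : PeriodPair) (a b : ℂ) (f : ellipticSpace L)
    (h : ∀ z, z ∉ L.lattice → z - a ∉ L.lattice → z - b ∉ L.lattice → evalAt L z f = 0) :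
    f = 0 := by
  refine Subtype.ext (funext fun z => ?_)
  by_cases hz : z ∈ L.lattice
  · exact f.2.2.2.2 z hz
  · refine eq_of_eventually_nhdsNE (f := (f : ℂ → ℂ)) (g := fun _ => 0)
      (analyticAt_of_mem L f hz).continuousAt continuousAt_const ?_
    filter_upwards [eventually_nhdsNE_notMem_lattice L z, eventually_nhdsNE_sub_notMem L z a,
      eventually_nhdsNE_sub_notMem L z b] with t h1 h2 h3 using h t h1 h2 h3

/-- A quadratic element is determined by its values at generic pairs of points. -/
theorem eq_zero_of_pairing (L : PeriodPair) {q : SymF L} (hq : q ∈ symPow (ellipticSpace L) 2)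
    (h : ∀ x y, x ∉ L.lattice → y ∉ L.lattice → x - y ∉ L.lattice →
      pairing (ellipticBasis L) (evalAt L x) (evalAt L y) q = 0) : q = 0 := by
  refine eq_zero_of_contract (ellipticBasis L) {l | ∃ x, x ∉ L.lattice ∧ l = evalAt L x}
    (fun f hf => eq_zero_of_evalAt L 0 0 f fun z hz _ _ => hf _ ⟨z, hz, rfl⟩) hq ?_
  rintro _ ⟨x, hx, rfl⟩
  refine eq_zero_of_contract (ellipticBasis L)
    {l | ∃ y, (y ∉ L.lattice ∧ y - x ∉ L.lattice) ∧ l = evalAt L y}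
    (fun f hf => eq_zero_of_evalAt L x x f fun z hz hz' _ => hf _ ⟨z, ⟨hz, hz'⟩, rfl⟩)
    (contract_mem _ _ 1 q hq) ?_
  rintro _ ⟨y, ⟨hy, hxy⟩, rfl⟩
  exact eq_zero_of_mem_symPow_zero (contract_mem _ _ 0 _ (contract_mem _ _ 1 q hq))
    (h x y hx hy (sub_notMem_lattice_comm hxy))

/-- A cubic element is determined by its values at generic triples of points. -/
theorem eq_zero_of_triplePairing (L : PeriodPair) {q : SymF L}
    (hq : q ∈ symPow (ellipticSpace L) 3)
    (h : ∀ x y z, x ∉ L.lattice → y ∉ L.lattice → z ∉ L.lattice → x - y ∉ L.lattice →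
      x - z ∉ L.lattice → y - z ∉ L.lattice →
      triplePairing (ellipticBasis L) (evalAt L x) (evalAt L y) (evalAt L z) q = 0) : q = 0 := by
  refine eq_zero_of_contract (ellipticBasis L) {l | ∃ x, x ∉ L.lattice ∧ l = evalAt L x}
    (fun f hf => eq_zero_of_evalAt L 0 0 f fun z hz _ _ => hf _ ⟨z, hz, rfl⟩) hq ?_
  rintro _ ⟨x, hx, rfl⟩
  refine eq_zero_of_contract (ellipticBasis L)
    {l | ∃ y, (y ∉ L.lattice ∧ y - x ∉ L.lattice) ∧ l = evalAt L y}
    (fun f hf => eq_zero_of_evalAt L x x f fun z hz hz' _ => hf _ ⟨z, ⟨hz, hz'⟩, rfl⟩)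
    (contract_mem _ _ 2 q hq) ?_
  rintro _ ⟨y, ⟨hy, hyx⟩, rfl⟩
  refine eq_zero_of_contract (ellipticBasis L)
    {l | ∃ z, (z ∉ L.lattice ∧ z - x ∉ L.lattice ∧ z - y ∉ L.lattice) ∧ l = evalAt L z}
    (fun f hf => eq_zero_of_evalAt L x y f fun z hz h1 h2 => hf _ ⟨z, ⟨hz, h1, h2⟩, rfl⟩)
    (contract_mem _ _ 1 _ (contract_mem _ _ 2 q hq)) ?_
  rintro _ ⟨z, ⟨hz, hzx, hzy⟩, rfl⟩
  exact eq_zero_of_mem_symPow_zero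
    (contract_mem _ _ 0 _ (contract_mem _ _ 1 _ (contract_mem _ _ 2 q hq)))
    (h x y z hx hy hz (sub_notMem_lattice_comm hyx) (sub_notMem_lattice_comm hzx)
      (sub_notMem_lattice_comm hzy))

lemma evalPair_eq_pairing (L : PeriodPair) (x y : ℂ) {q : SymF L}
    (hq : q ∈ symPow (ellipticSpace L) 2) :
    evalPair L x y q = pairing (ellipticBasis L) (evalAt L x) (evalAt L y) q := by
  refine sq_induction (motive := fun q => evalPair L x y q
    = pairing (ellipticBasis L) (evalAt L x) (evalAt L y) q) ?_ ?_ hq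
  · intro f g
    rw [pairing_ι_mul_ι]
    refine (evalPair_mul L x y f g).trans ?_
    simp only [evalAt, LinearMap.comp_apply, LinearMap.proj_apply, Submodule.subtype_apply]
    ring
  · intro a a' h h'
    rw [map_add, ← h, ← h', evalPair, map_add, MvPolynomial.coeff_add]
    rfl

lemma eq_of_evalPair (L : PeriodPair) {q q' : SymF L} (hq : q ∈ symPow (ellipticSpace L) 2)
    (hq' : q' ∈ symPow (ellipticSpace L) 2)
    (h : ∀ x y, x ∉ L.lattice → y ∉ L.lattice → x - y ∉ L.lattice →
      evalPair L x y q = evalPair L x y q') : q = q' := by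
  refine sub_eq_zero.1 (eq_zero_of_pairing L (Submodule.sub_mem _ hq hq') fun x y hx hy hxy => ?_)
  rw [map_sub, ← evalPair_eq_pairing L x y hq, ← evalPair_eq_pairing L x y hq', h x y hx hy hxy,
    sub_self]

lemma evalPair_aeval (L : PeriodPair) (x y : ℂ) (P : MvPolynomial BasisIndex ℂ) :
    evalPair L x y (MvPolynomial.aeval (fun k => inc L (eElem L k)) P)
      = evalQuad (fun k => (eElem L k : ℂ → ℂ) x) (fun k => (eElem L k : ℂ → ℂ) y) P := by
  have h : (SymmetricAlgebra.lift
      ((evalAt L x).smulRight (MvPolynomial.X 0 : MvPolynomial (Fin 2) ℂ) +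
        (evalAt L y).smulRight (MvPolynomial.X 1 : MvPolynomial (Fin 2) ℂ))).comp
      (MvPolynomial.aeval fun k => inc L (eElem L k))
      = MvPolynomial.aeval fun k => (eElem L k : ℂ → ℂ) x •
          (MvPolynomial.X 0 : MvPolynomial (Fin 2) ℂ) + (eElem L k : ℂ → ℂ) y •
            MvPolynomial.X 1 := by
    refine MvPolynomial.algHom_ext fun k => ?_
    rw [AlgHom.comp_apply, MvPolynomial.aeval_X, MvPolynomial.aeval_X,
      SymmetricAlgebra.lift_ι_apply]
    rfl
  exact congrArg (MvPolynomial.coeff _) (DFunLike.congr_fun h P)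

lemma aeval_mem_sq (L : PeriodPair) {S : Set BasisIndex} {W : Submodule ℂ (SymF L)}
    (hW : ∀ k ∈ S, inc L (eElem L k) ∈ W) {P : MvPolynomial BasisIndex ℂ} (hP : P ∈ quadSpan S) :
    MvPolynomial.aeval (fun k => inc L (eElem L k)) P ∈ W ^ 2 := by
  have : quadSpan S ≤ (W ^ 2).comap
      (MvPolynomial.aeval (fun k => inc L (eElem L k))).toLinearMap := by
    refine Submodule.span_le.2 ?_
    rintro _ ⟨a, ha, b, hb, rfl⟩
    rw [SetLike.mem_coe, Submodule.mem_comap, AlgHom.toLinearMap_apply, map_mul,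
      MvPolynomial.aeval_X, MvPolynomial.aeval_X, pow_two]
    exact Submodule.mul_mem_mul (hW a ha) (hW b hb)
  exact this hP

/-! ### The bracket as a bilinear form -/

/-- The linear form `f ↦ f'(x)`. -/
def derivAt (L : PeriodPair) {x : ℂ} (hx : x ∉ L.lattice) : ellipticSpace L →ₗ[ℂ] ℂ where
  toFun f := deriv (f : ℂ → ℂ) x
  map_add' f g := deriv_add (differentiableAt_of_mem L f hx) (differentiableAt_of_mem L g hx)
  map_smul' c f := deriv_const_smul c (differentiableAt_of_mem L f hx)

/-- The function `bracketFun` at a pair of points as a bilinear form. -/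
def bracketForm (L : PeriodPair) (n : ℂ) {x y : ℂ} (hx : x ∉ L.lattice) (hy : y ∉ L.lattice) :
    ellipticSpace L →ₗ[ℂ] ellipticSpace L →ₗ[ℂ] ℂ :=
  LinearMap.mk₂ ℂ (fun f g =>
    n * zetaKernel L x y * (evalAt L x f * evalAt L y g - evalAt L y f * evalAt L x g)
      - derivAt L hx f * evalAt L y g - derivAt L hy f * evalAt L x g
      + evalAt L x f * derivAt L hy g + evalAt L y f * derivAt L hx g)
    (fun _ _ _ => by simp only [map_add]; ring)
    (fun _ _ _ => by simp only [map_smul, smul_eq_mul]; ring)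
    (fun _ _ _ => by simp only [map_add]; ring)
    (fun _ _ _ => by simp only [map_smul, smul_eq_mul]; ring)

lemma bracketForm_apply (L : PeriodPair) (n : ℂ) {x y : ℂ} (hx : x ∉ L.lattice)
    (hy : y ∉ L.lattice) (f g : ellipticSpace L) :
    bracketForm L n hx hy f g = bracketFun L n f g x y := rfl

lemma bracketForm_def (L : PeriodPair) (n : ℂ) {x y : ℂ} (hx : x ∉ L.lattice)
    (hy : y ∉ L.lattice) (f g : ellipticSpace L) :
    bracketForm L n hx hy f g =
      n * zetaKernel L x y * (evalAt L x f * evalAt L y g - evalAt L y f * evalAt L x g)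
      - derivAt L hx f * evalAt L y g - derivAt L hy f * evalAt L x g
      + evalAt L x f * derivAt L hy g + evalAt L y f * derivAt L hx g := rfl

/-- The value of `{f, q}` for `f ∈ 𝓕` and `q ∈ S²𝓕`, with respect to one pair of points. -/
def bracketTerm (L : PeriodPair) (n : ℂ) (f : ellipticSpace L) {x y : ℂ} (hx : x ∉ L.lattice)
    (hy : y ∉ L.lattice) (z : ℂ) (q : SymF L) : ℂ :=
  n * zetaKernel L x y *
      (evalAt L x f * pairing (ellipticBasis L) (evalAt L y) (evalAt L z) q
        - evalAt L y f * pairing (ellipticBasis L) (evalAt L x) (evalAt L z) q)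
    - derivAt L hx f * pairing (ellipticBasis L) (evalAt L y) (evalAt L z) q
    - derivAt L hy f * pairing (ellipticBasis L) (evalAt L x) (evalAt L z) q
    + evalAt L x f * pairing (ellipticBasis L) (derivAt L hy) (evalAt L z) q
    + evalAt L y f * pairing (ellipticBasis L) (derivAt L hx) (evalAt L z) q

/-- By the Leibniz rule {f, gh} = {f,g}h + {f,h}g, each of the three pairs among x, y, z can serve
the bracket while the third point evaluates the remaining factor. Collected over both terms, the
result depends on `q` only through pairings. -/
lemma triplePairing_bracket (L : PeriodPair) (n : ℂ)
    {br : SymF L →ₗ[ℂ] SymF L →ₗ[ℂ] SymF L} (hbr : IsBiderivation br)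
    (hval : ∀ f g, ∀ {x y : ℂ} (hx : x ∉ L.lattice) (hy : y ∉ L.lattice), x - y ∉ L.lattice →
      pairing (ellipticBasis L) (evalAt L x) (evalAt L y) (br (inc L f) (inc L g))
        = bracketForm L n hx hy f g)
    (f : ellipticSpace L) {x y z : ℂ} (hx : x ∉ L.lattice) (hy : y ∉ L.lattice)
    (hz : z ∉ L.lattice) (hxy : x - y ∉ L.lattice) (hxz : x - z ∉ L.lattice)
    (hyz : y - z ∉ L.lattice) {q : SymF L} (hq : q ∈ symPow (ellipticSpace L) 2) :
    triplePairing (ellipticBasis L) (evalAt L x) (evalAt L y) (evalAt L z) (br (inc L f) q)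
      = bracketTerm L n f hx hy z q + bracketTerm L n f hx hz y q
        + bracketTerm L n f hy hz x q := by
  refine sq_induction (motive := fun q =>
    triplePairing (ellipticBasis L) (evalAt L x) (evalAt L y) (evalAt L z) (br (inc L f) q)
      = bracketTerm L n f hx hy z q + bracketTerm L n f hx hz y q
        + bracketTerm L n f hy hz x q) ?_ ?_ hq
  · intro g h
    rw [hbr.leibniz_right, mul_comm (SymmetricAlgebra.ι ℂ _ g), map_add, triplePairing_mul_ι,
      triplePairing_mul_ι]
    simp only [hval _ _ hx hy hxy, hval _ _ hx hz hxz, hval _ _ hy hz hyz, bracketTerm,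
      pairing_ι_mul_ι, bracketForm_def]
    ring
  · intro a a' h h'
    rw [map_add, map_add, h, h']
    simp only [bracketTerm, map_add]
    ring

/-- The derivative of `bracketFun` with respect to `x`. -/
def bracketDeriv (L : PeriodPair) (n : ℂ) (f g : ℂ → ℂ) (x y : ℂ) : ℂ :=
  n * (℘[L] x - ℘[L] (x - y)) * (f x * g y - f y * g x)
    + n * zetaKernel L x y * (deriv f x * g y - f y * deriv g x)
    - deriv (deriv f) x * g y - deriv f y * deriv g x + deriv f x * deriv g y
    + f y * deriv (deriv g) x

lemma hasDerivAt_bracketFun_left (L : PeriodPair) (n : ℂ) (f g : ellipticSpace L) {x y : ℂ}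
    (hx : x ∉ L.lattice) (hxy : x - y ∉ L.lattice) :
    HasDerivAt (fun t => bracketFun L n f g t y) (bracketDeriv L n f g x y) x := by
  have h1 := hasDerivAt_zetaKernel_left L hx hxy
  have h2 := (analyticAt_of_mem L f hx).differentiableAt.hasDerivAt
  have h3 := (analyticAt_of_mem L g hx).differentiableAt.hasDerivAt
  have h4 := (analyticAt_of_mem L f hx).deriv.differentiableAt.hasDerivAt
  have h5 := (analyticAt_of_mem L g hx).deriv.differentiableAt.hasDerivAt
  have h6 := ((((h1.const_mul n).mul ((h2.mul_const ((g : ℂ → ℂ) y)).sub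
    (h3.const_mul ((f : ℂ → ℂ) y)))).sub (h4.mul_const ((g : ℂ → ℂ) y))).sub
    (h3.const_mul (deriv (f : ℂ → ℂ) y))).add (h2.mul_const (deriv (g : ℂ → ℂ) y))
  have h7 := h6.add (h5.const_mul ((f : ℂ → ℂ) y))
  refine (h7.congr_deriv ?_)
  rw [bracketDeriv, Pi.sub_apply]

lemma hasDerivAt_pairing_left (L : PeriodPair) {x : ℂ} (hx : x ∉ L.lattice)
    (l : ellipticSpace L →ₗ[ℂ] ℂ) {q : SymF L} (hq : q ∈ symPow (ellipticSpace L) 2) :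
    HasDerivAt (fun t => pairing (ellipticBasis L) (evalAt L t) l q)
      (pairing (ellipticBasis L) (derivAt L hx) l q) x := by
  refine sq_induction (motive := fun q =>
    HasDerivAt (fun t => pairing (ellipticBasis L) (evalAt L t) l q)
      (pairing (ellipticBasis L) (derivAt L hx) l q) x) ?_ ?_ hq
  · intro f g
    simp only [pairing_ι_mul_ι]
    exact ((analyticAt_of_mem L f hx).differentiableAt.hasDerivAt.mul_const (l g)).add
      ((analyticAt_of_mem L g hx).differentiableAt.hasDerivAt.mul_const (l f))
  · intro a a' h h'
    simp only [map_add]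
    exact h.add h'

/-- Near x the pairing with evaluation at t equals `bracketFun` at t and y; the two sides are the
derivatives of this equality at t = x. -/
lemma pairing_derivAt (L : PeriodPair) (n : ℂ)
    {br : SymF L →ₗ[ℂ] SymF L →ₗ[ℂ] SymF L}
    (hval : ∀ f g, ∀ {x y : ℂ} (hx : x ∉ L.lattice) (hy : y ∉ L.lattice), x - y ∉ L.lattice →
      pairing (ellipticBasis L) (evalAt L x) (evalAt L y) (br (inc L f) (inc L g))
        = bracketForm L n hx hy f g)
    (hmem : ∀ f g, br (inc L f) (inc L g) ∈ symPow (ellipticSpace L) 2)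
    (f g : ellipticSpace L) {x y : ℂ} (hx : x ∉ L.lattice) (hy : y ∉ L.lattice)
    (hxy : x - y ∉ L.lattice) :
    pairing (ellipticBasis L) (derivAt L hx) (evalAt L y) (br (inc L f) (inc L g))
      = bracketDeriv L n f g x y := by
  refine (hasDerivAt_pairing_left L hx _ (hmem f g)).unique
    ((hasDerivAt_bracketFun_left L n f g hx hxy).congr_of_eventuallyEq ?_)
  have hc : ContinuousAt (fun t => t - y) x := by fun_prop
  filter_upwards [eventually_notMem_lattice hx, hc.eventually (eventually_notMem_lattice hxy)]
    with t ht hty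
  exact hval f g ht hy hty

/-- The Jacobi identity for elements of `𝓕`. -/
lemma jacobi_inc (L : PeriodPair) (n : ℂ)
    {br : SymF L →ₗ[ℂ] SymF L →ₗ[ℂ] SymF L} (hbr : IsBiderivation br)
    (hval : ∀ f g, ∀ {x y : ℂ} (hx : x ∉ L.lattice) (hy : y ∉ L.lattice), x - y ∉ L.lattice →
      pairing (ellipticBasis L) (evalAt L x) (evalAt L y) (br (inc L f) (inc L g))
        = bracketForm L n hx hy f g)
    (hmem : ∀ f g, br (inc L f) (inc L g) ∈ symPow (ellipticSpace L) 2)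
    (f g h : ellipticSpace L) :
    br (inc L f) (br (inc L g) (inc L h)) + br (inc L g) (br (inc L h) (inc L f))
      + br (inc L h) (br (inc L f) (inc L g)) = 0 := by
  have hcube : ∀ f, ∀ q ∈ symPow (ellipticSpace L) 2,
      br (inc L f) q ∈ symPow (ellipticSpace L) 3 := by
    intro f q hq
    refine sq_induction (motive := fun q => br (inc L f) q ∈ symPow (ellipticSpace L) 3) ?_ ?_ hq
    · intro g h
      rw [hbr.leibniz_right, mul_comm (SymmetricAlgebra.ι ℂ _ g), symPow, pow_succ]
      exact Submodule.add_mem _ (Submodule.mul_mem_mul (hmem f g) ⟨h, rfl⟩)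
        (Submodule.mul_mem_mul (hmem f h) ⟨g, rfl⟩)
    · intro a a' h h'
      rw [map_add]
      exact Submodule.add_mem _ h h'
  refine eq_zero_of_triplePairing L (Submodule.add_mem _ (Submodule.add_mem _
    (hcube f _ (hmem g h)) (hcube g _ (hmem h f))) (hcube h _ (hmem f g))) ?_
  intro x y z hx hy hz hxy hxz hyz
  have hyx := sub_notMem_lattice_comm hxy
  have hzx := sub_notMem_lattice_comm hxz
  have hzy := sub_notMem_lattice_comm hyz
  have e1 : ℘[L] (y - x) = ℘[L] (x - y) := by rw [← neg_sub x y, L.weierstrassP_neg]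
  have e2 : ℘[L] (z - x) = ℘[L] (x - z) := by rw [← neg_sub x z, L.weierstrassP_neg]
  have e3 : ℘[L] (z - y) = ℘[L] (y - z) := by rw [← neg_sub y z, L.weierstrassP_neg]
  rw [map_add, map_add, triplePairing_bracket L n hbr hval f hx hy hz hxy hxz hyz (hmem g h),
    triplePairing_bracket L n hbr hval g hx hy hz hxy hxz hyz (hmem h f),
    triplePairing_bracket L n hbr hval h hx hy hz hxy hxz hyz (hmem f g)]
  -- After expansion the kernels at the three pairs may be treated as independent quantities: apart
  -- from the kernel's derivative, only its antisymmetry and the evenness of ℘ enter.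
  simp only [bracketTerm, hval _ _ hx hy hxy, hval _ _ hx hz hxz, hval _ _ hy hz hyz,
    hval _ _ hy hx hyx, hval _ _ hz hx hzx, hval _ _ hz hy hzy,
    pairing_derivAt L n hval hmem _ _ hx hy hxy, pairing_derivAt L n hval hmem _ _ hx hz hxz,
    pairing_derivAt L n hval hmem _ _ hy hz hyz, pairing_derivAt L n hval hmem _ _ hy hx hyx,
    pairing_derivAt L n hval hmem _ _ hz hx hzx, pairing_derivAt L n hval hmem _ _ hz hy hzy,
    bracketDeriv, bracketForm_apply, bracketFun_eq, zetaKernel_swap L x y, zetaKernel_swap L x z,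
    zetaKernel_swap L y z, e1, e2, e3]
  have hE : ∀ (x : ℂ) (f : ellipticSpace L), evalAt L x f = (f : ℂ → ℂ) x := fun _ _ => rfl
  have hD : ∀ {x : ℂ} (hx : x ∉ L.lattice) (f : ellipticSpace L),
    derivAt L hx f = deriv (f : ℂ → ℂ) x := fun _ _ => rfl
  simp only [hE, hD]
  ring

/-! ### Existence and uniqueness of the bracket -/

/-- The coordinate polynomials serve as the values on the basis. Membership in S²𝓕 and the formula
extend by bilinearity, and from the formula come skew-symmetry and the Jacobi identity on
generators. -/
theorem exists_isEllipticBracket (L : PeriodPair) (n : ℂ) :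
    ∃ br : SymF L →ₗ[ℂ] SymF L →ₗ[ℂ] SymF L, IsEllipticBracket L n br := by
  choose P₁ P₂ P₃ h1 h2 h3 hmem hN hval using exists_coord L n
  obtain ⟨br, hbr, hbr_e⟩ := exists_isBiderivation (ellipticBasis L) fun i j =>
    MvPolynomial.aeval (fun k => inc L (eElem L k)) (P₁ i j + L.g₂ • P₂ i j + L.g₃ • P₃ i j)
  simp only [ellipticBasis_apply] at hbr_e
  have hsq : ∀ f g, br (inc L f) (inc L g) ∈ symPow (ellipticSpace L) 2 := by
    intro f g
    -- Composing with the quotient map turns membership into the vanishing of a bilinear map, which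
    -- can be tested on a basis.
    have key : ((br.compl₁₂ (inc L) (inc L)).compr₂
        (symPow (ellipticSpace L) 2).mkQ) = 0 := by
      refine LinearMap.ext_basis (ellipticBasis L) (ellipticBasis L) fun i j => ?_
      rw [LinearMap.compr₂_apply, LinearMap.compl₁₂_apply, ellipticBasis_apply,
        ellipticBasis_apply, hbr_e, Submodule.mkQ_apply, LinearMap.zero_apply,
        LinearMap.zero_apply, Submodule.Quotient.mk_eq_zero]
      exact aeval_mem_sq L (fun k _ => LinearMap.mem_range_self _ _) (hmem i j)
    have := LinearMap.congr_fun₂ key f g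
    rwa [LinearMap.compr₂_apply, LinearMap.compl₁₂_apply, Submodule.mkQ_apply,
      LinearMap.zero_apply, LinearMap.zero_apply, Submodule.Quotient.mk_eq_zero] at this
  have hform : ∀ f g, ∀ {x y : ℂ} (hx : x ∉ L.lattice) (hy : y ∉ L.lattice),
      x - y ∉ L.lattice → pairing (ellipticBasis L) (evalAt L x) (evalAt L y)
        (br (inc L f) (inc L g)) = bracketForm L n hx hy f g := by
    intro f g x y hx hy hxy
    have key : (br.compl₁₂ (inc L) (inc L)).compr₂
        (pairing (ellipticBasis L) (evalAt L x) (evalAt L y)) = bracketForm L n hx hy := by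
      refine LinearMap.ext_basis (ellipticBasis L) (ellipticBasis L) fun i j => ?_
      rw [LinearMap.compr₂_apply, LinearMap.compl₁₂_apply, ellipticBasis_apply,
        ellipticBasis_apply, ← evalPair_eq_pairing L x y (hsq _ _), hbr_e, evalPair_aeval,
        hval i j x y hx hy hxy, bracketForm_apply]
    exact LinearMap.congr_fun₂ key f g
  have hskew : ∀ a b, br a b = -br b a := by
    refine hbr.skew_of_ι fun f g => eq_neg_of_add_eq_zero_left ?_
    refine eq_zero_of_pairing L (Submodule.add_mem _ (hsq f g) (hsq g f)) fun x y hx hy hxy => ?_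
    rw [map_add, hform f g hx hy hxy, hform g f hx hy hxy, bracketForm_def, bracketForm_def]
    ring
  have halt : ∀ a, br a a = 0 := by
    intro a
    refine (IsUnit.mk0 (2 : ℂ) two_ne_zero).smul_eq_zero.1 ?_
    rw [two_smul]
    exact add_eq_zero_iff_eq_neg.2 (hskew a a)
  refine ⟨br, ⟨halt, hbr.leibniz_right,
    hbr.jacobi_of_ι hskew (jacobi_inc L n hbr hform hsq)⟩, hsq, fun f g x y hx hy hxy => ?_⟩
  rw [evalPair_eq_pairing L x y (hsq f g), hform f g hx hy hxy, bracketForm_apply]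

lemma IsEllipticBracket.eq {L : PeriodPair} {n : ℂ} {br br' : SymF L →ₗ[ℂ] SymF L →ₗ[ℂ] SymF L}
    (h : IsEllipticBracket L n br) (h' : IsEllipticBracket L n br') : br = br' :=
  h.poisson.isBiderivation.ext_ι h'.poisson.isBiderivation fun f g =>
    eq_of_evalPair L (h.mem_sq f g) (h'.mem_sq f g) fun x y hx hy hxy => by
      rw [h.formula f g x y hx hy hxy, h'.formula f g x y hx hy hxy]

/-- The bracket of two basis functions. -/
lemma IsEllipticBracket.apply_eElem {L : PeriodPair} {n : ℂ}
    {br : SymF L →ₗ[ℂ] SymF L →ₗ[ℂ] SymF L} (h : IsEllipticBracket L n br) (i j : BasisIndex)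
    {P : MvPolynomial BasisIndex ℂ} (hP : P ∈ quadSpan Set.univ)
    (hval : ∀ x y : ℂ, x ∉ L.lattice → y ∉ L.lattice → x - y ∉ L.lattice →
      evalQuad (fun k => (eElem L k : ℂ → ℂ) x) (fun k => (eElem L k : ℂ → ℂ) y) P
        = bracketFun L n (eElem L i) (eElem L j) x y) :
    br (inc L (eElem L i)) (inc L (eElem L j))
      = MvPolynomial.aeval (fun k => inc L (eElem L k)) P :=
  eq_of_evalPair L (h.mem_sq _ _) (aeval_mem_sq L (fun k _ => LinearMap.mem_range_self _ _) hP)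
    fun x y hx hy hxy => by
      rw [h.formula _ _ x y hx hy hxy, evalPair_aeval, hval x y hx hy hxy]

/-! ### Restriction to functions with poles of bounded order -/

/-- For basis functions the index bound in `exists_coord` with n = N does the work: e_{N+1} drops
out because its coefficient is N - n. Bilinearity extends this to the span. -/
lemma IsEllipticBracket.apply_mem_incLE {L : PeriodPair} {N : ℕ}
    {br : SymF L →ₗ[ℂ] SymF L →ₗ[ℂ] SymF L} (h : IsEllipticBracket L N br)
    {f g : ellipticSpace L} (hf : f ∈ ellipticSpaceLE L N) (hg : g ∈ ellipticSpaceLE L N) :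
    br (inc L f) (inc L g) ∈ incLE L N ^ 2 := by
  have hb : ∀ i j : BasisIndex, i.toNat ≤ N → j.toNat ≤ N →
      br (inc L (eElem L i)) (inc L (eElem L j)) ∈ incLE L N ^ 2 := by
    intro i j hi hj
    obtain ⟨P₁, P₂, P₃, -, -, -, hmem, hN, hval⟩ := exists_coord L N i j
    rw [h.apply_eElem i j hmem hval]
    refine aeval_mem_sq L (fun k hk => Submodule.mem_map_of_mem ?_) (hN N rfl hi hj)
    rw [ellipticSpaceLE_eq_span]
    exact Submodule.subset_span ⟨k, hk, rfl⟩
  rw [ellipticSpaceLE_eq_span] at hf hg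
  refine Submodule.span_induction₂ (p := fun f g _ _ => br (inc L f) (inc L g) ∈ incLE L N ^ 2)
    ?_ ?_ ?_ ?_ ?_ ?_ ?_ hf hg
  · rintro _ _ ⟨i, hi, rfl⟩ ⟨j, hj, rfl⟩
    exact hb i j hi hj
  · intro g _
    simp
  · intro g _
    simp
  · intro f f' g _ _ _ h1 h2
    rw [map_add, map_add, LinearMap.add_apply]
    exact Submodule.add_mem _ h1 h2
  · intro f g g' _ _ _ h1 h2
    rw [map_add, map_add]
    exact Submodule.add_mem _ h1 h2
  · intro c f g _ _ h1
    rw [map_smul, map_smul, LinearMap.smul_apply]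
    exact Submodule.smul_mem _ c h1
  · intro c f g _ _ h1
    rw [map_smul, map_smul]
    exact Submodule.smul_mem _ c h1

/-- Over a field the inclusion 𝓕_N → 𝓕 has a linear retraction, which induces an algebra retraction
of symmetric algebras. -/
lemma symIncl_injective (L : PeriodPair) (N : ℕ) : Function.Injective (symIncl L N) := by
  obtain ⟨r, hr⟩ : ∃ r : ellipticSpace L →ₗ[ℂ] ellipticSpaceLE L N,
      r ∘ₗ (ellipticSpaceLE L N).subtype = LinearMap.id :=
    LinearMap.exists_leftInverse_of_injective (K := ℂ)
      (V := ellipticSpaceLE L N) (V' := ellipticSpace L) _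
      (Submodule.ker_subtype (ellipticSpaceLE L N))
  have h : (SymmetricAlgebra.lift ((SymmetricAlgebra.ι ℂ (ellipticSpaceLE L N)).comp r)).comp
      (symIncl L N) = AlgHom.id ℂ _ := by
    refine SymmetricAlgebra.algHom_ext (LinearMap.ext fun f => ?_)
    have hf : r f = f := LinearMap.congr_fun hr f
    simp [symIncl, hf]
  exact Function.LeftInverse.injective (DFunLike.congr_fun h)

/-- A Poisson bracket restricts uniquely to a subalgebra that is closed under it. -/
lemma IsPoissonBracket.existsUnique_restrict {A B : Type*} [CommRing A] [Algebra ℂ A] [CommRing B]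
    [Algebra ℂ B] {br : B →ₗ[ℂ] B →ₗ[ℂ] B} (h : IsPoissonBracket br) (φ : A →ₐ[ℂ] B)
    (hφ : Function.Injective φ) (hrange : ∀ a b, br (φ a) (φ b) ∈ φ.range) :
    ∃! br' : A →ₗ[ℂ] A →ₗ[ℂ] A, IsPoissonBracket br' ∧ ∀ a b, φ (br' a b) = br (φ a) (φ b) := by
  -- A merely linear left inverse suffices to pull the bracket back; the Poisson axioms are verified
  -- after applying the injective `φ`.
  obtain ⟨r, hr⟩ := φ.toLinearMap.exists_leftInverse_of_injective
    (LinearMap.ker_eq_bot.2 hφ)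
  have hval : ∀ a b, φ (((br.compl₁₂ φ.toLinearMap φ.toLinearMap).compr₂ r) a b)
      = br (φ a) (φ b) := by
    intro a b
    obtain ⟨c, hc⟩ := hrange a b
    have hc' : φ c = br (φ a) (φ b) := hc
    have hrc : r (φ c) = c := LinearMap.congr_fun hr c
    rw [LinearMap.compr₂_apply, LinearMap.compl₁₂_apply, AlgHom.toLinearMap_apply,
      AlgHom.toLinearMap_apply, ← hc', hrc]
  refine ⟨_, ⟨⟨fun a => hφ ?_, fun a b c => hφ ?_, fun a b c => hφ ?_⟩, hval⟩, ?_⟩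
  · rw [hval, h.alternating, map_zero]
  · rw [map_add, map_mul φ, map_mul φ, hval, hval, hval, map_mul φ, h.leibniz]
  · rw [map_add, map_add, hval, hval, hval, hval, hval, hval, h.jacobi, map_zero]
  · rintro br' ⟨-, h'⟩
    exact LinearMap.ext₂ fun a b => hφ (by rw [h', hval])

lemma IsEllipticBracket.apply_symIncl_mem_range {L : PeriodPair} {N : ℕ}
    {br : SymF L →ₗ[ℂ] SymF L →ₗ[ℂ] SymF L} (h : IsEllipticBracket L N br)
    (a b : SymmetricAlgebra ℂ (ellipticSpaceLE L N)) :
    br (symIncl L N a) (symIncl L N b) ∈ (symIncl L N).range := by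
  have hd := h.poisson.isBiderivation
  have hle : incLE L N ^ 2 ≤ Subalgebra.toSubmodule (symIncl L N).range := by
    have h1 : incLE L N ≤ Subalgebra.toSubmodule (symIncl L N).range := by
      rintro _ ⟨f, hf, rfl⟩
      exact ⟨SymmetricAlgebra.ι ℂ _ ⟨f, hf⟩, SymmetricAlgebra.lift_ι_apply _ _⟩
    rw [pow_two]
    exact Submodule.mul_le.2 fun x hx y hy => (symIncl L N).range.mul_mem (h1 hx) (h1 hy)
  induction a using SymmetricAlgebra.induction with
  | algebraMap r =>
    rw [AlgHom.commutes, hd.algebraMap_apply]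
    exact Subalgebra.zero_mem _
  | mul a a' ha ha' =>
    rw [map_mul, hd.leibniz_left]
    exact Subalgebra.add_mem _ (Subalgebra.mul_mem _ ha ⟨a', rfl⟩)
      (Subalgebra.mul_mem _ ⟨a, rfl⟩ ha')
  | add a a' ha ha' =>
    rw [map_add, map_add, LinearMap.add_apply]
    exact Subalgebra.add_mem _ ha ha'
  | ι f =>
    induction b using SymmetricAlgebra.induction with
    | algebraMap r =>
      rw [AlgHom.commutes, hd.apply_algebraMap]
      exact Subalgebra.zero_mem _
    | mul b b' hb hb' =>
      rw [map_mul, hd.leibniz_right]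
      exact Subalgebra.add_mem _ (Subalgebra.mul_mem _ hb ⟨b', rfl⟩)
        (Subalgebra.mul_mem _ ⟨b, rfl⟩ hb')
    | add b b' hb hb' =>
      rw [map_add, map_add]
      exact Subalgebra.add_mem _ hb hb'
    | ι g =>
      rw [symIncl, SymmetricAlgebra.lift_ι_apply, SymmetricAlgebra.lift_ι_apply]
      exact hle (h.apply_mem_incLE f.2 g.2)

end OdesskiiElliptic

end

/-! ### The elliptic Poisson bracket: uniqueness, restriction and coordinates -/

theorem proposition2 (L : PeriodPair) (n : ℂ) :
    -- the formula defines a Poisson bracket on the polynomial algebra of the space of functions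
    (∃! br : OdesskiiElliptic.SymF L →ₗ[ℂ] OdesskiiElliptic.SymF L →ₗ[ℂ] OdesskiiElliptic.SymF L,
      OdesskiiElliptic.IsEllipticBracket L n br) ∧
    ∀ br : OdesskiiElliptic.SymF L →ₗ[ℂ] OdesskiiElliptic.SymF L →ₗ[ℂ] OdesskiiElliptic.SymF L,
      OdesskiiElliptic.IsEllipticBracket L n br →
      -- for natural `n` it restricts to functions with poles of order at most `n`
      (∀ N : ℕ, n = (N : ℂ) →
        (∀ f ∈ OdesskiiElliptic.ellipticSpaceLE L N, ∀ g ∈ OdesskiiElliptic.ellipticSpaceLE L N,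
          br (OdesskiiElliptic.inc L f) (OdesskiiElliptic.inc L g)
            ∈ OdesskiiElliptic.incLE L N ^ 2) ∧
        ∃! brN : SymmetricAlgebra ℂ (OdesskiiElliptic.ellipticSpaceLE L N) →ₗ[ℂ]
            SymmetricAlgebra ℂ (OdesskiiElliptic.ellipticSpaceLE L N) →ₗ[ℂ]
              SymmetricAlgebra ℂ (OdesskiiElliptic.ellipticSpaceLE L N),
          OdesskiiElliptic.IsPoissonBracket brN ∧
          ∀ a b, OdesskiiElliptic.symIncl L N (brN a b)
            = br (OdesskiiElliptic.symIncl L N a) (OdesskiiElliptic.symIncl L N b)) ∧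
      -- the bracket in the basis of the functions `e_α`
      (∃ e : Module.Basis OdesskiiElliptic.BasisIndex ℂ (OdesskiiElliptic.ellipticSpace L),
        (∀ i, ∀ z ∉ L.lattice, (e i : ℂ → ℂ) z = OdesskiiElliptic.eFun L i z) ∧
        ∀ i j : OdesskiiElliptic.BasisIndex,
          ∃ P₁ P₂ P₃ : MvPolynomial OdesskiiElliptic.BasisIndex ℂ,
            OdesskiiElliptic.toFormal P₁
              = OdesskiiElliptic.coordBracketOne n (OdesskiiElliptic.BasisIndex.toInt i)
                  (OdesskiiElliptic.BasisIndex.toInt j) ∧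
            OdesskiiElliptic.toFormal P₂ = OdesskiiElliptic.coordBracketTwo n i j ∧
            OdesskiiElliptic.toFormal P₃ = OdesskiiElliptic.coordBracketThree n i j ∧
            br (OdesskiiElliptic.inc L (e i)) (OdesskiiElliptic.inc L (e j))
              = MvPolynomial.aeval (fun k => OdesskiiElliptic.inc L (e k)) P₁
                + L.g₂ • MvPolynomial.aeval (fun k => OdesskiiElliptic.inc L (e k)) P₂
                + L.g₃ • MvPolynomial.aeval (fun k => OdesskiiElliptic.inc L (e k)) P₃) := by
  obtain ⟨br₀, h₀⟩ := OdesskiiElliptic.exists_isEllipticBracket L n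
  refine ⟨⟨br₀, h₀, fun br h => h.eq h₀⟩, fun br h => ⟨?_, ?_⟩⟩
  · rintro N rfl
    exact ⟨fun f hf g hg => h.apply_mem_incLE hf hg,
      h.poisson.existsUnique_restrict _ (OdesskiiElliptic.symIncl_injective L N)
        h.apply_symIncl_mem_range⟩
  · refine ⟨OdesskiiElliptic.ellipticBasis L, fun i z hz => ?_, fun i j => ?_⟩
    · rw [OdesskiiElliptic.ellipticBasis_apply, OdesskiiElliptic.eElem_apply L i hz]
    · obtain ⟨P₁, P₂, P₃, h1, h2, h3, hmem, -, hval⟩ := OdesskiiElliptic.exists_coord L n i j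
      refine ⟨P₁, P₂, P₃, h1, h2, h3, ?_⟩
      simp only [OdesskiiElliptic.ellipticBasis_apply]
      rw [h.apply_eElem i j hmem hval, map_add, map_add, map_smul, map_smul]
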